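/- **Setting.** Let $\{f_\theta:\theta\in\Theta\subseteq\mathbb R^p\}$ be a family of probability densities with respect to a $\sigma$-finite measure $\mu$ on a measurable space with measurable singletons, $F_\theta$ the distribution with density $f_\theta$, and $u_\theta=\nabla_\theta\log f_\theta$. Let $\beta\ge0$, $\gamma\in[0,1]$, $\lambda\in\mathbb R$, $\alpha\in(0,1)$, $A=1+\lambda(1-\gamma)$, $B=\gamma-\lambda(1-\gamma)$, and let $$S_{(\gamma,\lambda)}(g,f)=\frac1A\int f^{1+\gamma}-\frac{1+\gamma}{AB}\int f^{B}g^{A}+\frac1B\int g^{1+\gamma}$$ (with the continuous limits $\int f^{1+\gamma}\log\frac fg-\frac1{1+\gamma}\int(f^{1+\gamma}-g^{1+\gamma})$ if $A=0$, and the same with $f,g$ interchanged if $B=0$). Let $\Theta_0=\{\theta\in\Theta:h(\theta)=0\}$ with $h$ taking values in $\mathbb R^r$, $r\ge1$, and let $\theta_0\in\Theta_0$ be the true parameter. For some open $\omega$ with $\theta_0\in\omega\subseteq\Theta$ assume: * $h$ is continuously differentiable on $\omega$ and the $p\times r$ matrix $H(\theta)=\partial h/\partial\theta$ has rank $r$ there;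 * (Lehmann conditions) for almost all $x$, $f_\theta(x)$ has all third derivatives on $\omega$; for $\theta\in\omega$, $E_\theta u_\theta=0$ and the Fisher information $I(\theta)=E_\theta[u_\theta u_\theta^T]=-E_\theta[\nabla^2\log f_\theta]$ is finite and positive definite; the third derivatives of $\log f_\theta(x)$ are bounded for $\theta\in\omega$ by a function $M(x)$ with $E_{\theta_0}M<\infty$; * (Basu et al. conditions for $\beta$) $\{f_\theta>0\}$ does not depend on $\theta\in\Theta$; for almost all $x$, $f_\theta(x)$ is three times continuously differentiable on $\omega$; $\int f_\theta^{1+\beta}d\mu$ and $\int f_\theta^\beta f_{\theta_0}d\mu$ can be differentiated three times on $\omega$, under the integral sign; $J_\beta(\theta_0)=\int u_{\theta_0}u_{\theta_0}^Tf_{\theta_0}^{1+\beta}$ is positive definite; the third derivatives in $\theta\in\omega$ of $\int f_\theta^{1+\beta}-(1+\frac1\beta)f_\theta^\beta(x)$ (of $-\log f_\theta(x)$ if $\beta=0$) are bounded by a function $M(x)$ with $E_{\theta_0}M<\infty$; * $\int\|u_{\theta_0}\|^2f_{\theta_0}^{1+2\beta}<\infty$, and $(\theta,\theta')\mapsto S_{(\gamma,\lambda)}(f_\theta,f_{\theta'})$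 is finite (all the integrals in its definition converge) and twice continuously differentiable near $(\theta_0,\theta_0)$. Put $J=J_\beta(\theta_0)$, $H=H(\theta_0)$, $\xi=\int u_{\theta_0}f_{\theta_0}^{1+\beta}$, $V=\int u_{\theta_0}u_{\theta_0}^Tf_{\theta_0}^{1+2\beta}-\xi\xi^T$, $P=J^{-1}-J^{-1}H(H^TJ^{-1}H)^{-1}H^TJ^{-1}$, $\widetilde\Sigma=(J^{-1}-P)V(J^{-1}-P)$, and let $A_\gamma$ be the Hessian of $\theta\mapsto S_{(\gamma,\lambda)}(f_\theta,f_{\theta_0})$ at $\theta_0$. The minimum density power divergence estimator (MDPDE) equation at a distribution $G$ is $\Psi_G(\theta):=\int u_\theta f_\theta^\beta dG-\int u_\theta f_\theta^{1+\beta}d\mu=0$, $\theta\in\Theta$; the restricted one is $\Psi_G(\theta)+H(\theta)l=0$ for some $l\in\mathbb R^r$, $h(\theta)=0$, $\theta\in\Theta$. Let $y$ be a point with $f_{\theta_0}(y)>0$ at which $\theta\mapsto f_\theta(y)$ is three times continuously differentiable on $\omega$, let $\wedge_y$ be the point mass at $y$, and let $U_\beta$, $\widetilde U_\beta$ be the corresponding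 functionals: for small $t\ge0$ their values at $(1-t)F_{\theta_0}+t\wedge_y$ solve these equations, and they tend to $\theta_0$ as $t\downarrow0$. Their influence functions are $IF(y;U,F_{\theta_0})=\frac{d}{dt}U((1-t)F_{\theta_0}+t\wedge_y)|_{t=0+}$, and $D_\beta(y,\theta_0)=IF(y;U_\beta,F_{\theta_0})-IF(y;\widetilde U_\beta,F_{\theta_0})$. For $\varepsilon\ge0$ let $F^L_{n,\varepsilon,y}=(1-\frac{\varepsilon}{\sqrt n})F_{\theta_0}+\frac{\varepsilon}{\sqrt n}\wedge_y$. For samples of size $n$ from $F^L_{n,\varepsilon,y}$ let $\widehat\theta_\beta$, $\widetilde\theta_\beta$ be consistent (for $\theta_0$) sequences which, with probability tending to $1$, are roots of the two equations at the empirical distribution, and let $T_n=2nS_{(\gamma,\lambda)}(f_{\widehat\theta_\beta},f_{\widetilde\theta_\beta})$. **Claim.** Such functionals and estimator sequences exist, and the influence functions exist. Moreover $\operatorname{rank}\big(V(J^{-1}-P)A_\gamma(J^{-1}-P)V\big)=r$, and $A_\gamma\widetilde\Sigma$ has exactly $r$ nonzero eigenvalues $\zeta_1,\dots,\zeta_r$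 (with multiplicity). Let $v_1,\dots,v_r$ be corresponding orthonormal eigenvectors of $\widetilde\Sigma^{1/2}A_\gamma\widetilde\Sigma^{1/2}$ (these exist), let $\zeta_{(1)}=\min_i\zeta_i$, and let $t_\alpha$ be the $(1-\alpha)$-quantile of $\sum_{i=1}^r\zeta_iZ_i^2$ with $Z_i$ independent standard normal. For every $\varepsilon\ge0$ and every choice of the above objects, put $\sqrt{\delta_i}=v_i^T\widetilde\Sigma^{-1/2}\varepsilon D_\beta(y,\theta_0)$ (signed root; $\widetilde\Sigma^{-1/2}$ is the Moore–Penrose inverse of $\widetilde\Sigma^{1/2}$) and $$\widetilde C_v(\theta_0,\varepsilon D_\beta(y,\theta_0))=\frac1{v!}\Big(\prod_{j=1}^r\frac{\zeta_{(1)}}{\zeta_j}\Big)^{1/2}e^{-\frac12\sum_j\delta_j}E[Q^v],\qquad Q=\frac12\sum_{j=1}^r\Big[\Big(1-\frac{\zeta_{(1)}}{\zeta_j}\Big)^{1/2}Z_j+\sqrt{\delta_j}\Big(\frac{\zeta_{(1)}}{\zeta_j}\Big)^{1/2}\Big]^2 .$$ Then: 1. Under $F^L_{n,\varepsilon,y}$,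 $T_n$ converges in distribution, $P(T_n>t)\to P(W^TA_\gamma W>t)$ for all $t\in\mathbb R$, where $W\sim N_p(\varepsilon D_\beta(y,\theta_0),\widetilde\Sigma)$, and $W^TA_\gamma W$ has the law of $\sum_{i=1}^r\zeta_i\chi^2_{1,\delta_i}$ (independent noncentral chi-squares). 2. The asymptotic level is $\displaystyle\widetilde\alpha_\varepsilon=\lim_{n\to\infty}P_{F^L_{n,\varepsilon,y}}(T_n>t_\alpha)=\sum_{v=0}^\infty\widetilde C_v(\theta_0,\varepsilon D_\beta(y,\theta_0))\,P\big(\chi^2_{r+2v}>t_\alpha/\zeta_{(1)}\big)$, a convergent series. 3. For $\varepsilon=0$, $F^L_{n,0,y}=F_{\theta_0}$, the limit law in 1 is the null law of $\sum_{i=1}^r\zeta_iZ_i^2$, and $\widetilde\alpha_0=\alpha$. -/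

import Mathlib

open MeasureTheory ProbabilityTheory Filter Topology Matrix
open scoped ENNReal NNReal

namespace SDT

noncomputable section

/-- Column vectors of length `k` with the Euclidean norm. -/
abbrev Vec (k : ℕ) : Type := EuclideanSpace ℝ (Fin k)

/-- The `j`-th coordinate vector. -/
def coordVec {p : ℕ} (j : Fin p) : Vec p := EuclideanSpace.single j 1

/-! ### The parametric model -/

section Model

variable {X : Type*} [MeasurableSpace X] {p : ℕ}

/-- `f θ`, for `θ ∈ Θ`, is a family of probability densities with respect to `μ`. -/
structure IsDensityFamily (μ : Measure X) (Θ : Set (Vec p)) (f : Vec p → X → ℝ) : Prop where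
  measurable : ∀ θ ∈ Θ, Measurable (f θ)
  nonneg : ∀ θ ∈ Θ, ∀ x, 0 ≤ f θ x
  integral_eq_one : ∀ θ ∈ Θ, ∫ x, f θ x ∂μ = 1

/-- The model distribution `F_θ`. -/
def modelMeasure (μ : Measure X) (f : Vec p → X → ℝ) (θ : Vec p) : Measure X :=
  μ.withDensity (fun x => ENNReal.ofReal (f θ x))

/-- The likelihood score `u_θ(x) = ∇_θ log f_θ(x)`. -/
def score (f : Vec p → X → ℝ) (θ : Vec p) (x : X) : Vec p :=
  gradient (fun t => Real.log (f t x)) θ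

/-- The second order partial derivative `∂_j ∂_k log f_θ(x)`. -/
def logHess (f : Vec p → X → ℝ) (θ : Vec p) (x : X) (j k : Fin p) : ℝ :=
  iteratedFDeriv ℝ 2 (fun t => Real.log (f t x)) θ ![coordVec j, coordVec k]

/-- The Fisher information matrix `I(θ)`. -/
def fisher (μ : Measure X) (f : Vec p → X → ℝ) (θ : Vec p) : Matrix (Fin p) (Fin p) ℝ :=
  Matrix.of fun j k => ∫ x, score f θ x j * score f θ x k * f θ x ∂μ

/-- `J_β(θ) = ∫ u_θ u_θᵀ f_θ^{1+β}`. -/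
def Jmat (μ : Measure X) (f : Vec p → X → ℝ) (β : ℝ) (θ : Vec p) : Matrix (Fin p) (Fin p) ℝ :=
  Matrix.of fun j k => ∫ x, score f θ x j * score f θ x k * f θ x ^ (1 + β) ∂μ

/-- `ξ_β(θ) = ∫ u_θ f_θ^{1+β}`. -/
def xiVec (μ : Measure X) (f : Vec p → X → ℝ) (β : ℝ) (θ : Vec p) : Vec p :=
  ∫ x, (f θ x ^ (1 + β)) • score f θ x ∂μ

/-- `V_β(θ) = ∫ u_θ u_θᵀ f_θ^{1+2β} - ξ_β(θ) ξ_β(θ)ᵀ`. -/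
def Vmat (μ : Measure X) (f : Vec p → X → ℝ) (β : ℝ) (θ : Vec p) : Matrix (Fin p) (Fin p) ℝ :=
  Matrix.of fun j k =>
    (∫ x, score f θ x j * score f θ x k * f θ x ^ (1 + 2 * β) ∂μ)
      - xiVec μ f β θ j * xiVec μ f β θ k

/-- The summand of the empirical density power divergence,
`∫ f_θ^{1+β} - (1 + 1/β) f_θ(x)^β`, and `-log f_θ(x)` (the limit up to a constant) for `β = 0`. -/
def dpdLoss (μ : Measure X) (f : Vec p → X → ℝ) (β : ℝ) (θ : Vec p) (x : X) : ℝ :=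
  if β = 0 then -Real.log (f θ x)
  else (∫ z, f θ z ^ (1 + β) ∂μ) - (1 + 1 / β) * f θ x ^ β

/-- On `ω`, the integral `∫ F θ x dμ(x)` can be differentiated `k` times with respect to `θ`,
and the derivatives can be taken under the integral sign. -/
def DiffUnderIntegral (μ : Measure X) (k : ℕ) (ω : Set (Vec p)) (F : Vec p → X → ℝ) : Prop :=
  (∀ j ≤ k, ∀ θ ∈ ω, Integrable (fun x => iteratedFDeriv ℝ j (fun t => F t x) θ) μ) ∧
  (∀ j < k, ∀ θ ∈ ω,
    HasFDerivAt (fun s => ∫ x, iteratedFDeriv ℝ j (fun t => F t x) s ∂μ)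
      (∫ x, fderiv ℝ (iteratedFDeriv ℝ j (fun t => F t x)) θ ∂μ) θ)

/-- Lehmann's conditions (A)-(D) at the parameter value `θ₀`, with neighbourhood `ω`.  The
coordinatewise bounds in (D) are stated, equivalently, for the full third derivative. -/
structure LehmannConditions (μ : Measure X) (Θ ω : Set (Vec p)) (f : Vec p → X → ℝ)
    (θ₀ : Vec p) : Prop where
  isOpen : IsOpen ω
  subset : ω ⊆ Θ
  mem : θ₀ ∈ ω
  third_deriv : ∀ᵐ x ∂μ, ∀ k ≤ 2, DifferentiableOn ℝ (iteratedFDeriv ℝ k (fun t => f t x)) ω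
  score_mean : ∀ θ ∈ ω, ∫ x, f θ x • score f θ x ∂μ = 0
  hess_integrable : ∀ θ ∈ ω, ∀ j k, Integrable (fun x => logHess f θ x j k * f θ x) μ
  fisher_eq : ∀ θ ∈ ω, ∀ j k, fisher μ f θ j k = -∫ x, logHess f θ x j k * f θ x ∂μ
  fisher_finite : ∀ θ ∈ ω, ∀ j k,
    Integrable (fun x => score f θ x j * score f θ x k * f θ x) μ
  fisher_posDef : ∀ θ ∈ ω, (fisher μ f θ).PosDef
  third_bound : ∃ M : X → ℝ, Integrable M (modelMeasure μ f θ₀) ∧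
    ∀ᵐ x ∂(modelMeasure μ f θ₀), ∀ θ ∈ ω,
      ‖iteratedFDeriv ℝ 3 (fun t => Real.log (f t x)) θ‖ ≤ M x

/-- The Basu et al. conditions (D1)-(D5) for the tuning parameter `β`, at the true density
`g = f_{θ₀}`, with neighbourhood `ω`. -/
structure BasuConditions (μ : Measure X) (Θ ω : Set (Vec p)) (f : Vec p → X → ℝ) (β : ℝ)
    (θ₀ : Vec p) : Prop where
  isOpen : IsOpen ω
  subset : ω ⊆ Θ
  mem : θ₀ ∈ ω
  common_support : ∀ θ ∈ Θ, ∀ x, 0 < f θ x ↔ 0 < f θ₀ x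
  smooth : ∀ᵐ x ∂μ, ContDiffOn ℝ 3 (fun t => f t x) ω
  diff_integral_model : DiffUnderIntegral μ 3 ω (fun θ x => f θ x ^ (1 + β))
  diff_integral_cross : DiffUnderIntegral μ 3 ω (fun θ x => f θ x ^ β * f θ₀ x)
  J_posDef : (Jmat μ f β θ₀).PosDef
  third_bound : ∃ M : X → ℝ, Integrable M (modelMeasure μ f θ₀) ∧
    ∀ᵐ x ∂(modelMeasure μ f θ₀), ∀ θ ∈ ω,
      ‖iteratedFDeriv ℝ 3 (fun t => dpdLoss μ f β t x) θ‖ ≤ M x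

end Model

/-! ### The `S`-divergence -/

section Divergence

variable {X : Type*} [MeasurableSpace X]

/-- `A = 1 + λ (1 - γ)`. -/
def Aof (γ lam : ℝ) : ℝ := 1 + lam * (1 - γ)

/-- `B = γ - λ (1 - γ)`. -/
def Bof (γ lam : ℝ) : ℝ := γ - lam * (1 - γ)

/-- The `S`-divergence `S_{(γ,λ)}(g, f)`; the cases `A = 0` and `B = 0` are the continuous
limits. -/
def SDiv (μ : Measure X) (γ lam : ℝ) (g f : X → ℝ) : ℝ :=
  if Aof γ lam = 0 then
    (∫ x, f x ^ (1 + γ) * Real.log (f x / g x) ∂μ)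
      - ((∫ x, f x ^ (1 + γ) ∂μ) - ∫ x, g x ^ (1 + γ) ∂μ) / (1 + γ)
  else if Bof γ lam = 0 then
    (∫ x, g x ^ (1 + γ) * Real.log (g x / f x) ∂μ)
      - ((∫ x, g x ^ (1 + γ) ∂μ) - ∫ x, f x ^ (1 + γ) ∂μ) / (1 + γ)
  else
    1 / Aof γ lam * (∫ x, f x ^ (1 + γ) ∂μ)
      - (1 + γ) / (Aof γ lam * Bof γ lam) * (∫ x, f x ^ Bof γ lam * g x ^ Aof γ lam ∂μ)
      + 1 / Bof γ lam * (∫ x, g x ^ (1 + γ) ∂μ)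

/-- All the integrals in the definition of `S_{(γ,λ)}(g, f)` are finite. -/
def SDivFinite (μ : Measure X) (γ lam : ℝ) (g f : X → ℝ) : Prop :=
  Integrable (fun x => f x ^ (1 + γ)) μ ∧ Integrable (fun x => g x ^ (1 + γ)) μ ∧
  (if Aof γ lam = 0 then Integrable (fun x => f x ^ (1 + γ) * Real.log (f x / g x)) μ
   else if Bof γ lam = 0 then Integrable (fun x => g x ^ (1 + γ) * Real.log (g x / f x)) μ
   else Integrable (fun x => f x ^ Bof γ lam * g x ^ Aof γ lam) μ)

variable {p : ℕ}

/-- Near `(θ₀, θ₀)` the divergence `(θ, θ') ↦ S_{(γ,λ)}(f_θ, f_θ')` is finite and twice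
continuously differentiable. -/
def SDivRegular (μ : Measure X) (f : Vec p → X → ℝ) (γ lam : ℝ) (θ₀ : Vec p) : Prop :=
  (∀ᶠ q : Vec p × Vec p in 𝓝 (θ₀, θ₀), SDivFinite μ γ lam (f q.1) (f q.2)) ∧
  ContDiffAt ℝ 2 (fun q : Vec p × Vec p => SDiv μ γ lam (f q.1) (f q.2)) (θ₀, θ₀)

/-- The matrix `A_γ(θ₀)`: the Hessian of `θ ↦ S_{(γ,λ)}(f_θ, f_{θ₀})` at `θ₀`. -/
def Amat (μ : Measure X) (f : Vec p → X → ℝ) (γ lam : ℝ) (θ₀ : Vec p) :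
    Matrix (Fin p) (Fin p) ℝ :=
  Matrix.of fun j k =>
    iteratedFDeriv ℝ 2 (fun θ => SDiv μ γ lam (f θ) (f θ₀)) θ₀ ![coordVec j, coordVec k]

end Divergence

/-! ### Restrictions, estimating equations, functionals and influence functions -/

section Estimation

variable {X : Type*} [MeasurableSpace X] {p r : ℕ}

/-- The `p × r` matrix `H(θ) = ∂h(θ)/∂θ`. -/
def Hmat (h : Vec p → Vec r) (θ : Vec p) : Matrix (Fin p) (Fin r) ℝ :=
  Matrix.of fun j k => fderiv ℝ h θ (coordVec j) k

/-- The estimating function of the minimum density power divergence method at a distribution `G`: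
`∫ u_θ f_θ^β dG - ∫ u_θ f_θ^{1+β} dμ`. -/
def estFun (μ : Measure X) (f : Vec p → X → ℝ) (β : ℝ) (G : Measure X) (θ : Vec p) : Vec p :=
  (∫ x, (f θ x ^ β) • score f θ x ∂G) - ∫ x, (f θ x ^ (1 + β)) • score f θ x ∂μ

/-- `θ` solves the unrestricted estimating equation at `G`. -/
def IsRootU (μ : Measure X) (Θ : Set (Vec p)) (f : Vec p → X → ℝ) (β : ℝ)
    (G : Measure X) (θ : Vec p) : Prop :=
  θ ∈ Θ ∧ estFun μ f β G θ = 0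

/-- `θ` solves the restricted estimating equations at `G`, with some Lagrange multiplier `l`. -/
def IsRootR (μ : Measure X) (Θ : Set (Vec p)) (f : Vec p → X → ℝ) (β : ℝ) (h : Vec p → Vec r)
    (G : Measure X) (θ : Vec p) : Prop :=
  θ ∈ Θ ∧ h θ = 0 ∧ ∃ l : Fin r → ℝ, (estFun μ f β G θ).ofLp + Hmat h θ *ᵥ l = 0

/-- The contaminated distribution `(1 - t) F + t ∧_y`, with `∧_y` degenerate at `y`. -/
def contam (F : Measure X) (t : ℝ) (y : X) : Measure X :=
  ENNReal.ofReal (1 - t) • F + ENNReal.ofReal t • Measure.dirac y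

/-- Hampel's influence function of the functional `U` at `F`: the derivative of
`U((1 - t) F + t ∧_y)` at `t = 0` (over contamination proportions `t ≥ 0`). -/
def influence (U : Measure X → Vec p) (F : Measure X) (y : X) : Vec p :=
  derivWithin (fun t => U (contam F t y)) (Set.Ici 0) 0

/-- `U` is a version of the statistical functional defined by the estimating equations `root`:
along the contaminated distributions it is a root that tends to `θ₀` (so `U F = θ₀`). -/
structure IsRootFunctional (root : Measure X → Vec p → Prop) (F : Measure X) (y : X)
    (θ₀ : Vec p) (U : Measure X → Vec p) : Prop where
  root_eventually : ∀ᶠ t in 𝓝[≥] (0 : ℝ), root (contam F t y) (U (contam F t y))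
  tendsto : Tendsto (fun t => U (contam F t y)) (𝓝[≥] (0 : ℝ)) (𝓝 θ₀)

/-- The empirical distribution of a sample. -/
def empirical {n : ℕ} (x : Fin n → X) : Measure X :=
  (n : ℝ≥0∞)⁻¹ • ∑ i, Measure.dirac (x i)

/-- The contaminated distribution `F^L_{n,ε,y} = (1 - ε/√n) F + (ε/√n) ∧_y` for the level. -/
def levelContam (F : Measure X) (ε : ℝ) (y : X) (n : ℕ) : Measure X :=
  contam F (ε / √(n : ℝ)) y

/-- The law of an i.i.d. sample of size `n` from `Q n`. -/
def sampleLaw (Q : ℕ → Measure X) (n : ℕ) : Measure (Fin n → X) :=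
  Measure.pi fun _ => Q n

/-- `T n` is, for i.i.d. samples of size `n` from `Q n`, a consistent sequence of roots of the
estimating equations `root` (at the empirical distribution), with probability tending to one. -/
structure IsConsistentRoot (root : Measure X → Vec p → Prop) (Q : ℕ → Measure X) (θ₀ : Vec p)
    (T : (n : ℕ) → (Fin n → X) → Vec p) : Prop where
  root_whp : Tendsto (fun n => sampleLaw Q n {x | ¬ root (empirical x) (T n x)}) atTop (𝓝 0)
  consistent : ∀ η > 0, Tendsto (fun n => sampleLaw Q n {x | η ≤ dist (T n x) θ₀}) atTop (𝓝 0)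

/-- The test statistic `2 n S_{(γ,λ)}(f_θ̂, f_θ̃)`. -/
def sdtStat (μ : Measure X) (f : Vec p → X → ℝ) (γ lam : ℝ)
    (That Ttil : (n : ℕ) → (Fin n → X) → Vec p) (n : ℕ) (x : Fin n → X) : ℝ :=
  2 * n * SDiv μ γ lam (f (That n x)) (f (Ttil n x))

/-- `P_β(θ) = J⁻¹ - J⁻¹ H (Hᵀ J⁻¹ H)⁻¹ Hᵀ J⁻¹`, with `J = J_β(θ)` and `H = H(θ)`. -/
def Pmat (μ : Measure X) (f : Vec p → X → ℝ) (β : ℝ) (h : Vec p → Vec r) (θ : Vec p) :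
    Matrix (Fin p) (Fin p) ℝ :=
  (Jmat μ f β θ)⁻¹ - (Jmat μ f β θ)⁻¹ * Hmat h θ *
    ((Hmat h θ)ᵀ * (Jmat μ f β θ)⁻¹ * Hmat h θ)⁻¹ * (Hmat h θ)ᵀ * (Jmat μ f β θ)⁻¹

/-- `Σ̃_β(θ) = [J⁻¹ - P] V [J⁻¹ - P]`. -/
def SigmaTilde (μ : Measure X) (f : Vec p → X → ℝ) (β : ℝ) (h : Vec p → Vec r) (θ : Vec p) :
    Matrix (Fin p) (Fin p) ℝ :=
  ((Jmat μ f β θ)⁻¹ - Pmat μ f β h θ) * Vmat μ f β θ * ((Jmat μ f β θ)⁻¹ - Pmat μ f β h θ)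

/-- The matrix `V [J⁻¹ - P] A [J⁻¹ - P] V`. -/
def rankMat (μ : Measure X) (f : Vec p → X → ℝ) (β γ lam : ℝ) (h : Vec p → Vec r) (θ : Vec p) :
    Matrix (Fin p) (Fin p) ℝ :=
  Vmat μ f β θ * ((Jmat μ f β θ)⁻¹ - Pmat μ f β h θ) * Amat μ f γ lam θ *
    ((Jmat μ f β θ)⁻¹ - Pmat μ f β h θ) * Vmat μ f β θ

end Estimation

/-! ### Limit laws -/

section Limit

variable {p r : ℕ}

/-- The positive semidefinite square root `S^{1/2}` of a positive semidefinite matrix. -/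
def sqrtMat (S : Matrix (Fin p) (Fin p) ℝ) : Matrix (Fin p) (Fin p) ℝ :=
  cfc Real.sqrt S

/-- `S^{-1/2}` for a positive semidefinite, possibly singular, matrix: the Moore-Penrose inverse of
`S^{1/2}` (here `(√0)⁻¹ = 0`). -/
def invSqrtMat (S : Matrix (Fin p) (Fin p) ℝ) : Matrix (Fin p) (Fin p) ℝ :=
  cfc (fun x : ℝ => (√x)⁻¹) S

/-- `ζ 0, …, ζ (r-1)` are the nonzero eigenvalues of `A S`, with multiplicity, and the `v i` are
corresponding orthonormal eigenvectors of the symmetric matrix `S^{1/2} A S^{1/2}`, which has the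
same eigenvalues as `A S`. -/
structure IsSpectralSystem (A S : Matrix (Fin p) (Fin p) ℝ) (ζ : Fin r → ℝ)
    (v : Fin r → Vec p) : Prop where
  eigenvalues : (A * S).charpoly.roots.filter (fun z => z ≠ 0) = Finset.univ.val.map ζ
  orthonormal : Orthonormal ℝ v
  eigenvectors : ∀ i, (sqrtMat S * A * sqrtMat S) *ᵥ (v i).ofLp = ζ i • (v i).ofLp

/-- The (signed) roots `√δ_i = v_iᵀ S^{-1/2} m` of the noncentralities `δ_i`. -/
def sqrtDelta (S : Matrix (Fin p) (Fin p) ℝ) (v : Fin r → Vec p) (m : Vec p) (i : Fin r) : ℝ :=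
  (v i).ofLp ⬝ᵥ (invSqrtMat S *ᵥ m.ofLp)

/-- The law of `Wᵀ A W` with `W ∼ N_p(m, S)`. -/
def quadFormLaw (A S : Matrix (Fin p) (Fin p) ℝ) (m : Vec p) : Measure ℝ :=
  (multivariateGaussian m S).map fun w => w.ofLp ⬝ᵥ (A *ᵥ w.ofLp)

/-- The law of independent standard normal variables `Z_1, …, Z_k`. -/
def stdNormals (k : ℕ) : Measure (Fin k → ℝ) := Measure.pi fun _ => gaussianReal 0 1

/-- The law of `∑ ζ_i χ²_{1,δ_i}` with independent noncentral chi-square variables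
`(Z_i + s_i)²`, where `δ_i = s_i²`. -/
def wtdChiSqLaw (ζ s : Fin r → ℝ) : Measure ℝ :=
  (stdNormals r).map fun z => ∑ i, ζ i * (z i + s i) ^ 2

/-- The central chi-square law with `k` degrees of freedom. -/
def chiSqLaw (k : ℕ) : Measure ℝ := (stdNormals k).map fun z => ∑ i, z i ^ 2

/-- The `q`-quantile of a law on the line. -/
def quantile (ν : Measure ℝ) (q : ℝ) : ℝ := sInf {t : ℝ | q ≤ ν.real (Set.Iic t)}

/-- `ζ_(1)`, the minimum of the `ζ_i`. -/
def zetaMin (ζ : Fin r → ℝ) : ℝ := ⨅ i, ζ i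

/-- `Q = ½ ∑ [(1 - ζ_(1)/ζ_j)^{1/2} Z_j + √δ_j (ζ_(1)/ζ_j)^{1/2}]²`. -/
def mixQ (ζ s : Fin r → ℝ) (z : Fin r → ℝ) : ℝ :=
  (1 / 2) * ∑ j, (√(1 - zetaMin ζ / ζ j) * z j + s j * √(zetaMin ζ / ζ j)) ^ 2

/-- The mixture coefficient
`C_k = (1/k!) (∏ ζ_(1)/ζ_j)^{1/2} exp(-½ ∑ δ_j) E[Q^k]`. -/
def mixCoeff (ζ s : Fin r → ℝ) (k : ℕ) : ℝ :=
  1 / (Nat.factorial k : ℝ) * √(∏ j, zetaMin ζ / ζ j) * Real.exp (-(1 / 2) * ∑ j, s j ^ 2)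
    * ∫ z, mixQ ζ s z ^ k ∂(stdNormals r)

/-- The term `C_k P(χ²_{r+2k} > t / ζ_(1))`. -/
def seriesTerm (ζ s : Fin r → ℝ) (t : ℝ) (k : ℕ) : ℝ :=
  mixCoeff ζ s k * (chiSqLaw (r + 2 * k)).real (Set.Ioi (t / zetaMin ζ))

end Limit

end

end SDT

namespace SDT

set_option maxSynthPendingDepth 3

noncomputable section

/-! ### Roots of constrained estimating equations -/

section Roots

/-! The estimating equation at `G` reads `∫ ψ_θ dG = 0` with `ψ_θ = f_θ^β u_θ - ξ(θ)`, which is the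
gradient in `θ` of an explicit objective. Under the model at `θ₀` this `ψ` has mean `0`, mean
derivative `-J` and covariance `V`, and the third-derivative bound controls how far it is from
linear. The analysis of roots is therefore deterministic: only a few integrals against `G` have to
be close to their model values (`NearModel`). Then a constrained maximum of the objective is a root
(`exists_constrained_root`), and every root near `θ₀` is `θ₀ + P Ψ + o(‖Ψ‖)` with `Ψ = ∫ ψ_{θ₀} dG`
(`constrained_root_expansion`). The unrestricted case is `r = 0`, where `P = J⁻¹`.

For the contaminated distributions `Ψ = t ψ(y)`, so the influence functions are `J⁻¹ ψ(y)` and `P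
ψ(y)`, and `D = K ψ(y)` with `K = J⁻¹ - P` (`projMat`). For empirical distributions, `√n (θ̂ - θ̃)`
is asymptotically `K W_n`, where `W_n` is the normalized sum of the `ψ(x_i)`. A point mass of weight
`ε/√n` shifts the limit of `W_n` by exactly `ε ψ(y)` and leaves its covariance unchanged, so `W_n`
converges to `N(ε ψ(y), V)` (`exists_tendsto_normalized_sum`).

The `S`-divergence is nonnegative and vanishes on the diagonal. Its Hessian at `(θ₀, θ₀)` hence has
the diagonal directions in its kernel and depends only on the difference of the two arguments,
through `A_γ`. So `T_n` is asymptotically the quadratic form of `A_γ` at `K W_n`, with limiting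
vector `N(ε D, K V K)`; this is made precise by `tendsto_sampleLaw_lt`. Nondegeneracy of the Fisher
information makes `V` positive definite (`BasuConditions.posDef_Vmat`) and, through Fatou's lemma,
`A_γ` as well (`SDivRegular.posDef_Amat`). Since `K` has rank `r`, there are exactly `r` nonzero
eigenvalues, all positive.

Diagonalizing turns the limit law into a weighted sum of noncentral chi-squares
(`quadFormLaw_eq_wtdChiSqLaw`). It equals the stated mixture of scaled central chi-squares because
both have the same exponential moments near `0` (`wtdChiSqLaw_eq_mixLaw`), and it has no atoms,
which gives convergence at every threshold and level exactly `α` at `ε = 0`. -/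

/-- A root of the Lagrange equations near `θ₀` is, to first order, `θ₀ + P Ψ(θ₀)`. -/
theorem constrained_root_expansion {E R : Type*} [NormedAddCommGroup E] [NormedSpace ℝ E]
    [NormedAddCommGroup R] [NormedSpace ℝ R] {J P : E →L[ℝ] E} {Hc : R →L[ℝ] E} {Ht : E →L[ℝ] R}
    {N : R →L[ℝ] E} {N' : E →L[ℝ] R} (hPJ : ∀ d, P (J d) = d - N (Ht d))
    (hPH : ∀ l, P (Hc l) = 0) (hN' : ∀ l, N' (Hc l) = l) {h : E → R} {θ₀ : E}
    (hd : HasFDerivAt h Ht θ₀) (h0 : h θ₀ = 0) {Hf : E → R →L[ℝ] E} (hHf : ContinuousAt Hf θ₀)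
    (hHc : Hf θ₀ = Hc) {κ' : ℝ} (hκ' : 0 < κ') :
    ∃ κ > 0, ∀ (θ : E) (l : R) (Ψ₀ Ψθ : E), ‖θ - θ₀‖ ≤ κ →
      ‖Ψθ - Ψ₀ + J (θ - θ₀)‖ ≤ κ * ‖θ - θ₀‖ → h θ = 0 → Ψθ + Hf θ l = 0 →
      ‖θ - θ₀ - P Ψ₀‖ ≤ κ' * ‖Ψ₀‖ := by
  set a := ‖N'‖ with ha
  set C1 := ‖N‖ + ‖P‖ + ‖P‖ * (2 * a * (‖J‖ + 1)) with hC1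
  have ha0 : 0 ≤ a := norm_nonneg _
  have hC0 : 0 ≤ C1 := by positivity
  -- `c` bounds all relative errors. The condition `a * c ≤ 1 / 2` absorbs `‖l‖` in the bound for
  -- the multiplier, `c * C1 ≤ 1 / 2` absorbs `‖d‖` in the bound for `d`, and the last one turns the
  -- remainder into `κ'`.
  obtain ⟨c, hc0, hcl, hc1, hc2, hc3⟩ : ∃ c > 0, c ≤ 1 ∧ a * c ≤ 1 / 2 ∧ c * C1 ≤ 1 / 2 ∧
      c * C1 * (2 * ‖P‖ + 2) ≤ κ' := by
    have h1 : ∀ᶠ c in 𝓝[>] (0 : ℝ), a * c < 1 / 2 := by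
      refine (Tendsto.mono_left ?_ nhdsWithin_le_nhds).eventually (gt_mem_nhds (by norm_num : (0:ℝ) < 1/2))
      have : Continuous fun c : ℝ => a * c := by fun_prop
      simpa using this.tendsto 0
    have h2 : ∀ᶠ c in 𝓝[>] (0 : ℝ), c * C1 < 1 / 2 := by
      refine (Tendsto.mono_left ?_ nhdsWithin_le_nhds).eventually (gt_mem_nhds (by norm_num : (0:ℝ) < 1/2))
      have : Continuous fun c : ℝ => c * C1 := by fun_prop
      simpa using this.tendsto 0
    have h3 : ∀ᶠ c in 𝓝[>] (0 : ℝ), c * C1 * (2 * ‖P‖ + 2) < κ' := by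
      refine (Tendsto.mono_left ?_ nhdsWithin_le_nhds).eventually (gt_mem_nhds hκ')
      have : Continuous fun c : ℝ => c * C1 * (2 * ‖P‖ + 2) := by fun_prop
      simpa using this.tendsto 0
    have h0 : ∀ᶠ c in 𝓝[>] (0 : ℝ), c < 1 :=
      nhdsWithin_le_nhds (gt_mem_nhds one_pos)
    obtain ⟨c, ⟨⟨⟨h0, h1⟩, h2⟩, h3⟩, h4⟩ :=
      ((((h0.and h1).and h2).and h3).and (self_mem_nhdsWithin : ∀ᶠ c in 𝓝[>] (0 : ℝ), c ∈ Set.Ioi 0)).exists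
    exact ⟨c, h4, h0.le, h1.le, h2.le, h3.le⟩
  have e1 : ∀ᶠ θ in 𝓝 θ₀, ‖h θ - h θ₀ - Ht (θ - θ₀)‖ ≤ c * ‖θ - θ₀‖ := hd.isLittleO.def hc0
  have e2 : ∀ᶠ θ in 𝓝 θ₀, ‖Hf θ - Hc‖ ≤ c := by
    have := (tendsto_iff_norm_sub_tendsto_zero.1 hHf.tendsto).eventually (gt_mem_nhds hc0)
    filter_upwards [this] with θ hθ
    rw [hHc] at hθ; exact hθ.le
  obtain ⟨η, hη, hball⟩ := Metric.nhds_basis_closedBall.eventually_iff.1 (e1.and e2)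
  refine ⟨min c η, lt_min hc0 hη, fun θ l Ψ₀ Ψθ hθ hΨ hhθ hroot => ?_⟩
  obtain ⟨h1, h2⟩ := hball (show θ ∈ Metric.closedBall θ₀ η by
    simpa [dist_eq_norm] using hθ.trans (min_le_right _ _))
  set d := θ - θ₀ with hdd
  have hE1 : ‖Ψθ - Ψ₀ + J d‖ ≤ c * ‖d‖ :=
    hΨ.trans (mul_le_mul_of_nonneg_right (min_le_left _ _) (norm_nonneg _))
  have hE2 : ‖Ht d‖ ≤ c * ‖d‖ := by simpa [hhθ, h0] using h1
  have hE3 : ‖(Hf θ - Hc) l‖ ≤ c * ‖l‖ :=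
    ((Hf θ - Hc).le_opNorm l).trans (mul_le_mul_of_nonneg_right h2 (norm_nonneg _))
  set E1 := Ψθ - Ψ₀ + J d
  set E3 := (Hf θ - Hc) l with hE3d
  -- The Lagrange equation with `Ψθ` replaced by its linearization and `Hf θ` by `Hc`, the errors
  -- being `E1` and `E3`.
  have hJd : J d = Ψ₀ + E1 + Hc l + E3 := by
    have : Hf θ l = Hc l + E3 := by simp [hE3d]
    rw [this] at hroot
    have h' : Ψθ = -(Hc l + E3) := eq_neg_of_add_eq_zero_left hroot
    simp only [E1, h']; abel
  -- The left inverse `N'` of `Hc` solves `hJd` for the multiplier, which is thus controlled by `d`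
  -- and `Ψ₀`.
  have hl : ‖l‖ ≤ 2 * a * ((‖J‖ + 1) * ‖d‖ + ‖Ψ₀‖) := by
    have h1 : l = N' (J d - Ψ₀ - E1 - E3) := by
      rw [hJd, ← hN' l]; congr 1; rw [hN' l]; abel
    have h2 : ‖l‖ ≤ a * (‖J‖ * ‖d‖ + ‖Ψ₀‖ + c * ‖d‖ + c * ‖l‖) := by
      calc ‖l‖ = ‖N' (J d - Ψ₀ - E1 - E3)‖ := by rw [← h1]
        _ ≤ a * ‖J d - Ψ₀ - E1 - E3‖ := N'.le_opNorm _
        _ ≤ a * (‖J d‖ + ‖Ψ₀‖ + ‖E1‖ + ‖E3‖) := by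
            gcongr
            exact (norm_sub_le _ _).trans (add_le_add_left ((norm_sub_le _ _).trans
              (add_le_add_left (norm_sub_le _ _) _)) _)
        _ ≤ _ := by gcongr; exact J.le_opNorm d
    have h4 : a * c * ‖l‖ ≤ 1 / 2 * ‖l‖ := mul_le_mul_of_nonneg_right hc1 (norm_nonneg _)
    have h6 : a * (c * ‖d‖) ≤ a * (1 * ‖d‖) := by gcongr
    nlinarith
  -- `P` removes the multiplier term. What `P J` leaves besides `d` is `N (Ht d)`, which is small
  -- because `h` vanishes at both `θ` and `θ₀`.
  have hdP : d - P Ψ₀ = N (Ht d) + P E1 + P E3 := by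
    have h1 : P (J d) = P Ψ₀ + P E1 + P E3 := by rw [hJd]; simp [hPH]
    rw [hPJ] at h1
    rw [sub_eq_iff_eq_add] at h1
    rw [sub_eq_iff_eq_add]
    refine h1.trans ?_
    abel
  have hmain : ‖d - P Ψ₀‖ ≤ c * C1 * (‖d‖ + ‖Ψ₀‖) := by
    have h1 : ‖d - P Ψ₀‖ ≤ ‖N‖ * (c * ‖d‖) + ‖P‖ * (c * ‖d‖) +
        ‖P‖ * (c * (2 * a * ((‖J‖ + 1) * ‖d‖ + ‖Ψ₀‖))) := by
      rw [hdP]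
      refine (norm_add₃_le).trans ?_
      gcongr
      · exact (N.le_opNorm _).trans (by gcongr)
      · exact (P.le_opNorm _).trans (by gcongr)
      · exact (P.le_opNorm _).trans (by gcongr; exact hE3.trans (by gcongr))
    refine h1.trans ?_
    have h2 : 0 ≤ c * ‖N‖ * ‖Ψ₀‖ := by positivity
    have h3 : 0 ≤ c * ‖P‖ * ‖Ψ₀‖ := by positivity
    have h4 : 0 ≤ c * ‖P‖ * (2 * a) * ‖J‖ * ‖Ψ₀‖ := by positivity
    rw [hC1]
    nlinarith
  have hdn : ‖d‖ ≤ (2 * ‖P‖ + 1) * ‖Ψ₀‖ := by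
    have h1 : ‖d‖ ≤ ‖d - P Ψ₀‖ + ‖P Ψ₀‖ := by
      simpa using norm_add_le (d - P Ψ₀) (P Ψ₀)
    have h2 := P.le_opNorm Ψ₀
    have h3 : c * C1 * (‖d‖ + ‖Ψ₀‖) ≤ 1 / 2 * (‖d‖ + ‖Ψ₀‖) := by gcongr
    nlinarith
  calc ‖d - P Ψ₀‖ ≤ c * C1 * (‖d‖ + ‖Ψ₀‖) := hmain
    _ ≤ c * C1 * ((2 * ‖P‖ + 1) * ‖Ψ₀‖ + ‖Ψ₀‖) := by gcongr
    _ = c * C1 * (2 * ‖P‖ + 2) * ‖Ψ₀‖ := by ring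
    _ ≤ κ' * ‖Ψ₀‖ := by gcongr

/-- A constrained maximum of a potential gives a root of the Lagrange equations near `θ₀`. -/
theorem exists_constrained_root {E R : Type*} [NormedAddCommGroup E] [InnerProductSpace ℝ E]
    [FiniteDimensional ℝ E] [NormedAddCommGroup R] [InnerProductSpace ℝ R] [FiniteDimensional ℝ R]
    {J : E →L[ℝ] E} {c ρ : ℝ} (hc : 0 < c) (hJ : ∀ d, c * ‖d‖ ^ 2 ≤ inner ℝ (J d) d)
    {h : E → R} {h' : E → E →L[ℝ] R} {θ₀ : E}
    (hd : ∀ θ ∈ Metric.closedBall θ₀ ρ, HasStrictFDerivAt h (h' θ) θ)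
    (hsurj : ∀ θ ∈ Metric.closedBall θ₀ ρ, Function.Surjective (h' θ)) (h0 : h θ₀ = 0)
    {Ψ : E → E} {L : E → ℝ} {κ : ℝ≥0} (hκ : (κ : ℝ) ≤ c / 2)
    (hΨ : ApproximatesLinearOn Ψ (-J) (Metric.closedBall θ₀ ρ) κ)
    (hL : ∀ θ ∈ Metric.closedBall θ₀ ρ, HasGradientAt L (Ψ θ) θ) (hs : 4 / c * ‖Ψ θ₀‖ < ρ) :
    ∃ θ, ‖θ - θ₀‖ ≤ 4 / c * ‖Ψ θ₀‖ ∧ h θ = 0 ∧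
      ∃ l : R, Ψ θ + ContinuousLinearMap.adjoint (h' θ) l = 0 := by
  have hρ : 0 < ρ := lt_of_le_of_lt (by positivity) hs
  have hmem0 : θ₀ ∈ Metric.closedBall θ₀ ρ := Metric.mem_closedBall_self hρ.le
  have hcompact : IsCompact (Metric.closedBall θ₀ ρ ∩ h ⁻¹' {0}) := by
    refine (isCompact_closedBall θ₀ ρ).of_isClosed_subset ?_ Set.inter_subset_left
    exact ContinuousOn.preimage_isClosed_of_isClosed
      (fun θ hθ => (hd θ hθ).continuousAt.continuousWithinAt) Metric.isClosed_closedBall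
      isClosed_singleton
  -- The root is a maximum point of the potential on the compact set of constrained points of the
  -- ball.
  obtain ⟨θ, ⟨hθ, hhθ⟩, hmax⟩ := hcompact.exists_isMaxOn ⟨θ₀, hmem0, h0⟩
    (f := L) (fun θ hθ => (hL θ hθ.1).continuousAt.continuousWithinAt)
  set d := θ - θ₀ with hdd
  have hseg : ∀ s ∈ Set.Icc (0:ℝ) 1, θ₀ + s • d ∈ Metric.closedBall θ₀ ρ := by
    intro s hs
    have : ‖d‖ ≤ ρ := by simpa [dist_eq_norm] using hθ
    simp only [Metric.mem_closedBall, dist_eq_norm, add_sub_cancel_left, norm_smul,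
      Real.norm_eq_abs, abs_of_nonneg hs.1]
    nlinarith [hs.2, norm_nonneg d, hs.1]
  have hbound : ‖d‖ ≤ 4 / c * ‖Ψ θ₀‖ := by
    -- Along the segment from `θ₀` to `θ` the slope of `L` at time `s` is at most `‖Ψ θ₀‖ ‖d‖ - s
    -- (c/2) ‖d‖²`, by coercivity of `J` and `κ ≤ c / 2`. So `χ` decreases; with `L θ₀ ≤ L θ` this
    -- gives `(c/4) ‖d‖² ≤ ‖Ψ θ₀‖ ‖d‖`. The segment may leave the constraint set, since `L` is
    -- differentiable on the whole ball.
    let χ : ℝ → ℝ := fun s => L (θ₀ + s • d) - s * (‖Ψ θ₀‖ * ‖d‖) + s ^ 2 * (c / 4 * ‖d‖ ^ 2)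
    have hder : ∀ s ∈ Set.Icc (0:ℝ) 1, HasDerivAt χ
        (inner ℝ (Ψ (θ₀ + s • d)) d - ‖Ψ θ₀‖ * ‖d‖ + 2 * s * (c / 4 * ‖d‖ ^ 2)) s := by
      intro s hs
      have h1 : HasDerivAt (fun s : ℝ => θ₀ + s • d) d s := by
        simpa using ((hasDerivAt_id s).smul_const d).const_add θ₀
      have h2 : HasDerivAt (fun s : ℝ => L (θ₀ + s • d)) (inner ℝ (Ψ (θ₀ + s • d)) d) s := by
        have := (hL _ (hseg s hs)).hasFDerivAt.comp_hasDerivAt s h1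
        simpa [Function.comp_def] using this
      have h3 := (h2.sub ((hasDerivAt_id s).mul_const (‖Ψ θ₀‖ * ‖d‖))).add
        ((hasDerivAt_pow 2 s).mul_const (c / 4 * ‖d‖ ^ 2))
      refine h3.congr_deriv ?_
      norm_num
    have hanti : AntitoneOn χ (Set.Icc 0 1) := by
      refine antitoneOn_of_deriv_nonpos (convex_Icc 0 1)
        (fun s hs => (hder s hs).continuousAt.continuousWithinAt)
        (fun s hs => (hder s (interior_subset hs)).differentiableAt.differentiableWithinAt) ?_
      intro s hs
      have hs' := interior_subset hs
      rw [(hder s hs').deriv]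
      have h1 := hΨ _ (hseg s hs') _ hmem0
      simp only [add_sub_cancel_left] at h1
      have h2 : inner ℝ (Ψ (θ₀ + s • d) - Ψ θ₀ - (-J) (s • d)) d ≤ κ * ‖s • d‖ * ‖d‖ :=
        (real_inner_le_norm _ _).trans (by gcongr)
      have h3 := hJ d
      have h4 := real_inner_le_norm (Ψ θ₀) d
      simp only [inner_sub_left, _root_.neg_apply, map_smul, inner_neg_left,
        inner_smul_left, norm_smul, Real.norm_eq_abs, abs_of_nonneg hs'.1] at h2
      have h5 : κ * (s * ‖d‖) * ‖d‖ ≤ c / 2 * (s * ‖d‖) * ‖d‖ := by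
        have := hs'.1
        gcongr
      have h6 : s * (c * ‖d‖ ^ 2) ≤ s * inner ℝ (J d) d := mul_le_mul_of_nonneg_left h3 hs'.1
      simp at h2
      nlinarith
    have h1 := hanti (by simp : (0:ℝ) ∈ Set.Icc (0:ℝ) 1) (by simp : (1:ℝ) ∈ Set.Icc (0:ℝ) 1)
      zero_le_one
    have h2 : L θ₀ ≤ L θ := hmax ⟨hmem0, h0⟩
    simp only [χ, one_smul, hdd, add_sub_cancel, zero_smul, add_zero] at h1
    rw [← hdd] at h1
    have h3 : c / 4 * ‖d‖ ^ 2 ≤ ‖Ψ θ₀‖ * ‖d‖ := by linarith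
    rcases (norm_nonneg d).eq_or_lt with h4 | h4
    · rw [← h4]; positivity
    · have h5 : c / 4 * ‖d‖ ≤ ‖Ψ θ₀‖ := by
        by_contra! h6
        nlinarith
      rw [div_mul_eq_mul_div, le_div_iff₀ hc]
      linarith
  refine ⟨θ, hbound, hhθ, ?_⟩
  -- The strict inequality `hs` places the maximum in the interior of the ball, so only the
  -- constraint `h = 0` remains active.
  have hint : Metric.closedBall θ₀ ρ ∈ 𝓝 θ := by
    refine mem_of_superset (Metric.isOpen_ball.mem_nhds ?_) Metric.ball_subset_closedBall
    simpa [dist_eq_norm] using hbound.trans_lt hs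
  have hcont : ContinuousAt Ψ θ := hΨ.continuousOn.continuousAt hint
  have hstrict : HasStrictFDerivAt L (InnerProductSpace.toDual ℝ E (Ψ θ)) θ := by
    refine hasStrictFDerivAt_of_hasFDerivAt_of_continuousAt
      (f' := fun θ => InnerProductSpace.toDual ℝ E (Ψ θ)) ?_ ?_
    · filter_upwards [hint] with z hz using (hL z hz).hasFDerivAt
    · exact (InnerProductSpace.toDual ℝ E).continuous.continuousAt.comp hcont
  have hhθ' : h θ = 0 := hhθ
  have hextr : IsLocalExtrOn L {z | h z = h θ} θ := by
    refine Or.inr ?_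
    filter_upwards [mem_nhdsWithin_of_mem_nhds hint, self_mem_nhdsWithin] with z hz hz'
    exact hmax ⟨hz, by simpa [hhθ'] using hz'⟩
  obtain ⟨Λ, Λ₀, hne, hΛ⟩ := hextr.exists_linear_map_of_hasStrictFDerivAt (hd θ hθ) hstrict
  -- Surjectivity of `h' θ` rules out the abnormal case of the multiplier rule.
  have hΛ0 : Λ₀ ≠ 0 := by
    rintro rfl
    refine hne ?_
    have : Λ = 0 := by
      ext z
      obtain ⟨x, rfl⟩ := hsurj θ hθ z
      simpa using hΛ x
    simp [this]
  refine ⟨Λ₀⁻¹ • (InnerProductSpace.toDual ℝ R).symm (LinearMap.toContinuousLinearMap Λ), ?_⟩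
  refine ext_inner_right ℝ fun x => ?_
  have h1 := hΛ x
  simp only [inner_add_left, ContinuousLinearMap.adjoint_inner_left, inner_smul_left,
    InnerProductSpace.toDual_symm_apply, inner_zero_left]
  simp at h1 ⊢
  field_simp
  linarith

end Roots

/-! ### Limit theorems for samples from slightly contaminated distributions -/

section Contamination

variable {X : Type*} [MeasurableSpace X]

theorem contam_zero (F : Measure X) (y : X) : contam F 0 y = F := by
  simp [contam]

theorem isProbabilityMeasure_contam (F : Measure X) [IsProbabilityMeasure F] {t : ℝ} (h0 : 0 ≤ t)
    (h1 : t ≤ 1) (y : X) : IsProbabilityMeasure (contam F t y) := by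
  constructor
  simp only [contam, Measure.add_apply, Measure.smul_apply, measure_univ, smul_eq_mul, mul_one]
  rw [← ENNReal.ofReal_add (by linarith) h0]
  simp

variable [MeasurableSingletonClass X]

theorem aestronglyMeasurable_contam {E : Type*} [TopologicalSpace E]
    [TopologicalSpace.PseudoMetrizableSpace E] {F : Measure X}
    {φ : X → E} (hφ : AEStronglyMeasurable φ F) (t : ℝ) (y : X) :
    AEStronglyMeasurable φ (contam F t y) :=
  (hφ.smul_measure _).add_measure (aestronglyMeasurable_dirac.smul_measure _)

theorem ae_contam {F : Measure X} {p : X → Prop} (hp : ∀ᵐ x ∂F, p x) (t : ℝ) {y : X} (hy : p y) :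
    ∀ᵐ x ∂(contam F t y), p x := by
  rw [contam, ae_add_measure_iff]
  refine ⟨Measure.ae_smul_measure hp _, Measure.ae_smul_measure ?_ _⟩
  simpa [ae_dirac_eq] using hy

variable {E : Type*} [NormedAddCommGroup E]

theorem integrable_contam {F : Measure X} {φ : X → E} (hφ : Integrable φ F) (t : ℝ) (y : X) :
    Integrable φ (contam F t y) :=
  (hφ.smul_measure (by simp)).add_measure
    ((integrable_dirac (by simp)).smul_measure (by simp))

theorem integral_contam [NormedSpace ℝ E] [CompleteSpace E] {F : Measure X} {φ : X → E}
    (hφ : Integrable φ F) {t : ℝ} (h0 : 0 ≤ t) (h1 : t ≤ 1) (y : X) :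
    ∫ x, φ x ∂(contam F t y) = (1 - t) • ∫ x, φ x ∂F + t • φ y := by
  rw [contam, integral_add_measure (hφ.smul_measure (by simp))
    ((integrable_dirac (by simp)).smul_measure (by simp)), integral_smul_measure,
    integral_smul_measure, integral_dirac, ENNReal.toReal_ofReal (by linarith),
    ENNReal.toReal_ofReal h0]

theorem tendsto_contam_rate (ε : ℝ) : Tendsto (fun n : ℕ => ε / √(n : ℝ)) atTop (𝓝 0) :=
  tendsto_const_nhds.div_atTop (Real.tendsto_sqrt_atTop.comp tendsto_natCast_atTop_atTop)

theorem eventually_contam_rate_le (ε : ℝ) : ∀ᶠ n : ℕ in atTop, ε / √(n : ℝ) ≤ 1 :=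
  ((tendsto_contam_rate ε).eventually (gt_mem_nhds one_pos)).mono fun _ h => h.le

end Contamination

/-! ### Integrals against empirical distributions. -/

section Empirical

variable {X : Type*} [MeasurableSpace X]

theorem isProbabilityMeasure_empirical {n : ℕ} (x : Fin n → X) (hn : n ≠ 0) :
    IsProbabilityMeasure (empirical x) := by
  constructor
  simp [empirical, ENNReal.inv_mul_cancel, hn]

variable [MeasurableSingletonClass X] {E : Type*} [NormedAddCommGroup E]

theorem integrable_empirical {n : ℕ} (x : Fin n → X) (hn : n ≠ 0) (φ : X → E) :
    Integrable φ (empirical x) := by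
  refine Integrable.smul_measure ?_ (by simpa using hn)
  exact integrable_finsetSum_measure.2 fun i _ => integrable_dirac (by simp)

theorem integral_empirical [NormedSpace ℝ E] [CompleteSpace E] {n : ℕ} (x : Fin n → X)
    (φ : X → E) : ∫ z, φ z ∂(empirical x) = (n : ℝ)⁻¹ • ∑ i, φ (x i) := by
  rw [empirical, integral_smul_measure, integral_finsetSum_measure
    (fun i _ => integrable_dirac (by simp))]
  simp

theorem ae_empirical {n : ℕ} {x : Fin n → X} {p : X → Prop} (h : ∀ i, p (x i)) :
    ∀ᵐ z ∂(empirical x), p z := by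
  refine Measure.ae_smul_measure ?_ _
  rw [← Measure.sum_fintype, Measure.ae_sum_iff]
  intro i
  simpa [ae_dirac_eq] using h i

end Empirical

/-! ### Law of large numbers and central limit theorem under contamination of order `1/√n`. -/

section Arrays

variable {X : Type*} [MeasurableSpace X]
  {E : Type*} [NormedAddCommGroup E] [InnerProductSpace ℝ E] [FiniteDimensional ℝ E]
  [MeasurableSpace E] [BorelSpace E]

theorem aemeasurable_sum_pi {Q : Measure X} [SigmaFinite Q] {n : ℕ} {φ : X → E}
    (hφ : AEMeasurable φ Q) :
    AEMeasurable (fun x : Fin n → X => ∑ i, φ (x i)) (Measure.pi fun _ => Q) := by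
  refine Finset.aemeasurable_fun_sum _ fun i _ => ?_
  exact hφ.comp_quasiMeasurePreserving (Measure.quasiMeasurePreserving_eval _ i)

theorem charFun_map_smul_sum_pi {Q : Measure X} [SigmaFinite Q] {n : ℕ} {φ : X → E}
    (hφ : AEMeasurable φ Q) (a : ℝ) (v : E) :
    charFun ((Measure.pi fun _ : Fin n => Q).map fun x => a • ∑ i, φ (x i)) v =
      (∫ x, Complex.exp (((a * inner ℝ (φ x) v : ℝ) : ℂ) * Complex.I) ∂Q) ^ n := by
  have hm : AEMeasurable (fun x : Fin n → X => a • ∑ i, φ (x i)) (Measure.pi fun _ => Q) :=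
    (aemeasurable_sum_pi hφ).const_smul a
  rw [charFun_apply, integral_map hm (by fun_prop)]
  have : ∀ x : Fin n → X, Complex.exp (((inner ℝ (a • ∑ i, φ (x i)) v : ℝ) : ℂ) * Complex.I) =
      ∏ i, Complex.exp (((a * inner ℝ (φ (x i)) v : ℝ) : ℂ) * Complex.I) := by
    intro x
    rw [← Complex.exp_sum, ← Finset.sum_mul, inner_smul_left, sum_inner, ← Complex.ofReal_sum,
      Finset.mul_sum]
    simp
  simp_rw [this]
  rw [integral_fintype_prod_eq_prod (ι := Fin n)
    (f := fun _ z => Complex.exp (((a * inner ℝ (φ z) v : ℝ) : ℂ) * Complex.I))]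
  simp

theorem integral_exp_eq_charFun {F : Measure X} {φ : X → ℝ} (hφ : AEMeasurable φ F) (a : ℝ) :
    ∫ x, Complex.exp (((a * φ x : ℝ) : ℂ) * Complex.I) ∂F = charFun (F.map φ) a := by
  rw [charFun_apply_real, integral_map hφ (by fun_prop)]
  simp

theorem integrable_exp_mul_I {F : Measure X} [IsFiniteMeasure F] {φ : X → ℝ}
    (hφ : AEMeasurable φ F) (a : ℝ) :
    Integrable (fun x => Complex.exp (((a * φ x : ℝ) : ℂ) * Complex.I)) F := by
  refine Integrable.of_bound (C := 1) ?_ (ae_of_all _ fun x => ?_)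
  · exact (by fun_prop : AEMeasurable _ F).aestronglyMeasurable
  · rw [Complex.norm_exp_ofReal_mul_I]

/-- This handles the point mass at `y`, whose contribution to a characteristic function is a
difference quotient of `s ↦ exp (i s c)` at `0`. -/
theorem tendsto_exp_slope (c : ℝ) {a : ℕ → ℝ} (ha : Tendsto a atTop (𝓝 0)) (ha' : ∀ᶠ n in atTop, a n ≠ 0) :
    Tendsto (fun n => ((a n : ℂ))⁻¹ * (Complex.exp (((a n * c : ℝ) : ℂ) * Complex.I) - 1)) atTop
      (𝓝 (c * Complex.I)) := by
  have h1 : HasDerivAt (fun s : ℝ => Complex.exp (((s * c : ℝ) : ℂ) * Complex.I))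
      (c * Complex.I) 0 := by
    have h2 : HasDerivAt (fun s : ℝ => ((s * c : ℝ) : ℂ) * Complex.I) (c * Complex.I) 0 := by
      have := (((hasDerivAt_id (0:ℝ)).mul_const c).ofReal_comp).mul_const Complex.I
      simpa using this
    simpa using h2.cexp
  rw [hasDerivAt_iff_tendsto_slope] at h1
  have h3 : Tendsto a atTop (𝓝[≠] 0) := tendsto_nhdsWithin_iff.2 ⟨ha, ha'⟩
  refine (h1.comp h3).congr fun n => ?_
  simp [slope_def_module]

theorem tendsto_sqrt_inv : Tendsto (fun n : ℕ => (√(n : ℝ))⁻¹) atTop (𝓝 0) :=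
  tendsto_inv_atTop_zero.comp (Real.tendsto_sqrt_atTop.comp tendsto_natCast_atTop_atTop)

variable [MeasurableSingletonClass X]

/-- Characteristic functions of normalized sums, law of large numbers scaling. -/
theorem tendsto_charFun_lln {F : Measure X} [IsProbabilityMeasure F] {φ : X → ℝ}
    (hφ : Integrable φ F) {ε : ℝ} (hε : 0 ≤ ε) (y : X) :
    Tendsto (fun n : ℕ => (∫ x, Complex.exp ((((n : ℝ)⁻¹ * φ x : ℝ) : ℂ) * Complex.I)
      ∂(levelContam F ε y n)) ^ n) atTop (𝓝 (Complex.exp (((∫ x, φ x ∂F : ℝ) : ℂ) * Complex.I))) := by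
  have hlim : Tendsto (fun n : ℕ => ((n : ℝ))⁻¹) atTop (𝓝 0) :=
    tendsto_inv_atTop_zero.comp tendsto_natCast_atTop_atTop
  have hne : ∀ᶠ n : ℕ in atTop, ((n : ℝ))⁻¹ ≠ 0 := by
    filter_upwards [eventually_ne_atTop 0] with n hn
    simpa using hn
  have hder : HasDerivAt (charFun (F.map φ)) (((∫ x, φ x ∂F : ℝ) : ℂ) * Complex.I) 0 := by
    have : IsProbabilityMeasure (F.map φ) := Measure.isProbabilityMeasure_map hφ.aemeasurable
    have hm : MemLp id 1 (F.map φ) := by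
      rw [memLp_map_measure_iff aestronglyMeasurable_id hφ.aemeasurable]
      simpa using memLp_one_iff_integrable.2 hφ
    have hc : ContDiff ℝ 1 (charFun (F.map φ)) := contDiff_charFun (n := 1) (by simpa using hm)
    have h1 := (hc.differentiable (by norm_num) 0).hasDerivAt
    have h2 := iteratedDeriv_charFun_zero (n := 1) (by simpa using hm)
    rw [iteratedDeriv_one, integral_map hφ.aemeasurable (by fun_prop)] at h2
    rw [h2] at h1
    refine h1.congr_deriv ?_
    simp [mul_comm]
  -- By `(1 + z_n / n)^n → e^z`, it is enough to find the limit of `n` times the deviation of the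
  -- integral from `1`.
  have key : Tendsto (fun n : ℕ => (n : ℂ) * ((∫ x, Complex.exp ((((n : ℝ)⁻¹ * φ x : ℝ) : ℂ) *
      Complex.I) ∂(levelContam F ε y n)) - 1)) atTop
      (𝓝 (((∫ x, φ x ∂F : ℝ) : ℂ) * Complex.I)) := by
    have h1 : Tendsto (fun n : ℕ => (((n : ℝ))⁻¹ : ℂ)⁻¹ *
        (charFun (F.map φ) ((n : ℝ)⁻¹) - 1)) atTop (𝓝 (((∫ x, φ x ∂F : ℝ) : ℂ) * Complex.I)) := by
      have h3 : Tendsto (fun n : ℕ => ((n : ℝ))⁻¹) atTop (𝓝[≠] 0) :=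
        tendsto_nhdsWithin_iff.2 ⟨hlim, hne⟩
      have : IsProbabilityMeasure (F.map φ) := Measure.isProbabilityMeasure_map hφ.aemeasurable
      refine ((hasDerivAt_iff_tendsto_slope.1 hder).comp h3).congr fun n => ?_
      simp [slope_def_module]
    have h2 := tendsto_exp_slope (φ y) hlim hne
    have ht := ((Complex.continuous_ofReal.tendsto 0).comp (tendsto_contam_rate ε))
    -- The part at `y` is the weight `ε/√n`, tending to `0`, times a convergent difference quotient,
    -- so it disappears in this scaling.
    have h4 := ((tendsto_const_nhds (x := (1:ℂ))).sub ht).mul h1 |>.add (ht.mul h2)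
    simp only [Complex.ofReal_zero, sub_zero, one_mul, zero_mul, add_zero] at h4
    refine h4.congr' ?_
    filter_upwards [eventually_contam_rate_le ε] with n hn
    rw [levelContam, integral_contam (integrable_exp_mul_I hφ.aemeasurable _)
      (by positivity) hn, integral_exp_eq_charFun hφ.aemeasurable]
    simp only [Function.comp_apply, Complex.real_smul]
    push_cast
    simp only [inv_inv]
    ring
  refine (Complex.tendsto_one_add_pow_exp_of_tendsto key).congr fun n => ?_
  simp

/-- Characteristic functions of normalized sums, central limit scaling. -/
theorem tendsto_charFun_clt {F : Measure X} [IsProbabilityMeasure F] {φ : X → ℝ}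
    (hφ : MemLp φ 2 F) (h0 : ∫ x, φ x ∂F = 0) {ε : ℝ} (hε : 0 ≤ ε) (y : X) :
    Tendsto (fun n : ℕ => (∫ x, Complex.exp ((((√(n : ℝ))⁻¹ * φ x : ℝ) : ℂ) * Complex.I)
      ∂(levelContam F ε y n)) ^ n) atTop
      (𝓝 (Complex.exp (((ε * φ y : ℝ) : ℂ) * Complex.I - ((∫ x, φ x ^ 2 ∂F : ℝ) : ℂ) / 2))) := by
  have hφm : AEMeasurable φ F := hφ.aestronglyMeasurable.aemeasurable
  have hlim := tendsto_sqrt_inv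
  have hne : ∀ᶠ n : ℕ in atTop, (√(n : ℝ))⁻¹ ≠ 0 := by
    filter_upwards [eventually_ne_atTop 0] with n hn
    simpa using hn
  have : IsProbabilityMeasure (F.map φ) := Measure.isProbabilityMeasure_map hφm
  have hm : MemLp id 2 (F.map φ) := by
    rw [memLp_map_measure_iff aestronglyMeasurable_id hφm]
    simpa using hφ
  -- Second order Taylor expansion at `0`; there is no linear term since the mean is zero.
  have htay : (fun t : ℝ => charFun (F.map φ) t - (1 - ((∫ x, φ x ^ 2 ∂F : ℝ) : ℂ) * t ^ 2 / 2))
      =o[𝓝 0] fun t => t ^ 2 := by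
    have h1 := taylor_isLittleO_univ (x₀ := 0) (contDiff_charFun (n := 2) hm)
    have h2 := taylorWithinEval_charFun_two_zero hφm hm
    simp only [Pi.pow_apply] at h2
    rw [h0] at h2
    simp only [sub_zero] at h1
    refine h1.congr_left fun t => ?_
    rw [h2]; simp
  have key : Tendsto (fun n : ℕ => (n : ℂ) * ((∫ x, Complex.exp ((((√(n : ℝ))⁻¹ * φ x : ℝ) : ℂ) *
      Complex.I) ∂(levelContam F ε y n)) - 1)) atTop
      (𝓝 (((ε * φ y : ℝ) : ℂ) * Complex.I - ((∫ x, φ x ^ 2 ∂F : ℝ) : ℂ) / 2)) := by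
    have h1 : Tendsto (fun n : ℕ => (n : ℂ) * (charFun (F.map φ) ((√(n : ℝ))⁻¹) - 1)) atTop
        (𝓝 (- ((∫ x, φ x ^ 2 ∂F : ℝ) : ℂ) / 2)) := by
      have h2 := (htay.comp_tendsto hlim)
      have h3 : Tendsto (fun n : ℕ => (n : ℂ) * (charFun (F.map φ) ((√(n : ℝ))⁻¹) -
          (1 - ((∫ x, φ x ^ 2 ∂F : ℝ) : ℂ) * (((√(n : ℝ))⁻¹ : ℝ) : ℂ) ^ 2 / 2))) atTop (𝓝 0) := by
        have h4 : (fun n : ℕ => charFun (F.map φ) ((√(n : ℝ))⁻¹) -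
          (1 - ((∫ x, φ x ^ 2 ∂F : ℝ) : ℂ) * (((√(n : ℝ))⁻¹ : ℝ) : ℂ) ^ 2 / 2)) =o[atTop]
            fun n : ℕ => ((√(n : ℝ))⁻¹) ^ 2 := h2
        refine h4.tendsto_inv_smul_nhds_zero.congr fun n => ?_
        rw [inv_pow, inv_inv, Real.sq_sqrt (by positivity), Complex.real_smul]
        simp
      have h5 := h3.add (tendsto_const_nhds (x := (- ((∫ x, φ x ^ 2 ∂F : ℝ) : ℂ) / 2)))
      rw [zero_add] at h5
      refine h5.congr' ?_
      filter_upwards [eventually_ne_atTop 0] with n hn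
      have h6 : ((√(n : ℝ) : ℝ) : ℂ) ^ 2 = n := by
        rw [← Complex.ofReal_pow, Real.sq_sqrt (by positivity)]; simp
      have h7 : (n : ℂ) ≠ 0 := by exact_mod_cast hn
      push_cast
      rw [inv_pow, h6]
      field_simp
      ring
    have h2 := tendsto_exp_slope (φ y) hlim hne
    have ht := ((Complex.continuous_ofReal.tendsto 0).comp (tendsto_contam_rate ε))
    -- In this scaling `n · (ε/√n) = ε √n`, so the part at `y` is `ε` times a difference quotient of
    -- step `1/√n` and converges to the drift `i ε φ(y)`.
    have h4 := (((tendsto_const_nhds (x := (1:ℂ))).sub ht).mul h1).add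
      (h2.const_mul (ε : ℂ))
    have h5 : (1 - ((0:ℝ):ℂ)) * (- ((∫ x, φ x ^ 2 ∂F : ℝ) : ℂ) / 2) + (ε : ℂ) * (φ y * Complex.I) =
        ((ε * φ y : ℝ) : ℂ) * Complex.I - ((∫ x, φ x ^ 2 ∂F : ℝ) : ℂ) / 2 := by
      push_cast; ring
    rw [h5] at h4
    refine h4.congr' ?_
    filter_upwards [eventually_contam_rate_le ε, eventually_ne_atTop 0] with n hn hn0
    rw [levelContam, integral_contam (integrable_exp_mul_I hφm _)
      (by positivity) hn, integral_exp_eq_charFun hφm]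
    simp only [Function.comp_apply, Complex.real_smul]
    have h6 : ((√(n : ℝ) : ℝ) : ℂ) ^ 2 = n := by
      rw [← Complex.ofReal_pow, Real.sq_sqrt (by positivity)]; simp
    have h7 : ((√(n : ℝ) : ℝ) : ℂ) ≠ 0 := by
      simpa using hn0
    push_cast
    simp only [inv_inv]
    rw [← h6]
    field_simp
    ring
  refine (Complex.tendsto_one_add_pow_exp_of_tendsto key).congr fun n => ?_
  simp

/-- Lévy's continuity theorem. The sample law need not be a probability measure before `ε/√n ≤ 1`,
so `ν` is filled in with the limit law for small `n` and identified only eventually. -/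
theorem exists_tendsto_law {F : Measure X} [IsProbabilityMeasure F] {φ : X → E}
    (hφ : AEStronglyMeasurable φ F) {ε : ℝ} (hε : 0 ≤ ε) (y : X) (ν' : ProbabilityMeasure E)
    (a : ℕ → ℝ) (h : ∀ v, Tendsto (fun n : ℕ =>
      (∫ x, Complex.exp (((a n * inner ℝ (φ x) v : ℝ) : ℂ) * Complex.I)
        ∂(levelContam F ε y n)) ^ n) atTop (𝓝 (charFun (ν' : Measure E) v))) :
    ∃ ν : ℕ → ProbabilityMeasure E, Tendsto ν atTop (𝓝 ν') ∧ ∀ᶠ n : ℕ in atTop,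
      AEMeasurable (fun x : Fin n → X => a n • ∑ i, φ (x i))
        (sampleLaw (levelContam F ε y) n) ∧
      (ν n : Measure E) =
        (sampleLaw (levelContam F ε y) n).map fun x => a n • ∑ i, φ (x i) := by
  classical
  let law : ℕ → Measure E := fun n =>
    (sampleLaw (levelContam F ε y) n).map fun x => a n • ∑ i, φ (x i)
  let ν : ℕ → ProbabilityMeasure E := fun n =>
    if hn : IsProbabilityMeasure (law n) then ⟨law n, hn⟩ else ν'
  have hev : ∀ᶠ n : ℕ in atTop,
      AEMeasurable (fun x : Fin n → X => a n • ∑ i, φ (x i)) (sampleLaw (levelContam F ε y) n) ∧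
      (ν n : Measure E) = law n ∧ ∀ v, charFun (law n) v =
        (∫ x, Complex.exp (((a n * inner ℝ (φ x) v : ℝ) : ℂ) * Complex.I)
          ∂(levelContam F ε y n)) ^ n := by
    filter_upwards [eventually_contam_rate_le ε] with n hn
    have hQ : IsProbabilityMeasure (levelContam F ε y n) :=
      isProbabilityMeasure_contam F (by positivity) hn y
    have hm : AEMeasurable φ (levelContam F ε y n) :=
      (aestronglyMeasurable_contam hφ _ y).aemeasurable
    have hm' : AEMeasurable (fun x : Fin n → X => a n • ∑ i, φ (x i))
        (sampleLaw (levelContam F ε y) n) := (aemeasurable_sum_pi hm).const_smul (a n)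
    have hp : IsProbabilityMeasure (sampleLaw (levelContam F ε y) n) := by
      rw [sampleLaw]; infer_instance
    have hlaw : IsProbabilityMeasure (law n) := Measure.isProbabilityMeasure_map hm'
    refine ⟨hm', ?_, fun v => charFun_map_smul_sum_pi hm (a n) v⟩
    have h1 : ν n = ⟨law n, hlaw⟩ := dif_pos hlaw
    rw [h1, ProbabilityMeasure.coe_mk]
  refine ⟨ν, ?_, hev.mono fun n hn => ⟨hn.1, hn.2.1⟩⟩
  refine ProbabilityMeasure.tendsto_iff_tendsto_charFun.2 fun v => (h v).congr' ?_
  filter_upwards [hev] with n hn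
  rw [hn.2.1, hn.2.2 v]

/-- The vector law of large numbers for samples from contaminated distributions. -/
theorem tendsto_sampleLaw_average {F : Measure X} [IsProbabilityMeasure F] {G : Type*}
    [NormedAddCommGroup G] [NormedSpace ℝ G] [FiniteDimensional ℝ G] {φ : X → G}
    (hφ : Integrable φ F) {ε : ℝ} (hε : 0 ≤ ε) (y : X) {η : ℝ} (hη : 0 < η) :
    Tendsto (fun n => sampleLaw (levelContam F ε y) n
      {x | η ≤ ‖(n : ℝ)⁻¹ • ∑ i, φ (x i) - ∫ x, φ x ∂F‖}) atTop (𝓝 0) := by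
  have : CompleteSpace G := FiniteDimensional.complete ℝ G
  -- Characteristic functions require an inner product, which `G` lacks (it will also be a space of
  -- operators), so the statement is carried over to a Euclidean space.
  let T : G ≃L[ℝ] EuclideanSpace ℝ (Fin (Module.finrank ℝ G)) := toEuclidean
  have hTφ : Integrable (fun x => T (φ x)) F := T.toContinuousLinearMap.integrable_comp hφ
  have hTi : ∫ x, T (φ x) ∂F = T (∫ x, φ x ∂F) := T.toContinuousLinearMap.integral_comp_comm hφ
  obtain ⟨ν, hν, hev⟩ := exists_tendsto_law hTφ.aestronglyMeasurable hε y
    ⟨Measure.dirac (T (∫ x, φ x ∂F)), inferInstance⟩ (fun n => (n : ℝ)⁻¹) (fun v => by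
      have h1 := tendsto_charFun_lln (hTφ.inner_const v) hε y
      have h2 : ∫ x, inner ℝ (T (φ x)) v ∂F = inner ℝ (T (∫ x, φ x ∂F)) v := by
        have h3 := integral_inner (𝕜 := ℝ) hTφ v
        simp_rw [real_inner_comm v] at h3 ⊢
        rw [h3, hTi]
      rw [h2] at h1
      rw [ProbabilityMeasure.coe_mk, charFun_dirac]
      exact h1)
  -- The summand `1` keeps `S` positive when `T.symm` is zero, so that division by `S` is allowed.
  set S := ‖(T.symm : EuclideanSpace ℝ (Fin (Module.finrank ℝ G)) →L[ℝ] G)‖ + 1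
  have hS : 0 < S := by positivity
  let C : Set (EuclideanSpace ℝ (Fin (Module.finrank ℝ G))) :=
    {w | η / S ≤ ‖w - T (∫ x, φ x ∂F)‖}
  have hC : IsClosed C := isClosed_le continuous_const (by fun_prop)
  -- Convergence in law to a point mass: the closed set `C` avoids the point, so by the portmanteau
  -- theorem its probability tends to zero.
  have hlim := ProbabilityMeasure.limsup_measure_closed_le_of_tendsto hν hC
  have h0 : Measure.dirac (T (∫ x, φ x ∂F)) C = 0 := by
    rw [Measure.dirac_apply' _ hC.measurableSet]
    have : T (∫ x, φ x ∂F) ∉ C := by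
      simp only [C, Set.mem_ofPred_eq, sub_self, norm_zero, not_le]; positivity
    simp [this]
  rw [ProbabilityMeasure.coe_mk, h0] at hlim
  have hz : Tendsto (fun n => (ν n : Measure _) C) atTop (𝓝 0) :=
    tendsto_of_le_liminf_of_limsup_le (zero_le) hlim
  refine tendsto_of_tendsto_of_tendsto_of_le_of_le' tendsto_const_nhds hz
    (Eventually.of_forall fun _ => zero_le) ?_
  filter_upwards [hev] with n hn
  rw [hn.2, Measure.map_apply_of_aemeasurable hn.1 hC.measurableSet]
  refine measure_mono fun x hx => ?_
  simp only [Set.mem_ofPred_eq] at hx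
  simp only [Set.mem_preimage, C, Set.mem_ofPred_eq]
  rw [div_le_iff₀ hS]
  have h1 : (n : ℝ)⁻¹ • ∑ i, T (φ (x i)) - T (∫ x, φ x ∂F) =
      T ((n : ℝ)⁻¹ • ∑ i, φ (x i) - ∫ x, φ x ∂F) := by simp
  rw [h1]
  set w := (n : ℝ)⁻¹ • ∑ i, φ (x i) - ∫ x, φ x ∂F
  have h2 := (T.symm : EuclideanSpace ℝ (Fin (Module.finrank ℝ G)) →L[ℝ] G).le_opNorm (T w)
  simp only [ContinuousLinearEquiv.coe_coe, ContinuousLinearEquiv.symm_apply_apply] at h2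
  calc η ≤ ‖w‖ := hx
    _ ≤ _ := h2
    _ ≤ S * ‖T w‖ := by gcongr; simp [S]
    _ = _ := mul_comm _ _

/-- The vector central limit theorem for samples from contaminated distributions. -/
theorem exists_tendsto_normalized_sum {p : ℕ} {F : Measure X} [IsProbabilityMeasure F]
    {φ : X → Vec p} (hφ : MemLp φ 2 F) (h0 : ∫ x, φ x ∂F = 0) {V : Matrix (Fin p) (Fin p) ℝ}
    (hV : ∀ j k, V j k = ∫ x, φ x j * φ x k ∂F) (hVp : V.PosSemidef)
    {ε : ℝ} (hε : 0 ≤ ε) (y : X) :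
    ∃ (ν : ℕ → ProbabilityMeasure (Vec p)) (ν' : ProbabilityMeasure (Vec p)),
      (ν' : Measure (Vec p)) = multivariateGaussian (ε • φ y) V ∧
      Tendsto ν atTop (𝓝 ν') ∧ ∀ᶠ n : ℕ in atTop,
        AEMeasurable (fun x : Fin n → X => (√(n : ℝ))⁻¹ • ∑ i, φ (x i))
          (sampleLaw (levelContam F ε y) n) ∧
        (ν n : Measure (Vec p)) =
          (sampleLaw (levelContam F ε y) n).map fun x => (√(n : ℝ))⁻¹ • ∑ i, φ (x i) := by
  have hφ1 : Integrable φ F := hφ.integrable (by norm_num)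
  have hcoord : ∀ j, MemLp (fun x => φ x j) 2 F := fun j =>
    (EuclideanSpace.proj (𝕜 := ℝ) j).comp_memLp' hφ
  obtain ⟨ν, hν, hev⟩ := exists_tendsto_law hφ.aestronglyMeasurable hε y
    ⟨multivariateGaussian (ε • φ y) V, inferInstance⟩ (fun n => (√(n : ℝ))⁻¹) (fun v => by
      have h1 := tendsto_charFun_clt (hφ.inner_const v) (by
        have h3 := integral_inner (𝕜 := ℝ) hφ1 v
        simp_rw [real_inner_comm v] at h3 ⊢
        rw [h3, h0, inner_zero_right]) hε y
      have h2 : ∫ x, inner ℝ (φ x) v ^ 2 ∂F = v.ofLp ⬝ᵥ V *ᵥ v.ofLp := by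
        have : ∀ x, inner ℝ (φ x) v ^ 2 = ∑ j, ∑ k, v j * (φ x j * φ x k) * v k := by
          intro x
          rw [PiLp.inner_apply, sq, Finset.sum_mul_sum]
          refine Finset.sum_congr rfl fun j _ => Finset.sum_congr rfl fun k _ => ?_
          simp; ring
        have hint : ∀ j k, Integrable (fun x => v j * (φ x j * φ x k) * v k) F := fun j k =>
          (((hcoord j).integrable_mul (hcoord k)).const_mul _).mul_const _
        simp_rw [this]
        rw [integral_finsetSum _ fun j _ => integrable_finsetSum _ fun k _ => hint j k]
        simp only [dotProduct, mulVec, Finset.mul_sum]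
        refine Finset.sum_congr rfl fun j _ => ?_
        rw [integral_finsetSum _ fun k _ => hint j k]
        refine Finset.sum_congr rfl fun k _ => ?_
        rw [integral_mul_const, integral_const_mul, hV]
        ring
      rw [h2] at h1
      rw [ProbabilityMeasure.coe_mk, charFun_multivariateGaussian hVp]
      convert h1 using 4
      · rw [real_inner_comm, inner_smul_left]; simp)
  exact ⟨ν, _, rfl, hν, hev⟩

end Arrays

/-! ### Quadratic forms in normal variables -/

section ExponentialMoments

/-- Finite measures on the line with the same finite exponential moments near `0` are equal. -/
theorem ext_of_lintegral_exp_eq {μ ν : Measure ℝ} [IsFiniteMeasure μ] [IsFiniteMeasure ν] {δ : ℝ}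
    (hδ : 0 < δ) (hfin : ∀ u, |u| < δ → ∫⁻ x, ENNReal.ofReal (Real.exp (u * x)) ∂μ ≠ ⊤)
    (heq : ∀ u, |u| < δ → ∫⁻ x, ENNReal.ofReal (Real.exp (u * x)) ∂μ =
      ∫⁻ x, ENNReal.ofReal (Real.exp (u * x)) ∂ν) : μ = ν := by
  have hint : ∀ (ρ : Measure ℝ), (∀ u, |u| < δ → ∫⁻ x, ENNReal.ofReal (Real.exp (u * x)) ∂ρ ≠ ⊤) →
      ∀ u, |u| < δ → Integrable (fun x => Real.exp (u * x)) ρ := by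
    intro ρ h u hu
    refine (lintegral_ofReal_ne_top_iff_integrable (by fun_prop)
      (ae_of_all _ fun _ => (Real.exp_pos _).le)).1 (h u hu)
  have hμ := hint μ hfin
  have hν := hint ν (fun u hu => heq u hu ▸ hfin u hu)
  have hsub : ∀ (ρ : Measure ℝ), (∀ u, |u| < δ → Integrable (fun x => Real.exp (u * x)) ρ) →
      Set.Ioo (-δ) δ ⊆ interior (integrableExpSet id ρ) := by
    intro ρ h
    refine interior_maximal (fun u hu => ?_) isOpen_Ioo
    exact h u (abs_lt.2 hu)
  -- Both complex moment generating functions are analytic on this strip and agree on its real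
  -- segment, hence on the whole strip. It contains the imaginary axis, where they are the
  -- characteristic functions.
  let U : Set ℂ := {z | z.re ∈ Set.Ioo (-δ) δ}
  have hX : AnalyticOnNhd ℂ (complexMGF id μ) U := fun z hz =>
    analyticOnNhd_complexMGF z (hsub μ hμ hz)
  have hY : AnalyticOnNhd ℂ (complexMGF id ν) U := fun z hz =>
    analyticOnNhd_complexMGF z (hsub ν hν hz)
  have hreal : ∀ u : ℝ, |u| < δ → complexMGF id μ u = complexMGF id ν u := by
    intro u hu
    rw [complexMGF_ofReal, complexMGF_ofReal]
    simp only [mgf, id]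
    rw [integral_eq_lintegral_of_nonneg_ae (ae_of_all _ fun _ => (Real.exp_pos _).le) (by fun_prop),
      integral_eq_lintegral_of_nonneg_ae (ae_of_all _ fun _ => (Real.exp_pos _).le) (by fun_prop),
      heq u hu]
  have hU : IsPreconnected U :=
    ((convex_Ioo (-δ) δ).linear_preimage Complex.reLm).isPreconnected
  have hfreq : ∃ᶠ z in 𝓝[≠] ((0 : ℝ) : ℂ), complexMGF id μ z = complexMGF id ν z := by
    have h1 : ∃ᶠ u : ℝ in 𝓝[≠] (0 : ℝ), complexMGF id μ ((u : ℝ) : ℂ) =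
        complexMGF id ν ((u : ℝ) : ℂ) := by
      refine Eventually.frequently ?_
      have : Set.Ioo (-δ) δ ∈ 𝓝 (0 : ℝ) := Ioo_mem_nhds (by linarith) hδ
      filter_upwards [mem_nhdsWithin_of_mem_nhds this] with u hu
      exact hreal u (abs_lt.2 hu)
    have h2 : Tendsto (fun u : ℝ => (u : ℂ)) (𝓝[≠] 0) (𝓝[≠] ((0 : ℝ) : ℂ)) := by
      refine tendsto_nhdsWithin_iff.2 ⟨(Complex.continuous_ofReal.tendsto 0).mono_left
        nhdsWithin_le_nhds, ?_⟩
      filter_upwards [self_mem_nhdsWithin] with u hu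
      simpa using hu
    exact h2.frequently h1
  have hEq : Set.EqOn (complexMGF id μ) (complexMGF id ν) U :=
    hX.eqOn_of_preconnected_of_frequently_eq hY hU (by simp [U, hδ]) hfreq
  refine Measure.ext_of_charFun (funext fun t => ?_)
  rw [← complexMGF_id_mul_I, ← complexMGF_id_mul_I]
  exact hEq (by simp [U, hδ])

/-- Exponential moments of the square of an affine function of a standard normal variable. -/
theorem lintegral_exp_sq_gaussian {θ a b : ℝ} (h : θ * a ^ 2 < 1) :
    ∫⁻ z, ENNReal.ofReal (Real.exp (θ / 2 * (a * z + b) ^ 2)) ∂(gaussianReal 0 1) =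
      ENNReal.ofReal ((√(1 - θ * a ^ 2))⁻¹ * Real.exp (θ * b ^ 2 / (2 * (1 - θ * a ^ 2)))) := by
  set c := 1 - θ * a ^ 2 with hc
  have hc0 : 0 < c := by linarith
  rw [gaussianReal_of_var_ne_zero _ one_ne_zero,
    lintegral_withDensity_eq_lintegral_mul _ (measurable_gaussianPDF _ _) (by fun_prop)]
  -- Completing the square: the integrand is a constant times the normal density with mean `θ a b /
  -- c` and variance `1 / c`.
  have key : ∀ z, (gaussianPDF 0 1 * fun z => ENNReal.ofReal (Real.exp (θ / 2 * (a * z + b) ^ 2))) z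
      = ENNReal.ofReal ((√c)⁻¹ * Real.exp (θ * b ^ 2 / (2 * c))) *
        ENNReal.ofReal (gaussianPDFReal (θ * a * b / c) (Real.toNNReal c⁻¹) z) := by
    intro z
    rw [Pi.mul_apply, gaussianPDF, ← ENNReal.ofReal_mul (gaussianPDFReal_nonneg _ _ _),
      ← ENNReal.ofReal_mul (by positivity)]
    congr 1
    simp only [gaussianPDFReal, NNReal.coe_one, mul_one, sub_zero,
      Real.coe_toNNReal _ (inv_pos.2 hc0).le]
    have h1 : √(2 * Real.pi * c⁻¹) = √(2 * Real.pi) * (√c)⁻¹ := by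
      rw [Real.sqrt_mul (by positivity), Real.sqrt_inv]
    have h2 : -z ^ 2 / 2 + θ / 2 * (a * z + b) ^ 2 =
        θ * b ^ 2 / (2 * c) + -(z - θ * a * b / c) ^ 2 / (2 * c⁻¹) := by
      field_simp
      rw [hc]; ring
    have h3 : √c ≠ 0 := (Real.sqrt_pos.2 hc0).ne'
    rw [h1, mul_assoc, ← Real.exp_add, h2, Real.exp_add]
    field_simp
  rw [lintegral_congr key, lintegral_const_mul _ (by fun_prop),
    lintegral_gaussianPDFReal_eq_one _ (by simpa using hc0), mul_one]

theorem lintegral_prod_stdNormals {k : ℕ} {g : Fin k → ℝ → ℝ} (hg : ∀ i, Measurable (g i)) :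
    ∫⁻ z, ENNReal.ofReal (Real.exp (∑ i, g i (z i))) ∂(stdNormals k) =
      ∏ i, ∫⁻ z, ENNReal.ofReal (Real.exp (g i z)) ∂(gaussianReal 0 1) := by
  have h1 : ∀ z : Fin k → ℝ, ENNReal.ofReal (Real.exp (∑ i, g i (z i))) =
      ∏ i, ENNReal.ofReal (Real.exp (g i (z i))) := by
    intro z
    rw [Real.exp_sum, ENNReal.ofReal_prod_of_nonneg fun _ _ => (Real.exp_pos _).le]
  have hm : ∀ i, Measurable fun z => ENNReal.ofReal (Real.exp (g i z)) := fun i => by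
    have := hg i; fun_prop
  have hind : iIndepFun (fun i (z : Fin k → ℝ) => ENNReal.ofReal (Real.exp (g i (z i))))
      (stdNormals k) := iIndepFun_pi (μ := fun _ : Fin k => gaussianReal 0 1)
        (X := fun i z => ENNReal.ofReal (Real.exp (g i z))) (fun i => (hm i).aemeasurable)
  have h2 := lintegral_prod_eq_prod_lintegral_of_indepFun Finset.univ _ hind
    (fun i => (hm i).comp (measurable_pi_apply i))
  simp_rw [h1]
  rw [h2]
  refine Finset.prod_congr rfl fun i _ => ?_
  exact (measurePreserving_eval (fun _ : Fin k => gaussianReal 0 1) i).lintegral_comp (hm i)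

instance isProbabilityMeasure_stdNormals (k : ℕ) : IsProbabilityMeasure (stdNormals k) := by
  rw [stdNormals]; infer_instance

instance isProbabilityMeasure_wtdChiSqLaw {r : ℕ} (ζ s : Fin r → ℝ) :
    IsProbabilityMeasure (wtdChiSqLaw ζ s) :=
  Measure.isProbabilityMeasure_map (Measurable.aemeasurable (by fun_prop))

instance isProbabilityMeasure_chiSqLaw (k : ℕ) : IsProbabilityMeasure (chiSqLaw k) := by
  have hm : Measurable fun z : Fin k → ℝ => ∑ i, z i ^ 2 := by fun_prop
  exact Measure.isProbabilityMeasure_map hm.aemeasurable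

theorem lintegral_exp_wtdChiSqLaw {r : ℕ} {ζ s : Fin r → ℝ} {u : ℝ} (hu : ∀ i, 2 * u * ζ i < 1) :
    ∫⁻ x, ENNReal.ofReal (Real.exp (u * x)) ∂(wtdChiSqLaw ζ s) =
      ∏ i, ENNReal.ofReal ((√(1 - 2 * u * ζ i))⁻¹ *
        Real.exp (2 * u * ζ i * s i ^ 2 / (2 * (1 - 2 * u * ζ i)))) := by
  rw [wtdChiSqLaw, lintegral_map (by fun_prop) (by fun_prop)]
  have h1 : ∀ z : Fin r → ℝ, u * ∑ i, ζ i * (z i + s i) ^ 2 =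
      ∑ i, 2 * u * ζ i / 2 * (1 * z i + s i) ^ 2 := by
    intro z; rw [Finset.mul_sum]; exact Finset.sum_congr rfl fun i _ => by ring
  simp_rw [h1]
  rw [lintegral_prod_stdNormals (g := fun i z => 2 * u * ζ i / 2 * (1 * z + s i) ^ 2)
    (fun i => by fun_prop)]
  refine Finset.prod_congr rfl fun i _ => ?_
  rw [lintegral_exp_sq_gaussian (by simpa using hu i)]
  simp

theorem lintegral_exp_chiSqLaw {k : ℕ} {u : ℝ} (hu : 2 * u < 1) :
    ∫⁻ x, ENNReal.ofReal (Real.exp (u * x)) ∂(chiSqLaw k) =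
      ENNReal.ofReal ((√(1 - 2 * u))⁻¹) ^ k := by
  have h1 : chiSqLaw k = wtdChiSqLaw (fun _ : Fin k => 1) 0 := by
    simp [chiSqLaw, wtdChiSqLaw]
  rw [h1, lintegral_exp_wtdChiSqLaw (fun _ => by simpa using hu)]
  simp

end ExponentialMoments

/-! ### Mixtures of scaled chi-square laws, atoms and quantiles. -/

section Mixture

variable {r : ℕ} {ζ : Fin r → ℝ}

theorem zetaMin_le (ζ : Fin r → ℝ) (i : Fin r) : zetaMin ζ ≤ ζ i :=
  ciInf_le (Set.finite_range ζ).bddBelow i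

theorem zetaMin_pos (hr : 0 < r) (hζ : ∀ i, 0 < ζ i) : 0 < zetaMin ζ := by
  have : Nonempty (Fin r) := ⟨⟨0, hr⟩⟩
  obtain ⟨i, hi⟩ := exists_eq_ciInf_of_finite (f := ζ)
  rw [zetaMin, ← hi]; exact hζ i

theorem mixQ_nonneg (ζ s z : Fin r → ℝ) : 0 ≤ mixQ ζ s z := by
  rw [mixQ]; positivity

theorem measurable_mixQ (ζ s : Fin r → ℝ) : Measurable (mixQ ζ s) := by
  unfold mixQ; fun_prop

/-- The argument `(1 - 2uζ_(1))⁻¹` is the one produced by summing the exponential moments of the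
mixture at `u`. Each coordinate contributes a Gaussian integral, evaluated by `1 - c1⁻¹ a_j² = c1⁻¹
(ζ_(1)/ζ_j)(1 - 2uζ_j)`. -/
theorem lintegral_exp_mixQ (hr : 0 < r) (hζ : ∀ i, 0 < ζ i) (s : Fin r → ℝ) {u : ℝ}
    (hu : ∀ i, 2 * u * ζ i < 1) :
    ∫⁻ z, ENNReal.ofReal (Real.exp ((1 - 2 * u * zetaMin ζ)⁻¹ * mixQ ζ s z)) ∂(stdNormals r) =
      ENNReal.ofReal ((√(∏ i, zetaMin ζ / ζ i))⁻¹ * √(1 - 2 * u * zetaMin ζ) ^ r *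
        ∏ i, (√(1 - 2 * u * ζ i))⁻¹ * Real.exp (s i ^ 2 / (2 * (1 - 2 * u * ζ i)))) := by
  have h1pos := zetaMin_pos hr hζ
  have hu1 : 2 * u * zetaMin ζ < 1 := by
    have : Nonempty (Fin r) := ⟨⟨0, hr⟩⟩
    obtain ⟨i, hi⟩ := exists_eq_ciInf_of_finite (f := ζ)
    rw [zetaMin, ← hi]; exact hu i
  set c1 := 1 - 2 * u * zetaMin ζ with hc1
  have hc1pos : 0 < c1 := by linarith
  let a : Fin r → ℝ := fun j => √(1 - zetaMin ζ / ζ j)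
  let b : Fin r → ℝ := fun j => s j * √(zetaMin ζ / ζ j)
  have hρ : ∀ j, 0 < zetaMin ζ / ζ j := fun j => div_pos h1pos (hζ j)
  have ha : ∀ j, a j ^ 2 = 1 - zetaMin ζ / ζ j := fun j =>
    Real.sq_sqrt (by rw [sub_nonneg, div_le_one (hζ j)]; exact zetaMin_le ζ j)
  have hcj : ∀ j, 0 < 1 - 2 * u * ζ j := fun j => by linarith [hu j]
  have hform : ∀ j, 1 - c1⁻¹ * a j ^ 2 = c1⁻¹ * (zetaMin ζ / ζ j) * (1 - 2 * u * ζ j) := by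
    intro j
    have := (hζ j).ne'
    rw [ha]
    field_simp
    rw [hc1]; ring
  have hexp : ∀ z : Fin r → ℝ, c1⁻¹ * mixQ ζ s z = ∑ j, c1⁻¹ / 2 * (a j * z j + b j) ^ 2 := by
    intro z
    rw [mixQ, Finset.mul_sum, Finset.mul_sum]
    exact Finset.sum_congr rfl fun j _ => by ring
  simp_rw [hexp]
  rw [lintegral_prod_stdNormals (g := fun j z => c1⁻¹ / 2 * (a j * z + b j) ^ 2)
    (fun i => by fun_prop)]
  have hfac : ∀ j, ∫⁻ z, ENNReal.ofReal (Real.exp (c1⁻¹ / 2 * (a j * z + b j) ^ 2))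
      ∂(gaussianReal 0 1) = ENNReal.ofReal ((√(zetaMin ζ / ζ j))⁻¹ * √c1 *
        ((√(1 - 2 * u * ζ j))⁻¹ * Real.exp (s j ^ 2 / (2 * (1 - 2 * u * ζ j))))) := by
    intro j
    have h2 : 0 < c1⁻¹ * (zetaMin ζ / ζ j) * (1 - 2 * u * ζ j) :=
      mul_pos (mul_pos (inv_pos.2 hc1pos) (hρ j)) (hcj j)
    rw [lintegral_exp_sq_gaussian (by rw [← hform j] at h2; linarith), hform]
    congr 1
    have h3 : c1⁻¹ * b j ^ 2 / (2 * (c1⁻¹ * (zetaMin ζ / ζ j) * (1 - 2 * u * ζ j))) =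
        s j ^ 2 / (2 * (1 - 2 * u * ζ j)) := by
      have h4 : b j ^ 2 = s j ^ 2 * (zetaMin ζ / ζ j) := by
        simp only [b]; rw [mul_pow, Real.sq_sqrt (hρ j).le]
      have := (hcj j).ne'
      have h5 := (hρ j).ne'
      rw [h4]
      generalize zetaMin ζ / ζ j = ρ at h5
      field_simp
    rw [h3, Real.sqrt_mul (by have := hρ j; positivity), Real.sqrt_mul (by positivity),
      Real.sqrt_inv]
    have := (Real.sqrt_pos.2 hc1pos).ne'
    have := (Real.sqrt_pos.2 (hρ j)).ne'
    have := (Real.sqrt_pos.2 (hcj j)).ne'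
    field_simp
  simp_rw [hfac]
  rw [← ENNReal.ofReal_prod_of_nonneg (fun j _ => by positivity)]
  congr 1
  rw [Finset.prod_mul_distrib, Finset.prod_mul_distrib, Finset.prod_const, Finset.card_univ,
    Fintype.card_fin, Finset.prod_inv_distrib, Real.sqrt_prod _ (fun j _ => (hρ j).le)]

/-- The mixture of scaled chi-square laws with the weights `mixCoeff`. -/
def mixLaw (ζ s : Fin r → ℝ) : Measure ℝ :=
  Measure.sum fun k => ENNReal.ofReal (mixCoeff ζ s k) •
    (chiSqLaw (r + 2 * k)).map fun x => zetaMin ζ * x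

/-- Exponential moments are compared near `0`. The law of `ζ_(1) χ²_{r+2k}` has moment `c1^{-r/2}
c1^{-k}` at `u`, with `c1 = 1 - 2uζ_(1)`. Summed against weights proportional to `E[Q^k]/k!`, this
becomes an exponential series with value a constant times `c1^{-r/2} E[exp (Q / c1)]`, which
`lintegral_exp_mixQ` evaluates. -/
theorem wtdChiSqLaw_eq_mixLaw (hr : 0 < r) (hζ : ∀ i, 0 < ζ i) (s : Fin r → ℝ) :
    wtdChiSqLaw ζ s = mixLaw ζ s := by
  have h1pos := zetaMin_pos hr hζ
  have hρ : ∀ j, 0 < zetaMin ζ / ζ j := fun j => div_pos h1pos (hζ j)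
  set c0 : ℝ := √(∏ j, zetaMin ζ / ζ j) * Real.exp (-(1 / 2) * ∑ j, s j ^ 2) with hc0
  have hc0nn : 0 ≤ c0 := by positivity
  -- `mixCoeff` contains a Bochner integral, which would be `0` without integrability. Here `Q^k ≤
  -- k! e^Q`, and `e^Q` is integrable by the case `u = 0` of `lintegral_exp_mixQ`.
  have hintQ : ∀ k, Integrable (fun z => mixQ ζ s z ^ k) (stdNormals r) := by
    intro k
    have h2 : Integrable (fun z => Real.exp (mixQ ζ s z)) (stdNormals r) := by
      refine (lintegral_ofReal_ne_top_iff_integrable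
        (measurable_mixQ ζ s).exp.aestronglyMeasurable
        (ae_of_all _ fun _ => (Real.exp_pos _).le)).1 ?_
      have := lintegral_exp_mixQ hr hζ s (u := 0) (by simp)
      simp only [mul_zero, zero_mul, sub_zero, inv_one, one_mul] at this
      rw [this]; exact ENNReal.ofReal_ne_top
    refine Integrable.mono' (h2.const_mul (k.factorial : ℝ))
      ((measurable_mixQ ζ s).pow_const k).aestronglyMeasurable (ae_of_all _ fun z => ?_)
    rw [Real.norm_of_nonneg (pow_nonneg (mixQ_nonneg ζ s z) k)]
    have := Real.pow_div_factorial_le_exp _ (mixQ_nonneg ζ s z) k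
    rwa [div_le_iff₀' (by positivity)] at this
  have hcoeff : ∀ k, ENNReal.ofReal (mixCoeff ζ s k) = ENNReal.ofReal c0 *
      ∫⁻ z, ENNReal.ofReal (mixQ ζ s z ^ k / k.factorial) ∂(stdNormals r) := by
    intro k
    rw [← ofReal_integral_eq_lintegral_ofReal ((hintQ k).div_const _)
      (ae_of_all _ fun z => div_nonneg (pow_nonneg (mixQ_nonneg ζ s z) k) (by positivity)),
      ← ENNReal.ofReal_mul hc0nn, integral_div, mixCoeff]
    congr 1
    rw [hc0]; ring
  have hmix : ∀ u, (∀ i, 2 * u * ζ i < 1) →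
      ∫⁻ x, ENNReal.ofReal (Real.exp (u * x)) ∂(mixLaw ζ s) =
      ∫⁻ x, ENNReal.ofReal (Real.exp (u * x)) ∂(wtdChiSqLaw ζ s) := by
    intro u hu
    have hu1 : 2 * (u * zetaMin ζ) < 1 := by
      have : Nonempty (Fin r) := ⟨⟨0, hr⟩⟩
      obtain ⟨i, hi⟩ := exists_eq_ciInf_of_finite (f := ζ)
      rw [zetaMin, ← hi, ← mul_assoc]; exact hu i
    have hc1eq : 1 - 2 * (u * zetaMin ζ) = 1 - 2 * u * zetaMin ζ := by ring
    set c1 := 1 - 2 * u * zetaMin ζ with hc1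
    have hc1pos : 0 < c1 := by linarith
    have hcj : ∀ j, 0 < 1 - 2 * u * ζ j := fun j => by linarith [hu j]
    have hterm : ∀ k, ∫⁻ x, ENNReal.ofReal (Real.exp (u * x)) ∂(ENNReal.ofReal (mixCoeff ζ s k) •
        (chiSqLaw (r + 2 * k)).map fun x => zetaMin ζ * x) =
        ENNReal.ofReal (c0 * (√c1)⁻¹ ^ r) *
          ∫⁻ z, ENNReal.ofReal ((c1⁻¹ * mixQ ζ s z) ^ k / k.factorial) ∂(stdNormals r) := by
      intro k
      rw [lintegral_smul_measure, lintegral_map (by fun_prop) (by fun_prop)]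
      simp_rw [← mul_assoc]
      rw [lintegral_exp_chiSqLaw hu1, hc1eq, hcoeff, smul_eq_mul]
      have h3 : ∀ z, ENNReal.ofReal ((c1⁻¹ * mixQ ζ s z) ^ k / k.factorial) =
          ENNReal.ofReal (c1⁻¹ ^ k) * ENNReal.ofReal (mixQ ζ s z ^ k / k.factorial) := by
        intro z
        rw [← ENNReal.ofReal_mul (by positivity)]
        congr 1; rw [mul_pow]; ring
      simp_rw [h3]
      have hmQ := measurable_mixQ ζ s
      rw [lintegral_const_mul _ (by fun_prop), ENNReal.ofReal_mul hc0nn, pow_add, pow_mul,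
        ← ENNReal.ofReal_pow (by positivity), ← ENNReal.ofReal_pow (by positivity),
        ← ENNReal.ofReal_pow (by positivity)]
      have h4 : (√c1)⁻¹ ^ 2 = c1⁻¹ := by rw [inv_pow, Real.sq_sqrt hc1pos.le]
      rw [h4]
      ring
    rw [mixLaw, lintegral_sum_measure]
    simp_rw [hterm]
    have hmQ := measurable_mixQ ζ s
    rw [ENNReal.tsum_mul_left, ← lintegral_tsum (fun k => by fun_prop)]
    have hexp : ∀ z, ∑' k, ENNReal.ofReal ((c1⁻¹ * mixQ ζ s z) ^ k / k.factorial) =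
        ENNReal.ofReal (Real.exp (c1⁻¹ * mixQ ζ s z)) := by
      intro z
      have h5 := NormedSpace.expSeries_div_hasSum_exp (c1⁻¹ * mixQ ζ s z)
      have h6 : 0 ≤ c1⁻¹ * mixQ ζ s z := mul_nonneg (inv_pos.2 hc1pos).le (mixQ_nonneg _ _ _)
      rw [← ENNReal.ofReal_tsum_of_nonneg (fun k => by positivity) h5.summable, h5.tsum_eq,
        Real.exp_eq_exp_ℝ]
    simp_rw [hexp]
    rw [hc1, lintegral_exp_mixQ hr hζ s hu, lintegral_exp_wtdChiSqLaw hu, ← hc1,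
      ← ENNReal.ofReal_mul (by positivity), ← ENNReal.ofReal_prod_of_nonneg
      (fun j _ => by positivity)]
    congr 1
    have h7 : Real.exp (-(1 / 2) * ∑ j, s j ^ 2) = ∏ j, Real.exp (-(1 / 2) * s j ^ 2) := by
      rw [Finset.mul_sum, Real.exp_sum]
    have h8 : ∀ j, Real.exp (2 * u * ζ j * s j ^ 2 / (2 * (1 - 2 * u * ζ j))) =
        Real.exp (-(1 / 2) * s j ^ 2) * Real.exp (s j ^ 2 / (2 * (1 - 2 * u * ζ j))) := by
      intro j
      rw [← Real.exp_add]
      congr 1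
      have := (hcj j).ne'
      field_simp
      ring
    simp_rw [h8]
    rw [Finset.prod_mul_distrib, Finset.prod_mul_distrib, Finset.prod_mul_distrib, hc0, h7]
    have h9 : √(∏ i, zetaMin ζ / ζ i) ≠ 0 :=
      (Real.sqrt_pos.2 (Finset.prod_pos fun j _ => hρ j)).ne'
    have h10 : √c1 ≠ 0 := (Real.sqrt_pos.2 hc1pos).ne'
    rw [inv_pow]
    field_simp
  obtain ⟨δ, hδ, hδ'⟩ : ∃ δ > 0, ∀ u : ℝ, |u| < δ → ∀ i, 2 * u * ζ i < 1 := by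
    have hpos : 0 < 1 + ∑ j, ζ j := by
      have := Finset.sum_nonneg fun j (_ : j ∈ Finset.univ) => (hζ j).le
      linarith
    refine ⟨1 / (2 * (1 + ∑ j, ζ j)), by positivity, fun u hu i => ?_⟩
    have h1 : ζ i ≤ 1 + ∑ j, ζ j := by
      have := Finset.single_le_sum (fun j _ => (hζ j).le) (Finset.mem_univ i)
      linarith
    rw [lt_div_iff₀ (by positivity)] at hu
    have h2 : u * ζ i ≤ |u| * (1 + ∑ j, ζ j) :=
      mul_le_mul (le_abs_self u) h1 (hζ i).le (abs_nonneg u)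
    linarith
  -- The comparison at `u = 0` says that the weights have total mass one.
  have hfin : IsFiniteMeasure (mixLaw ζ s) := by
    have h2 := hmix 0 (by simp)
    simp only [zero_mul, Real.exp_zero, ENNReal.ofReal_one, lintegral_one, measure_univ] at h2
    exact ⟨by rw [h2]; simp⟩
  refine ext_of_lintegral_exp_eq hδ (fun u hu => ?_) (fun u hu => (hmix u (hδ' u hu)).symm)
  rw [lintegral_exp_wtdChiSqLaw (hδ' u hu)]
  exact ENNReal.prod_ne_top fun _ _ => ENNReal.ofReal_ne_top

theorem mixCoeff_nonneg (s : Fin r → ℝ) (k : ℕ) : 0 ≤ mixCoeff ζ s k := by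
  have : 0 ≤ ∫ z, mixQ ζ s z ^ k ∂(stdNormals r) :=
    integral_nonneg fun z => pow_nonneg (mixQ_nonneg ζ s z) k
  rw [mixCoeff]; positivity

/-- Tail probabilities of a weighted sum of noncentral chi-square variables as a series. -/
theorem hasSum_seriesTerm (hr : 0 < r) (hζ : ∀ i, 0 < ζ i) (s : Fin r → ℝ) (t : ℝ) :
    HasSum (seriesTerm ζ s t) ((wtdChiSqLaw ζ s).real (Set.Ioi t)) := by
  have h1pos := zetaMin_pos hr hζ
  have hterm : ∀ k, (ENNReal.ofReal (mixCoeff ζ s k) •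
      (chiSqLaw (r + 2 * k)).map fun x => zetaMin ζ * x) (Set.Ioi t) =
        ENNReal.ofReal (seriesTerm ζ s t k) := by
    intro k
    have hpre : (fun x => zetaMin ζ * x) ⁻¹' Set.Ioi t = Set.Ioi (t / zetaMin ζ) := by
      ext x; simp [div_lt_iff₀' h1pos]
    rw [Measure.smul_apply, Measure.map_apply (by fun_prop) measurableSet_Ioi, hpre, smul_eq_mul,
      seriesTerm, ENNReal.ofReal_mul (mixCoeff_nonneg s k), Measure.real,
      ENNReal.ofReal_toReal (measure_ne_top _ _)]
  have hnn : ∀ k, 0 ≤ seriesTerm ζ s t k := fun k =>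
    mul_nonneg (mixCoeff_nonneg s k) measureReal_nonneg
  have hval : (wtdChiSqLaw ζ s) (Set.Ioi t) = ∑' k, ENNReal.ofReal (seriesTerm ζ s t k) := by
    rw [wtdChiSqLaw_eq_mixLaw hr hζ, mixLaw, Measure.sum_apply _ measurableSet_Ioi]
    exact tsum_congr hterm
  have hne : ∑' k, ENNReal.ofReal (seriesTerm ζ s t k) ≠ ⊤ := hval ▸ measure_ne_top _ _
  have hsum : Summable (seriesTerm ζ s t) := by
    refine (ENNReal.summable_toReal hne).congr fun k => ENNReal.toReal_ofReal (hnn k)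
  have : (wtdChiSqLaw ζ s).real (Set.Ioi t) = ∑' k, seriesTerm ζ s t k := by
    rw [Measure.real, hval, ← ENNReal.ofReal_tsum_of_nonneg hnn hsum,
      ENNReal.toReal_ofReal (tsum_nonneg hnn)]
  rw [this]
  exact hsum.hasSum

/-- By Fubini: with the other coordinates fixed, the first one, which exists as `r > 0`, must solve
a quadratic equation with nonzero leading coefficient. That leaves at most two values, a null set
for the normal law. -/
theorem wtdChiSqLaw_singleton (hr : 0 < r) (hζ : ∀ i, 0 < ζ i) (s : Fin r → ℝ) (t : ℝ) :
    wtdChiSqLaw ζ s {t} = 0 := by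
  obtain ⟨m, rfl⟩ : ∃ m, r = m + 1 := ⟨r - 1, by omega⟩
  rw [wtdChiSqLaw, Measure.map_apply (by fun_prop) (measurableSet_singleton t), stdNormals]
  have hmp := (measurePreserving_piFinSuccAbove (fun _ : Fin (m + 1) => gaussianReal 0 1) 0).symm
  have hS : MeasurableSet ((fun z : Fin (m + 1) → ℝ => ∑ i, ζ i * (z i + s i) ^ 2) ⁻¹' {t}) :=
    (by fun_prop : Measurable fun z : Fin (m + 1) → ℝ => ∑ i, ζ i * (z i + s i) ^ 2)
      (measurableSet_singleton t)
  rw [← hmp.measure_preimage hS.nullMeasurableSet, Measure.prod_apply_symm (hmp.measurable hS),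
    lintegral_eq_zero_iff' (measurable_measure_prodMk_right (hmp.measurable hS)).aemeasurable]
  refine ae_of_all _ fun w => ?_
  set c := (t - ∑ i, ζ (Fin.succ i) * (w i + s (Fin.succ i)) ^ 2) / ζ 0 with hc
  have : NullSingletonClass (gaussianReal 0 1) := nullSingletonClass_gaussianReal one_ne_zero
  refine Set.Finite.measure_zero (Set.Finite.subset (Set.toFinite {√c - s 0, -√c - s 0}) ?_) _
  intro x hx
  simp only [Set.mem_preimage, Set.mem_singleton_iff, MeasurableEquiv.piFinSuccAbove_symm_apply,
    Fin.sum_univ_succ, Fin.insertNthEquiv_apply, Fin.insertNth_zero', Fin.cons_zero, Fin.cons_succ]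
    at hx
  have h1 : (x + s 0) ^ 2 = c := by
    rw [hc, eq_div_iff (hζ 0).ne']
    linarith
  have h2 : √c ^ 2 = c := Real.sq_sqrt (h1 ▸ sq_nonneg _)
  rw [← h2, sq_eq_sq_iff_eq_or_eq_neg] at h1
  rcases h1 with h1 | h1
  · left; linarith
  · right; simp only [Set.mem_singleton_iff]; linarith

/-- Without atoms the distribution function is continuous, so it takes the value `q` exactly at the
infimum: left limits give `≤`, right continuity gives `≥`. -/
theorem real_Iic_quantile {ν : Measure ℝ} [IsProbabilityMeasure ν] (hν : ∀ t, ν {t} = 0) {q : ℝ}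
    (h0 : 0 < q) (h1 : q < 1) : ν.real (Set.Iic (quantile ν q)) = q := by
  set A := {t : ℝ | q ≤ ν.real (Set.Iic t)} with hA
  have hA' : A = {t : ℝ | q ≤ cdf ν t} := by simp [hA, cdf_eq_real]
  have hne : A.Nonempty := by
    rw [hA']
    obtain ⟨t, ht⟩ := ((tendsto_cdf_atTop ν).eventually (lt_mem_nhds h1)).exists
    exact ⟨t, ht.le⟩
  have hbdd : BddBelow A := by
    rw [hA']
    obtain ⟨t, ht⟩ := ((tendsto_cdf_atBot ν).eventually (gt_mem_nhds h0)).exists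
    refine ⟨t, fun a ha => ?_⟩
    by_contra! hlt
    exact absurd (ha.trans ((monotone_cdf ν) hlt.le)) (not_le.2 ht)
  have hq : quantile ν q = sInf A := rfl
  rw [hq, ← cdf_eq_real]
  refine le_antisymm ?_ ?_
  · have h2 : (cdf ν).measure {sInf A} = 0 := by rw [measure_cdf]; exact hν _
    rw [StieltjesFunction.measure_singleton, ENNReal.ofReal_eq_zero, sub_nonpos] at h2
    refine h2.trans (le_of_tendsto ((monotone_cdf ν).tendsto_leftLim (sInf A)) ?_)
    filter_upwards [self_mem_nhdsWithin] with t ht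
    by_contra! hlt
    have : t ∈ A := by rw [hA']; exact hlt.le
    exact absurd (csInf_le hbdd this) (not_le.2 ht)
  · have h2 : Tendsto (cdf ν) (𝓝[>] (sInf A)) (𝓝 (cdf ν (sInf A))) :=
      ((cdf ν).right_continuous (sInf A)).mono_left (nhdsWithin_mono _ Set.Ioi_subset_Ici_self)
    refine ge_of_tendsto h2 ?_
    filter_upwards [self_mem_nhdsWithin] with t ht
    obtain ⟨a, ha, hat⟩ := exists_lt_of_csInf_lt hne ht
    rw [hA'] at ha
    exact le_trans ha ((monotone_cdf ν) hat.le)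

/-- The `(1 - α)`-quantile of the null law is exceeded with probability `α`. -/
theorem wtdChiSqLaw_Ioi_quantile (hr : 0 < r) (hζ : ∀ i, 0 < ζ i) {α : ℝ} (h0 : 0 < α)
    (h1 : α < 1) (s : Fin r → ℝ) :
    (wtdChiSqLaw ζ s).real (Set.Ioi (quantile (wtdChiSqLaw ζ s) (1 - α))) = α := by
  have h2 := real_Iic_quantile (wtdChiSqLaw_singleton hr hζ s) (q := 1 - α) (by linarith)
    (by linarith)
  have h3 := probReal_compl_eq_one_sub (μ := wtdChiSqLaw ζ s)
    (measurableSet_Iic (a := quantile (wtdChiSqLaw ζ s) (1 - α)))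
  rw [Set.compl_Iic, h2] at h3
  linarith

end Mixture

/-! ### Matrix algebra -/

section SquareRoot

variable {p : ℕ} {S : Matrix (Fin p) (Fin p) ℝ}

open scoped MatrixOrder in
theorem spectrum_nonneg_of_posSemidef (hS : S.PosSemidef) {x : ℝ} (hx : x ∈ spectrum ℝ S) :
    0 ≤ x :=
  spectrum_nonneg_of_nonneg hS.nonneg hx

theorem continuousOn_spectrum (S : Matrix (Fin p) (Fin p) ℝ) (g : ℝ → ℝ) :
    ContinuousOn g (spectrum ℝ S) :=
  (Matrix.finite_real_spectrum (A := S)).continuousOn g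

open scoped MatrixOrder in
theorem sqrt_eq_sqrtMat (hS : S.PosSemidef) : CFC.sqrt S = sqrtMat S := by
  have : IsSelfAdjoint S := hS.1
  rw [CFC.sqrt_eq_real_sqrt _ hS.nonneg, cfcₙ_eq_cfc, sqrtMat]

theorem sqrtMat_mul_self (hS : S.PosSemidef) : sqrtMat S * sqrtMat S = S := by
  have : IsSelfAdjoint S := hS.1
  rw [sqrtMat, ← cfc_mul Real.sqrt Real.sqrt S (continuousOn_spectrum S _)
    (continuousOn_spectrum S _)]
  conv_rhs => rw [← cfc_id' ℝ S]
  exact cfc_congr fun x hx => Real.mul_self_sqrt (spectrum_nonneg_of_posSemidef hS hx)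

/-- On the spectrum `√x · (√x)⁻¹ · x = x`, also at `x = 0`. Hence a vector in the range of a
singular `S` is recovered from its image under `S^{-1/2}`. -/
theorem sqrtMat_mul_invSqrtMat_mul (hS : S.PosSemidef) :
    sqrtMat S * (invSqrtMat S * S) = S := by
  have : IsSelfAdjoint S := hS.1
  have h1 : invSqrtMat S * S = cfc (fun x : ℝ => (√x)⁻¹ * x) S := by
    rw [cfc_mul (fun x : ℝ => (√x)⁻¹) (fun x => x) S (continuousOn_spectrum S _)
      (continuousOn_spectrum S _), cfc_id' ℝ S, invSqrtMat]
  rw [h1, sqrtMat, ← cfc_mul _ _ S (continuousOn_spectrum S _) (continuousOn_spectrum S _)]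
  conv_rhs => rw [← cfc_id' ℝ S]
  refine cfc_congr fun x hx => ?_
  have h0 := spectrum_nonneg_of_posSemidef hS hx
  rcases h0.eq_or_lt with h | h
  · simp [← h]
  · have := (Real.sqrt_pos.2 h).ne'
    field_simp

open scoped MatrixOrder in
theorem posSemidef_sqrtMat (hS : S.PosSemidef) : (sqrtMat S).PosSemidef := by
  rw [← sqrt_eq_sqrtMat hS]
  exact (CFC.sqrt_nonneg S).posSemidef

theorem transpose_sqrtMat (hS : S.PosSemidef) : (sqrtMat S)ᵀ = sqrtMat S := by
  simpa using (posSemidef_sqrtMat hS).1.eq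

theorem isUnit_det_sqrtMat (hS : S.PosDef) : IsUnit (sqrtMat S).det := by
  have h1 := congrArg Matrix.det (sqrtMat_mul_self hS.posSemidef)
  rw [det_mul] at h1
  have h2 : S.det ≠ 0 := hS.det_pos.ne'
  rw [← h1] at h2
  exact (left_ne_zero_of_mul h2).isUnit

/-- The rank of `Bᵀ A B` for positive definite `A`. -/
theorem rank_transpose_mul_mul {m : ℕ} {A : Matrix (Fin p) (Fin p) ℝ} (hA : A.PosDef)
    (B : Matrix (Fin p) (Fin m) ℝ) : (Bᵀ * A * B).rank = B.rank := by
  have h1 : Bᵀ * A * B = (sqrtMat A * B)ᵀ * (sqrtMat A * B) := by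
    rw [transpose_mul, transpose_sqrtMat hA.posSemidef, Matrix.mul_assoc, Matrix.mul_assoc,
      ← Matrix.mul_assoc (sqrtMat A), sqrtMat_mul_self hA.posSemidef]
  rw [h1, rank_transpose_mul_self, rank_mul_eq_right_of_isUnit_det _ _ (isUnit_det_sqrtMat hA)]

end SquareRoot

/-! ### Spectral systems and the law of a quadratic form. -/

section Spectral

variable {p r : ℕ} {A S : Matrix (Fin p) (Fin p) ℝ}

/-- Since `XY` and `YX` have the same characteristic polynomial, the nonsymmetric product `A S` has
the real spectrum of a symmetric matrix. -/
theorem charpoly_mul_eq (hS : S.PosSemidef) :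
    (A * S).charpoly = (sqrtMat S * A * sqrtMat S).charpoly := by
  rw [Matrix.mul_assoc (sqrtMat S), Matrix.charpoly_mul_comm (sqrtMat S), Matrix.mul_assoc,
    sqrtMat_mul_self hS]

theorem posSemidef_conj_sqrtMat (hA : A.PosSemidef) (hS : S.PosSemidef) :
    (sqrtMat S * A * sqrtMat S).PosSemidef := by
  have := hA.conjTranspose_mul_mul_same (sqrtMat S)
  rwa [(posSemidef_sqrtMat hS).1.eq] at this

theorem rank_sqrtMat (hS : S.PosSemidef) : (sqrtMat S).rank = S.rank := by
  conv_rhs => rw [← sqrtMat_mul_self hS]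
  have := rank_transpose_mul_self (sqrtMat S)
  rw [transpose_sqrtMat hS] at this
  exact this.symm

/-- The number of nonzero eigenvalues of `S^{1/2} A S^{1/2}` is its rank, which is the rank of `S`
as `A` is definite. An eigenbasis restricted to them is the required system. -/
theorem exists_isSpectralSystem (hA : A.PosDef) (hS : S.PosSemidef) (hr : S.rank = r) :
    ∃ (ζ : Fin r → ℝ) (v : Fin r → Vec p), IsSpectralSystem A S ζ v := by
  have hM := (posSemidef_conj_sqrtMat hA.posSemidef hS).1
  have hcard : Fintype.card {i // hM.eigenvalues i ≠ 0} = r := by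
    rw [← hM.rank_eq_card_non_zero_eigs, ← hr, ← rank_sqrtMat hS]
    have := rank_transpose_mul_mul hA (sqrtMat S)
    rwa [transpose_sqrtMat hS] at this
  let e : Fin r ≃ {i // hM.eigenvalues i ≠ 0} := (Fintype.equivFinOfCardEq hcard).symm
  refine ⟨fun k => hM.eigenvalues (e k), fun k => hM.eigenvectorBasis (e k), ?_, ?_, ?_⟩
  · rw [charpoly_mul_eq hS, hM.roots_charpoly_eq_eigenvalues, Multiset.filter_map]
    have h1 : Finset.univ.val.map (fun k => hM.eigenvalues (e k)) =
        (Finset.univ.val.map (fun k => (e k : Fin p))).map hM.eigenvalues := by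
      rw [Multiset.map_map]; rfl
    rw [h1]
    congr 1
    have h2 : (Finset.univ : Finset (Fin r)).map (e.toEmbedding.trans (Function.Embedding.subtype _))
        = Finset.univ.filter fun i => hM.eigenvalues i ≠ 0 := by
      ext i
      simp only [Finset.mem_map, Finset.mem_univ, true_and, Finset.mem_filter]
      constructor
      · rintro ⟨k, rfl⟩; exact (e k).2
      · intro hi; exact ⟨e.symm ⟨i, hi⟩, by simp⟩
    have h3 := congrArg Finset.val h2
    rw [Finset.map_val, Finset.filter_val] at h3
    refine Eq.trans ?_ h3.symm
    congr
  · exact hM.eigenvectorBasis.orthonormal.comp _ (Subtype.val_injective.comp e.injective)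
  · exact fun i => hM.mulVec_eigenvectorBasis (e i)

theorem IsSpectralSystem.pos {ζ : Fin r → ℝ} {v : Fin r → Vec p} (h : IsSpectralSystem A S ζ v)
    (hA : A.PosSemidef) (hS : S.PosSemidef) (i : Fin r) : 0 < ζ i := by
  have hM := posSemidef_conj_sqrtMat hA hS
  have h1 : ζ i ∈ Finset.univ.val.map ζ := Multiset.mem_map_of_mem _ (Finset.mem_univ_val i)
  rw [← h.eigenvalues, Multiset.mem_filter, charpoly_mul_eq hS,
    hM.1.roots_charpoly_eq_eigenvalues, Multiset.mem_map] at h1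
  obtain ⟨⟨j, _, hj⟩, hne⟩ := h1
  refine lt_of_le_of_ne ?_ (Ne.symm hne)
  rw [← hj]
  exact hM.eigenvalues_nonneg j

theorem IsSpectralSystem.sum_eq_trace {ζ : Fin r → ℝ} {v : Fin r → Vec p}
    (h : IsSpectralSystem A S ζ v) (hA : A.PosSemidef) (hS : S.PosSemidef) :
    ∑ i, ζ i = (sqrtMat S * A * sqrtMat S).trace := by
  have hM := posSemidef_conj_sqrtMat hA hS
  have h1 : (Finset.univ.val.map ζ).sum = ∑ i, ζ i := rfl
  rw [← h1, ← h.eigenvalues, charpoly_mul_eq hS, hM.1.roots_charpoly_eq_eigenvalues,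
    hM.1.trace_eq_sum_eigenvalues, Multiset.filter_map]
  have h2 : ∑ i, hM.1.eigenvalues i = ∑ i with hM.1.eigenvalues i ≠ 0, hM.1.eigenvalues i := by
    rw [Finset.sum_filter_ne_zero]
  exact h2.symm

/-- The spectral decomposition of the quadratic form of `S^{1/2} A S^{1/2}`. -/
theorem IsSpectralSystem.quadForm {ζ : Fin r → ℝ} {v : Fin r → Vec p}
    (h : IsSpectralSystem A S ζ v) (hA : A.PosSemidef) (hS : S.PosSemidef) (x : Fin p → ℝ) :
    x ⬝ᵥ (sqrtMat S * A * sqrtMat S) *ᵥ x = ∑ i, ζ i * ((v i).ofLp ⬝ᵥ x) ^ 2 := by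
  set M := sqrtMat S * A * sqrtMat S with hMdef
  have hM : M.PosSemidef := posSemidef_conj_sqrtMat hA hS
  have hMt : Mᵀ = M := by simpa using hM.1.eq
  -- For an arbitrary spectral system, nothing is yet known about `M` off the span of the `v i`. The
  -- matrix `M - R` turns out to be positive semidefinite with trace zero, so it vanishes.
  let R : Matrix (Fin p) (Fin p) ℝ := ∑ i, ζ i • vecMulVec (v i).ofLp (v i).ofLp
  have hR : ∀ z, R *ᵥ z = ∑ i, (ζ i * ((v i).ofLp ⬝ᵥ z)) • (v i).ofLp := by
    intro z
    simp only [R, sum_mulVec, smul_mulVec, vecMulVec_mulVec, op_smul_eq_smul, smul_smul]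
  have horth : ∀ i j, (v i).ofLp ⬝ᵥ (v j).ofLp = if i = j then 1 else 0 := by
    intro i j
    have := (orthonormal_iff_ite.1 h.orthonormal) j i
    rw [EuclideanSpace.inner_eq_star_dotProduct] at this
    simpa [eq_comm] using this
  have hquad : ∀ z, z ⬝ᵥ R *ᵥ z = ∑ i, ζ i * ((v i).ofLp ⬝ᵥ z) ^ 2 := by
    intro z
    rw [hR, dotProduct_sum]
    refine Finset.sum_congr rfl fun i _ => ?_
    rw [dotProduct_smul, smul_eq_mul, dotProduct_comm z]; ring
  have hvM : ∀ i z, (v i).ofLp ⬝ᵥ M *ᵥ z = ζ i * ((v i).ofLp ⬝ᵥ z) := by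
    intro i z
    rw [dotProduct_mulVec, ← mulVec_transpose, hMt, h.eigenvectors i, smul_dotProduct, smul_eq_mul]
  have hpsd : (M - R).PosSemidef := by
    refine PosSemidef.of_dotProduct_mulVec_nonneg ?_ fun z => ?_
    · refine hM.1.sub ?_
      rw [IsHermitian, conjTranspose_sum]
      refine Finset.sum_congr rfl fun i _ => ?_
      ext a b
      simp [vecMulVec_apply, mul_comm]
    -- `w` is the orthogonal projection of `z` on the span of the `v i`; the value of the form `M -
    -- R` at `z` equals that of `M` at `z - w`.
    · let w := ∑ i, ((v i).ofLp ⬝ᵥ z) • (v i).ofLp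
      have h0 : 0 ≤ (z - w) ⬝ᵥ M *ᵥ (z - w) := by
        have := hM.dotProduct_mulVec_nonneg (z - w)
        simpa using this
      have h1 : M *ᵥ w = R *ᵥ z := by
        rw [hR, mulVec_sum]
        refine Finset.sum_congr rfl fun i _ => ?_
        rw [mulVec_smul, hMdef, h.eigenvectors, smul_smul, mul_comm]
      have h2 : w ⬝ᵥ M *ᵥ z = z ⬝ᵥ R *ᵥ z := by
        rw [hquad, sum_dotProduct]
        refine Finset.sum_congr rfl fun i _ => ?_
        rw [smul_dotProduct, hvM, smul_eq_mul]; ring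
      have h3 : w ⬝ᵥ R *ᵥ z = z ⬝ᵥ R *ᵥ z := by
        rw [hR, dotProduct_sum, dotProduct_sum]
        refine Finset.sum_congr rfl fun i _ => ?_
        rw [dotProduct_smul, dotProduct_smul, sum_dotProduct]
        simp only [smul_dotProduct, horth]
        simp [dotProduct_comm]
      rw [mulVec_sub, h1, sub_dotProduct, dotProduct_sub, dotProduct_sub, h2, h3] at h0
      rw [sub_mulVec, dotProduct_sub, star_trivial]
      linarith
  -- The `ζ i` are all the nonzero eigenvalues with multiplicity, so they sum to the trace of `M`.
  have htr : (M - R).trace = 0 := by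
    rw [trace_sub, ← h.sum_eq_trace hA hS]
    simp only [R, trace_sum, trace_smul, trace_vecMulVec, horth]
    simp
  have hMR : M - R = 0 := hpsd.trace_eq_zero_iff.1 htr
  rw [sub_eq_zero.1 hMR, hquad]

/-- Compare characteristic functions: orthonormality gives `‖∑ t_i v_i‖ = ‖t‖`. -/
theorem map_stdGaussian_orthonormal {v : Fin r → Vec p} (hv : Orthonormal ℝ v) :
    (stdGaussian (Vec p)).map (fun z i => (v i).ofLp ⬝ᵥ z.ofLp) = stdNormals r := by
  have hm : Measurable fun (z : Vec p) i => (v i).ofLp ⬝ᵥ z.ofLp := by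
    unfold dotProduct; fun_prop
  have h1 : ((stdGaussian (Vec p)).map (fun z i => (v i).ofLp ⬝ᵥ z.ofLp)).map (WithLp.toLp 2) =
      (stdNormals r).map (WithLp.toLp 2) := by
    rw [stdNormals, map_pi_eq_stdGaussian, Measure.map_map (by fun_prop) hm]
    refine Measure.ext_of_charFun (funext fun t => ?_)
    rw [charFun_stdGaussian, charFun_apply, integral_map (by fun_prop) (by fun_prop)]
    have h2 : ∀ z : Vec p, inner ℝ ((WithLp.toLp 2 ∘ fun (z : Vec p) i => (v i).ofLp ⬝ᵥ z.ofLp) z) t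
        = inner ℝ z (∑ i, t i • v i) := by
      intro z
      rw [inner_sum, PiLp.inner_apply]
      refine Finset.sum_congr rfl fun i _ => ?_
      rw [inner_smul_right, EuclideanSpace.inner_eq_star_dotProduct]
      simp [mul_comm]
    simp_rw [h2]
    rw [← charFun_apply, charFun_stdGaussian]
    have h3 : ‖∑ i, t i • v i‖ ^ 2 = ‖t‖ ^ 2 := by
      rw [← real_inner_self_eq_norm_sq, hv.inner_sum, EuclideanSpace.real_norm_sq_eq]
      simp [sq]
    rw [(sq_eq_sq₀ (norm_nonneg _) (norm_nonneg _)).1 h3]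
  have h3 : ∀ ν : Measure (Fin r → ℝ),
      (ν.map (WithLp.toLp 2)).map (WithLp.ofLp : Vec r → Fin r → ℝ) = ν := fun ν => by
    rw [Measure.map_map (by fun_prop) (by fun_prop)]
    exact Measure.map_id
  rw [← h3 (stdNormals r), ← h1, h3]

/-- The law of a quadratic form in a possibly degenerate normal vector. -/
theorem quadFormLaw_eq_wtdChiSqLaw {ζ : Fin r → ℝ} {v : Fin r → Vec p}
    (h : IsSpectralSystem A S ζ v) (hA : A.PosSemidef) (hS : S.PosSemidef) {m : Vec p}
    (hm : ∃ w, m.ofLp = S *ᵥ w) :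
    quadFormLaw A S m = wtdChiSqLaw ζ (sqrtDelta S v m) := by
  obtain ⟨w, hw⟩ := hm
  set m' := invSqrtMat S *ᵥ m.ofLp with hm'
  -- This is where the mean must lie in the range of `S`: then the normal vector is `S^{1/2} (m' +
  -- Z)` with `Z` standard.
  have hmm : sqrtMat S *ᵥ m' = m.ofLp := by
    rw [hm', hw, mulVec_mulVec, mulVec_mulVec, Matrix.mul_assoc, sqrtMat_mul_invSqrtMat_mul hS]
  have hmeas : Measurable fun (z : Vec p) i => (v i).ofLp ⬝ᵥ z.ofLp := by
    unfold dotProduct; fun_prop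
  rw [quadFormLaw, multivariateGaussian, sqrt_eq_sqrtMat hS, Measure.map_map
    (by unfold dotProduct mulVec dotProduct; fun_prop) (by fun_prop), wtdChiSqLaw,
    ← map_stdGaussian_orthonormal h.orthonormal, Measure.map_map (by fun_prop) hmeas]
  congr 1
  funext z
  simp only [Function.comp_apply]
  have h1 : (m + toEuclideanCLM (𝕜 := ℝ) (sqrtMat S) z).ofLp = sqrtMat S *ᵥ (m' + z.ofLp) := by
    rw [mulVec_add, hmm]; simp
  have h2 : (sqrtMat S *ᵥ (m' + z.ofLp)) ⬝ᵥ A *ᵥ (sqrtMat S *ᵥ (m' + z.ofLp)) =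
      (m' + z.ofLp) ⬝ᵥ (sqrtMat S * A * sqrtMat S) *ᵥ (m' + z.ofLp) := by
    rw [← mulVec_mulVec, ← mulVec_mulVec, dotProduct_mulVec (m' + z.ofLp), ← mulVec_transpose,
      transpose_sqrtMat hS]
  rw [h1, h2, h.quadForm hA hS]
  refine Finset.sum_congr rfl fun i _ => ?_
  rw [dotProduct_add, sqrtDelta, ← hm']
  ring

end Spectral

/-! ### Ranks and identities for the matrix `K = J⁻¹ - P`. -/

section Projection

variable {p r : ℕ} {J V A : Matrix (Fin p) (Fin p) ℝ} {H : Matrix (Fin p) (Fin r) ℝ}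

theorem mulVec_injective_of_rank_eq (hH : H.rank = r) : Function.Injective H.mulVec := by
  rw [mulVec_injective_iff, linearIndependent_iff_card_eq_finrank_span, Fintype.card_fin,
    Set.finrank, ← rank_eq_finrank_span_cols, hH]

theorem posDef_transpose_mul_inv_mul (hJ : J.PosDef) (hH : H.rank = r) :
    (Hᵀ * J⁻¹ * H).PosDef := by
  have := hJ.inv.conjTranspose_mul_mul_same (mulVec_injective_of_rank_eq hH)
  rwa [conjTranspose_eq_transpose_of_trivial] at this

/-- The matrix `J⁻¹ H (Hᵀ J⁻¹ H)⁻¹ Hᵀ J⁻¹`. -/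
def projMat (J : Matrix (Fin p) (Fin p) ℝ) (H : Matrix (Fin p) (Fin r) ℝ) :
    Matrix (Fin p) (Fin p) ℝ :=
  J⁻¹ * H * (Hᵀ * J⁻¹ * H)⁻¹ * Hᵀ * J⁻¹

theorem transpose_inv_of_posDef {n : ℕ} {J : Matrix (Fin n) (Fin n) ℝ} (hJ : J.PosDef) :
    (J⁻¹)ᵀ = J⁻¹ := by
  simpa using hJ.inv.1.eq

theorem transpose_projMat (hJ : J.PosDef) (hH : H.rank = r) : (projMat J H)ᵀ = projMat J H := by
  have h1 := transpose_inv_of_posDef (posDef_transpose_mul_inv_mul hJ hH)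
  rw [projMat]
  generalize (Hᵀ * J⁻¹ * H)⁻¹ = N at h1 ⊢
  simp only [transpose_mul, transpose_inv_of_posDef hJ, transpose_transpose, h1,
    Matrix.mul_assoc]

/-- `K = Bᵀ N B` with `B = Hᵀ J⁻¹` of rank `r` and `N` positive definite. -/
theorem rank_projMat (hJ : J.PosDef) (hH : H.rank = r) : (projMat J H).rank = r := by
  have h1 : projMat J H = (Hᵀ * J⁻¹)ᵀ * (Hᵀ * J⁻¹ * H)⁻¹ * (Hᵀ * J⁻¹) := by
    simp only [projMat, transpose_mul, transpose_inv_of_posDef hJ, transpose_transpose,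
      Matrix.mul_assoc]
  rw [h1, rank_transpose_mul_mul (posDef_transpose_mul_inv_mul hJ hH).inv,
    rank_mul_eq_left_of_isUnit_det _ _ (by simpa using hJ.inv.det_pos.ne'), rank_transpose, hH]

theorem rank_projMat_conj (hJ : J.PosDef) (hH : H.rank = r) (hV : V.PosDef) :
    (projMat J H * V * projMat J H).rank = r := by
  have := rank_transpose_mul_mul hV (projMat J H)
  rwa [transpose_projMat hJ hH, rank_projMat hJ hH] at this

theorem rank_conj_projMat_conj (hJ : J.PosDef) (hH : H.rank = r) (hV : V.PosDef) (hA : A.PosDef) :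
    (V * projMat J H * A * projMat J H * V).rank = r := by
  have hVt : Vᵀ = V := by simpa using hV.1.eq
  have h1 : (projMat J H * V).rank = r := by
    rw [rank_mul_eq_left_of_isUnit_det V (projMat J H) (by simpa using hV.det_pos.ne'),
      rank_projMat hJ hH]
  have h2 := rank_transpose_mul_mul hA (projMat J H * V)
  rwa [transpose_mul, hVt, transpose_projMat hJ hH, h1, ← Matrix.mul_assoc] at h2

theorem posSemidef_projMat_conj (hJ : J.PosDef) (hH : H.rank = r) (hV : V.PosSemidef) :
    (projMat J H * V * projMat J H).PosSemidef := by
  have := hV.conjTranspose_mul_mul_same (projMat J H)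
  rwa [conjTranspose_eq_transpose_of_trivial, transpose_projMat hJ hH] at this

/-- The range of `projMat` is the range of `projMat * V * projMat`. -/
theorem exists_projMat_conj_mulVec_eq (hJ : J.PosDef) (hH : H.rank = r) (hV : V.PosDef)
    (z : Fin p → ℝ) : ∃ w, projMat J H *ᵥ z = (projMat J H * V * projMat J H) *ᵥ w := by
  set K := projMat J H
  have hle : LinearMap.range (K * V * K).mulVecLin ≤ LinearMap.range K.mulVecLin := by
    rintro _ ⟨x, rfl⟩
    refine ⟨(V * K) *ᵥ x, ?_⟩
    simp [mulVec_mulVec, Matrix.mul_assoc]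
  -- One range contains the other and both have dimension `r`.
  have heq : LinearMap.range (K * V * K).mulVecLin = LinearMap.range K.mulVecLin := by
    refine Submodule.eq_of_le_of_finrank_eq hle ?_
    have h1 := rank_projMat_conj hJ hH hV
    have h2 := rank_projMat hJ hH
    rw [Matrix.rank] at h1 h2
    rw [h1, h2]
  have hz : K *ᵥ z ∈ LinearMap.range K.mulVecLin := ⟨z, rfl⟩
  rw [← heq] at hz
  obtain ⟨w, hw⟩ := hz
  exact ⟨w, hw.symm⟩

/-- This identity and the next two are the algebraic hypotheses of `constrained_root_expansion` for
`P = J⁻¹ - K`. -/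
theorem inv_sub_projMat_mul (hJ : J.PosDef) :
    (J⁻¹ - projMat J H) * J = 1 - (J⁻¹ * H * (Hᵀ * J⁻¹ * H)⁻¹) * Hᵀ := by
  have h1 : J⁻¹ * J = 1 := nonsing_inv_mul J (by simpa using hJ.det_pos.ne')
  rw [Matrix.sub_mul, h1, projMat, Matrix.mul_assoc _ J⁻¹ J, h1, Matrix.mul_one]

theorem inv_sub_projMat_mul_eq_zero (hJ : J.PosDef) (hH : H.rank = r) :
    (J⁻¹ - projMat J H) * H = 0 := by
  have h1 : (Hᵀ * J⁻¹ * H)⁻¹ * (Hᵀ * J⁻¹ * H) = 1 := nonsing_inv_mul _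
    (by simpa using (posDef_transpose_mul_inv_mul hJ hH).det_pos.ne')
  have h2 : projMat J H * H = J⁻¹ * H * ((Hᵀ * J⁻¹ * H)⁻¹ * (Hᵀ * J⁻¹ * H)) := by
    simp only [projMat, Matrix.mul_assoc]
  rw [Matrix.sub_mul, h2, h1, Matrix.mul_one, sub_self]

theorem leftInverse_of_rank_eq (hJ : J.PosDef) (hH : H.rank = r) :
    ((Hᵀ * J⁻¹ * H)⁻¹ * Hᵀ * J⁻¹) * H = 1 := by
  have h1 : (Hᵀ * J⁻¹ * H)⁻¹ * (Hᵀ * J⁻¹ * H) = 1 := nonsing_inv_mul _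
    (by simpa using (posDef_transpose_mul_inv_mul hJ hH).det_pos.ne')
  rw [← h1]
  simp only [Matrix.mul_assoc]

/-- The linear image of a normal vector. -/
theorem map_mulVec_multivariateGaussian (hV : V.PosSemidef) {K : Matrix (Fin p) (Fin p) ℝ}
    (hK : Kᵀ = K) (hS : (K * V * K).PosSemidef) (m : Vec p) :
    (multivariateGaussian m V).map (toEuclideanCLM (𝕜 := ℝ) K) =
      multivariateGaussian (toEuclideanCLM (𝕜 := ℝ) K m) (K * V * K) := by
  refine Measure.ext_of_charFun (funext fun t => ?_)
  have h1 : ∀ w : Vec p, inner ℝ (toEuclideanCLM (𝕜 := ℝ) K w) t =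
      inner ℝ w (toEuclideanCLM (𝕜 := ℝ) K t) := by
    intro w
    simp only [EuclideanSpace.inner_eq_star_dotProduct, star_trivial]
    simp only [ofLp_toEuclideanCLM]
    rw [dotProduct_mulVec, ← mulVec_transpose, hK]
  rw [charFun_apply, integral_map (by fun_prop) (by fun_prop)]
  simp_rw [h1]
  rw [← charFun_apply, charFun_multivariateGaussian hV, charFun_multivariateGaussian hS]
  congr 2
  · rw [real_inner_comm, ← h1, real_inner_comm]
  · have : (toEuclideanCLM (𝕜 := ℝ) K t).ofLp ⬝ᵥ V *ᵥ (toEuclideanCLM (𝕜 := ℝ) K t).ofLp =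
        t.ofLp ⬝ᵥ (K * V * K) *ᵥ t.ofLp := by
      simp only [ofLp_toEuclideanCLM]
      rw [← mulVec_mulVec, ← mulVec_mulVec, dotProduct_mulVec t.ofLp, ← mulVec_transpose, hK]
    rw [this]

end Projection

/-! ### Calculus on a Euclidean space -/

section Calculus

variable {E : Type*} [NormedAddCommGroup E] [InnerProductSpace ℝ E]

/-- `d ↦ ⟪u, d⟫ u`. -/
def outerSelf (u : E) : E →L[ℝ] E := (innerSL ℝ u).smulRight u

theorem outerSelf_apply (u d : E) : outerSelf u d = inner ℝ u d • u := rfl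

theorem continuous_outerSelf : Continuous (outerSelf : E → E →L[ℝ] E) := by
  have : (outerSelf : E → E →L[ℝ] E) = fun u =>
      ContinuousLinearMap.smulRightL ℝ E E (innerSL ℝ u) u := rfl
  rw [this]
  exact (ContinuousLinearMap.continuous₂ _).comp ((innerSL ℝ).continuous.prodMk continuous_id)

theorem norm_outerSelf_le (u : E) : ‖outerSelf u‖ ≤ ‖u‖ ^ 2 := by
  rw [outerSelf, ContinuousLinearMap.norm_smulRight_apply, innerSL_apply_norm, sq]

theorem norm_fderiv_fderiv_sub_le {g : E → ℝ} {M ρ : ℝ} {θ₀ : E}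
    (hd : ∀ θ ∈ Metric.ball θ₀ ρ, DifferentiableAt ℝ (fderiv ℝ (fderiv ℝ g)) θ)
    (hM : ∀ θ ∈ Metric.ball θ₀ ρ, ‖iteratedFDeriv ℝ 3 g θ‖ ≤ M) {θ : E}
    (hθ : θ ∈ Metric.ball θ₀ ρ) :
    ‖fderiv ℝ (fderiv ℝ g) θ - fderiv ℝ (fderiv ℝ g) θ₀‖ ≤ M * ‖θ - θ₀‖ := by
  refine Convex.norm_image_sub_le_of_norm_fderiv_le (𝕜 := ℝ) hd (fun x hx => ?_)
    (convex_ball θ₀ ρ) (Metric.mem_ball_self (dist_nonneg.trans_lt hθ)) hθ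
  refine le_trans (le_of_eq ?_) (hM x hx)
  rw [← norm_iteratedFDeriv_fderiv, ← norm_iteratedFDeriv_fderiv, ← norm_iteratedFDeriv_fderiv,
    norm_iteratedFDeriv_zero]

variable [CompleteSpace E]

/-- The Riesz isomorphism of a real Hilbert space, as a linear map. -/
def riesz : StrongDual ℝ E ≃ₗᵢ[ℝ] E := (InnerProductSpace.toDual ℝ E).symm

theorem inner_riesz (T : StrongDual ℝ E) (d : E) : inner ℝ (riesz T) d = T d :=
  InnerProductSpace.toDual_symm_apply

theorem riesz_innerSL (u : E) : riesz (innerSL ℝ u) = u :=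
  ext_inner_right ℝ fun d => by rw [inner_riesz]; rfl

theorem hasGradientAt_riesz {g : E → ℝ} {T : StrongDual ℝ E} {θ : E} (h : HasFDerivAt g T θ) :
    HasGradientAt g (riesz T) θ := h.hasGradientAt

theorem innerSL_gradient (g : E → ℝ) (θ : E) : innerSL ℝ (gradient g θ) = fderiv ℝ g θ := by
  ext d
  exact inner_riesz _ d

/-- Near `θ₀`, `psi` is the gradient of `lam`, and it is approximated by its linearization `B`,
with Lipschitz constant `M`. -/
structure ScoreRegularAt (lam : E → ℝ) (psi : E → E) (B : E →L[ℝ] E) (M ρ : ℝ) (θ₀ : E) :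
    Prop where
  hasGradientAt : ∀ θ ∈ Metric.ball θ₀ ρ, HasGradientAt lam (psi θ) θ
  approx : ∀ s < ρ, ∀ θ ∈ Metric.closedBall θ₀ s, ∀ θ' ∈ Metric.closedBall θ₀ s,
    ‖psi θ - psi θ' - B (θ - θ')‖ ≤ M * s * ‖θ - θ'‖

/-- On the closed ball of radius `s` the derivative `D` stays within `M * s` of `D θ₀`, and the mean
value inequality applies. -/
theorem ScoreRegularAt.of_hasFDerivAt {lam : E → ℝ} {T : E → StrongDual ℝ E}
    {D : E → E →L[ℝ] StrongDual ℝ E} {M ρ : ℝ} {θ₀ : E}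
    (h1 : ∀ θ ∈ Metric.ball θ₀ ρ, HasFDerivAt lam (T θ) θ)
    (h2 : ∀ θ ∈ Metric.ball θ₀ ρ, HasFDerivAt T (D θ) θ)
    (hM : ∀ θ ∈ Metric.ball θ₀ ρ, ‖D θ - D θ₀‖ ≤ M * ‖θ - θ₀‖) (hM0 : 0 ≤ M) :
    ScoreRegularAt lam (fun θ => riesz (T θ))
      ((riesz (E := E)).toContinuousLinearEquiv.toContinuousLinearMap ∘L D θ₀) M ρ θ₀ := by
  refine ⟨fun θ hθ => hasGradientAt_riesz (h1 θ hθ), fun s hs θ hθ θ' hθ' => ?_⟩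
  have hsub : Metric.closedBall θ₀ s ⊆ Metric.ball θ₀ ρ := Metric.closedBall_subset_ball hs
  have := Convex.norm_image_sub_le_of_norm_hasFDerivWithin_le' (C := M * s) (φ := D θ₀)
    (fun θ hθ => (h2 θ (hsub hθ)).hasFDerivWithinAt)
    (fun θ hθ => (hM θ (hsub hθ)).trans (mul_le_mul_of_nonneg_left
      (by simpa [dist_eq_norm] using hθ) hM0)) (convex_closedBall θ₀ s) hθ' hθ
  have h3 : riesz (T θ) - riesz (T θ') -
      ((riesz (E := E)).toContinuousLinearEquiv.toContinuousLinearMap ∘L D θ₀) (θ - θ') =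
      riesz (T θ - T θ' - D θ₀ (θ - θ')) := by
    rw [map_sub riesz, map_sub riesz]; rfl
  rw [h3, LinearIsometryEquiv.norm_map]
  exact this

end Calculus

/-! ### Differentiation under the integral sign -/

section DiffIntegral

variable {X : Type*} [MeasurableSpace X] {p : ℕ} {μ : Measure X} {ω : Set (Vec p)}
  {F : Vec p → X → ℝ}

/-- Reading off the Fréchet derivative from the first iterated derivative. -/
def curryOne (p : ℕ) : ((Vec p) [×1]→L[ℝ] ℝ) →L[ℝ] StrongDual ℝ (Vec p) :=
  (continuousMultilinearCurryFin1 ℝ (Vec p) ℝ).toContinuousLinearEquiv.toContinuousLinearMap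

/-- `DiffUnderIntegral` speaks of multilinear iterated derivatives, the calculus below of nested
Fréchet derivatives. The currying maps are continuous and linear, so they commute with the
integrals. -/
theorem curryOne_iteratedFDeriv (g : Vec p → ℝ) (θ : Vec p) :
    curryOne p (iteratedFDeriv ℝ 1 g θ) = fderiv ℝ g θ := by
  ext d
  exact iteratedFDeriv_one_apply _

/-- Reading off the second Fréchet derivative from the second iterated derivative. -/
def curryTwo (p : ℕ) : ((Vec p) [×2]→L[ℝ] ℝ) →L[ℝ] (Vec p →L[ℝ] StrongDual ℝ (Vec p)) :=
  (ContinuousLinearMap.compL ℝ (Vec p) _ _ (curryOne p)) ∘L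
    (continuousMultilinearCurryLeftEquiv ℝ (fun _ : Fin 2 => Vec p) ℝ
      ).toContinuousLinearEquiv.toContinuousLinearMap

theorem curryTwo_iteratedFDeriv (g : Vec p → ℝ) (θ : Vec p) :
    curryTwo p (iteratedFDeriv ℝ 2 g θ) = fderiv ℝ (fderiv ℝ g) θ := by
  ext d e
  have := iteratedFDeriv_two_apply (𝕜 := ℝ) g θ ![d, e]
  simp only [cons_val_zero, cons_val_one] at this
  rw [← this]
  simp only [curryTwo, curryOne, ContinuousLinearMap.comp_apply, ContinuousLinearMap.compL_apply]
  change (iteratedFDeriv ℝ 2 g θ) _ = _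
  congr 1
  funext i
  fin_cases i <;> rfl

theorem curryOne_comp_fderiv (g : Vec p → ℝ) (θ : Vec p) :
    (curryOne p) ∘L fderiv ℝ (iteratedFDeriv ℝ 1 g) θ = fderiv ℝ (fderiv ℝ g) θ := by
  have h1 : iteratedFDeriv ℝ 1 g =
      (continuousMultilinearCurryFin1 ℝ (Vec p) ℝ).symm ∘ fderiv ℝ g := by
    funext θ
    rw [Function.comp_apply, LinearIsometryEquiv.eq_symm_apply]
    exact curryOne_iteratedFDeriv g θ
  rw [h1, LinearIsometryEquiv.comp_fderiv]
  ext d e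
  rfl

theorem fderiv_iteratedFDeriv_eq (k : ℕ) (g : Vec p → ℝ) (θ : Vec p) :
    fderiv ℝ (iteratedFDeriv ℝ k g) θ =
      continuousMultilinearCurryLeftEquiv ℝ (fun _ : Fin (k + 1) => Vec p) ℝ
        (iteratedFDeriv ℝ (k + 1) g θ) := by
  rw [iteratedFDeriv_succ_eq_comp_left]
  simp

theorem DiffUnderIntegral.integrable_fderiv {k : ℕ} (h : DiffUnderIntegral μ k ω F) (hk : 1 ≤ k)
    {θ : Vec p} (hθ : θ ∈ ω) : Integrable (fun x => fderiv ℝ (fun t => F t x) θ) μ := by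
  have := (curryOne p).integrable_comp (h.1 1 hk θ hθ)
  simpa only [curryOne_iteratedFDeriv] using this

theorem DiffUnderIntegral.integrable_fderiv_fderiv {k : ℕ} (h : DiffUnderIntegral μ k ω F)
    (hk : 2 ≤ k) {θ : Vec p} (hθ : θ ∈ ω) :
    Integrable (fun x => fderiv ℝ (fderiv ℝ (fun t => F t x)) θ) μ := by
  have := (curryTwo p).integrable_comp (h.1 2 hk θ hθ)
  simpa only [curryTwo_iteratedFDeriv] using this

theorem DiffUnderIntegral.integrable_fderiv_iteratedFDeriv {k : ℕ}
    (h : DiffUnderIntegral μ k ω F) {j : ℕ} (hj : j < k) {θ : Vec p} (hθ : θ ∈ ω) :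
    Integrable (fun x => fderiv ℝ (iteratedFDeriv ℝ j (fun t => F t x)) θ) μ := by
  let L : ((Vec p) [×(j + 1)]→L[ℝ] ℝ) →L[ℝ] (Vec p →L[ℝ] ((Vec p) [×j]→L[ℝ] ℝ)) :=
    (continuousMultilinearCurryLeftEquiv ℝ (fun _ : Fin (j + 1) => Vec p) ℝ
      ).toContinuousLinearEquiv.toContinuousLinearMap
  have := L.integrable_comp (h.1 (j + 1) hj θ hθ)
  refine this.congr (ae_of_all _ fun x => ?_)
  exact (fderiv_iteratedFDeriv_eq j _ θ).symm

theorem DiffUnderIntegral.hasFDerivAt {k : ℕ} (h : DiffUnderIntegral μ k ω F) (hω : IsOpen ω)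
    (hk : 1 ≤ k) {θ : Vec p} (hθ : θ ∈ ω) :
    HasFDerivAt (fun s => ∫ x, F s x ∂μ) (∫ x, fderiv ℝ (fun t => F t x) θ ∂μ) θ := by
  let Z : ((Vec p) [×0]→L[ℝ] ℝ) →L[ℝ] ℝ :=
    (continuousMultilinearCurryFin0 ℝ (Vec p) ℝ).toContinuousLinearEquiv.toContinuousLinearMap
  have hZ : ∀ (g : Vec p → ℝ) s, Z (iteratedFDeriv ℝ 0 g s) = g s := fun g s => by
    simp [Z, iteratedFDeriv_zero_eq_comp]
  have hZ' : ∀ (g : Vec p → ℝ) s, Z ∘L fderiv ℝ (iteratedFDeriv ℝ 0 g) s = fderiv ℝ g s := by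
    intro g s
    rw [iteratedFDeriv_zero_eq_comp, LinearIsometryEquiv.comp_fderiv]
    ext d
    simp [Z]
  have h1 := Z.hasFDerivAt.comp θ (h.2 0 hk θ hθ)
  have h2 : Z ∘L (∫ x, fderiv ℝ (iteratedFDeriv ℝ 0 (fun t => F t x)) θ ∂μ) =
      ∫ x, fderiv ℝ (fun t => F t x) θ ∂μ := by
    have := (ContinuousLinearMap.compL ℝ (Vec p) _ _ Z).integral_comp_comm
      (h.integrable_fderiv_iteratedFDeriv (j := 0) hk hθ)
    simp only [ContinuousLinearMap.compL_apply, hZ'] at this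
    exact this.symm
  rw [h2] at h1
  refine h1.congr_of_eventuallyEq ?_
  filter_upwards [hω.mem_nhds hθ] with s hs
  have := Z.integral_comp_comm (h.1 0 (Nat.zero_le _) s hs)
  simp only [hZ] at this
  exact this

theorem DiffUnderIntegral.hasFDerivAt_fderiv {k : ℕ} (h : DiffUnderIntegral μ k ω F)
    (hω : IsOpen ω) (hk : 2 ≤ k) {θ : Vec p} (hθ : θ ∈ ω) :
    HasFDerivAt (fun s => ∫ x, fderiv ℝ (fun t => F t x) s ∂μ)
      (∫ x, fderiv ℝ (fderiv ℝ (fun t => F t x)) θ ∂μ) θ := by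
  have h1 := (curryOne p).hasFDerivAt.comp θ (h.2 1 hk θ hθ)
  have h2 : (curryOne p) ∘L (∫ x, fderiv ℝ (iteratedFDeriv ℝ 1 (fun t => F t x)) θ ∂μ) =
      ∫ x, fderiv ℝ (fderiv ℝ (fun t => F t x)) θ ∂μ := by
    have := (ContinuousLinearMap.compL ℝ (Vec p) _ _ (curryOne p)).integral_comp_comm
      (h.integrable_fderiv_iteratedFDeriv (j := 1) hk hθ)
    simp only [ContinuousLinearMap.compL_apply, curryOne_comp_fderiv] at this
    exact this.symm
  rw [h2] at h1
  refine h1.congr_of_eventuallyEq ?_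
  filter_upwards [hω.mem_nhds hθ] with s hs
  have := (curryOne p).integral_comp_comm (h.1 1 (by omega) s hs)
  simp only [curryOne_iteratedFDeriv] at this
  exact this

theorem DiffUnderIntegral.differentiableAt_fderiv_fderiv {k : ℕ} (h : DiffUnderIntegral μ k ω F)
    (hω : IsOpen ω) (hk : 3 ≤ k) {θ : Vec p} (hθ : θ ∈ ω) :
    DifferentiableAt ℝ (fun s => ∫ x, fderiv ℝ (fderiv ℝ (fun t => F t x)) s ∂μ) θ := by
  have h1 := (curryTwo p).differentiableAt.comp θ (h.2 2 hk θ hθ).differentiableAt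
  refine h1.congr_of_eventuallyEq ?_
  filter_upwards [hω.mem_nhds hθ] with s hs
  have := (curryTwo p).integral_comp_comm (h.1 2 (by omega) s hs)
  simp only [curryTwo_iteratedFDeriv] at this
  exact this

end DiffIntegral

/-! ### The objective function of the minimum density power divergence method -/

section PowerCalculus

variable {E : Type*} [NormedAddCommGroup E] [InnerProductSpace ℝ E] {g : E → ℝ} {ω : Set E} {θ : E}

/-- `v ↦ v^β / β`, and the logarithm for `β = 0`. -/
def boxCox (β v : ℝ) : ℝ := if β = 0 then Real.log v else v ^ β / β

/-- Positive and thrice continuously differentiable on `ω`. -/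
structure PosSmoothOn (g : E → ℝ) (ω : Set E) : Prop where
  pos : ∀ θ ∈ ω, 0 < g θ
  contDiffOn : ContDiffOn ℝ 3 g ω

namespace PosSmoothOn

theorem log (hg : PosSmoothOn g ω) : ContDiffOn ℝ 3 (fun t => Real.log (g t)) ω :=
  hg.contDiffOn.log fun θ hθ => (hg.pos θ hθ).ne'

theorem hasFDerivAt_log (hg : PosSmoothOn g ω) (hω : IsOpen ω) (hθ : θ ∈ ω) :
    HasFDerivAt (fun t => Real.log (g t)) (fderiv ℝ (fun t => Real.log (g t)) θ) θ :=
  ((hg.log.contDiffAt (hω.mem_nhds hθ)).differentiableAt (by norm_num)).hasFDerivAt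

theorem hasFDerivAt_fderiv_log (hg : PosSmoothOn g ω) (hω : IsOpen ω) (hθ : θ ∈ ω) :
    HasFDerivAt (fderiv ℝ (fun t => Real.log (g t)))
      (fderiv ℝ (fderiv ℝ (fun t => Real.log (g t))) θ) θ :=
  (((hg.log.contDiffAt (hω.mem_nhds hθ)).fderiv_right (m := 2)
    (by norm_num)).differentiableAt (by norm_num)).hasFDerivAt

/-- Writing `g ^ a = exp (a log g)` expresses the derivatives of powers through those of `log g`,
that is, through the score. -/
theorem hasFDerivAt_rpow (hg : PosSmoothOn g ω) (hω : IsOpen ω) (hθ : θ ∈ ω) (a : ℝ) :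
    HasFDerivAt (fun t => g t ^ a) ((a * g θ ^ a) • fderiv ℝ (fun t => Real.log (g t)) θ) θ := by
  have h1 := ((hg.hasFDerivAt_log hω hθ).const_mul a).exp
  have h2 : ∀ t ∈ ω, g t ^ a = Real.exp (a * Real.log (g t)) := fun t ht => by
    rw [Real.rpow_def_of_pos (hg.pos t ht), mul_comm]
  rw [← h2 θ hθ, smul_smul, mul_comm] at h1
  exact h1.congr_of_eventuallyEq (by filter_upwards [hω.mem_nhds hθ] with t ht using h2 t ht)

theorem fderiv_rpow (hg : PosSmoothOn g ω) (hω : IsOpen ω) (hθ : θ ∈ ω) (a : ℝ) :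
    fderiv ℝ (fun t => g t ^ a) θ = (a * g θ ^ a) • fderiv ℝ (fun t => Real.log (g t)) θ :=
  (hg.hasFDerivAt_rpow hω hθ a).fderiv

theorem hasFDerivAt_rpow_smul (hg : PosSmoothOn g ω) (hω : IsOpen ω) (hθ : θ ∈ ω) (a : ℝ) :
    HasFDerivAt (fun t => g t ^ a • fderiv ℝ (fun t => Real.log (g t)) t)
      (g θ ^ a • fderiv ℝ (fderiv ℝ (fun t => Real.log (g t))) θ +
        (a * g θ ^ a) • (fderiv ℝ (fun t => Real.log (g t)) θ).smulRight
          (fderiv ℝ (fun t => Real.log (g t)) θ)) θ := by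
  refine ((hg.hasFDerivAt_rpow hω hθ a).smul (hg.hasFDerivAt_fderiv_log hω hθ)).congr_fderiv ?_
  ext d e
  simp [mul_assoc]

theorem fderiv_fderiv_rpow (hg : PosSmoothOn g ω) (hω : IsOpen ω) (hθ : θ ∈ ω) (a : ℝ) :
    fderiv ℝ (fderiv ℝ (fun t => g t ^ a)) θ =
      a • (g θ ^ a • fderiv ℝ (fderiv ℝ (fun t => Real.log (g t))) θ +
        (a * g θ ^ a) • (fderiv ℝ (fun t => Real.log (g t)) θ).smulRight
          (fderiv ℝ (fun t => Real.log (g t)) θ)) := by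
  have h1 : fderiv ℝ (fun t => g t ^ a) =ᶠ[𝓝 θ]
      fun t => a • g t ^ a • fderiv ℝ (fun t => Real.log (g t)) t := by
    filter_upwards [hω.mem_nhds hθ] with t ht
    rw [hg.fderiv_rpow hω ht, smul_smul]
  rw [h1.fderiv_eq]
  exact ((hg.hasFDerivAt_rpow_smul hω hθ a).const_smul a).fderiv

/-- The normalization by `β` makes the gradient `g ^ β` times the score for every `β`, so that
maximum likelihood (`β = 0`) needs no separate treatment. -/
theorem hasFDerivAt_boxCox (hg : PosSmoothOn g ω) (hω : IsOpen ω) (hθ : θ ∈ ω) (β : ℝ) :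
    HasFDerivAt (fun t => boxCox β (g t)) (g θ ^ β • fderiv ℝ (fun t => Real.log (g t)) θ) θ := by
  by_cases h : β = 0
  · simpa [boxCox, h] using hg.hasFDerivAt_log hω hθ
  · have := (hg.hasFDerivAt_rpow hω hθ β).mul_const β⁻¹
    simp only [boxCox, h, if_false, div_eq_mul_inv]
    refine this.congr_fderiv ?_
    rw [smul_smul]
    congr 1
    field_simp

end PosSmoothOn

end PowerCalculus

/-! ### Derivatives of the estimating function and the third-derivative bound. -/

section ModelCalculus

theorem innerSL_score {X : Type*} {p : ℕ} (f : Vec p → X → ℝ) (θ : Vec p) (x : X) :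
    innerSL ℝ (score f θ x) = fderiv ℝ (fun t => Real.log (f t x)) θ :=
  innerSL_gradient _ θ

variable {X : Type*} [MeasurableSpace X] {p : ℕ} {μ : Measure X} {Θ ω : Set (Vec p)}
  {f : Vec p → X → ℝ} {θ₀ θ : Vec p} {β : ℝ}

/-- The summand of the estimating equation, with mean zero under the model. -/
def psi (μ : Measure X) (f : Vec p → X → ℝ) (β : ℝ) (θ : Vec p) (x : X) : Vec p :=
  f θ x ^ β • score f θ x - xiVec μ f β θ

/-- The summand of the objective function whose gradient is `psi`. -/
def dpdObj (μ : Measure X) (f : Vec p → X → ℝ) (β : ℝ) (θ : Vec p) (x : X) : ℝ :=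
  boxCox β (f θ x) - (1 + β)⁻¹ * ∫ z, f θ z ^ (1 + β) ∂μ

/-- The derivative of `psi` with respect to the parameter. -/
def psiDeriv (μ : Measure X) (f : Vec p → X → ℝ) (β : ℝ) (θ : Vec p) (x : X) : Vec p →L[ℝ] Vec p :=
  fderiv ℝ (fun t => psi μ f β t x) θ

/-- The common support gives a dichotomy: almost every point is either outside the support for all
parameters in `ω`, or inside it for all of them, with a smooth density. -/
theorem BasuConditions.ae_posSmoothOn (hB : BasuConditions μ Θ ω f β θ₀)
    (hf : IsDensityFamily μ Θ f) :
    ∀ᵐ x ∂μ, (∀ θ ∈ ω, f θ x = 0) ∨ PosSmoothOn (fun t => f t x) ω := by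
  filter_upwards [hB.smooth] with x hx
  by_cases h : 0 < f θ₀ x
  · exact Or.inr ⟨fun θ hθ => (hB.common_support θ (hB.subset hθ) x).2 h, hx⟩
  · refine Or.inl fun θ hθ => le_antisymm (not_lt.1 fun h' => h ?_)
      (hf.nonneg θ (hB.subset hθ) x)
    exact (hB.common_support θ (hB.subset hθ) x).1 h'

/-- Off the support the formulas through `log f` are not available, but the power is locally zero.
The exponent must be nonzero because `0 ^ 0 = 1`. -/
theorem fderiv_rpow_of_eq_zero {g : Vec p → ℝ} (hω : IsOpen ω) (hg : ∀ θ ∈ ω, g θ = 0) {a : ℝ}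
    (ha : a ≠ 0) (hθ : θ ∈ ω) : fderiv ℝ (fun t => g t ^ a) θ = 0 := by
  have h1 : (fun t => g t ^ a) =ᶠ[𝓝 θ] fun _ => (0 : ℝ) := by
    filter_upwards [hω.mem_nhds hθ] with t ht
    rw [hg t ht, Real.zero_rpow ha]
  rw [h1.fderiv_eq, fderiv_const_apply]

theorem fderiv_fderiv_rpow_of_eq_zero {g : Vec p → ℝ} (hω : IsOpen ω) (hg : ∀ θ ∈ ω, g θ = 0)
    {a : ℝ} (ha : a ≠ 0) (hθ : θ ∈ ω) : fderiv ℝ (fderiv ℝ (fun t => g t ^ a)) θ = 0 := by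
  have h1 : fderiv ℝ (fun t => g t ^ a) =ᶠ[𝓝 θ] fun _ => (0 : StrongDual ℝ (Vec p)) := by
    filter_upwards [hω.mem_nhds hθ] with t ht using fderiv_rpow_of_eq_zero hω hg ha ht
  rw [h1.fderiv_eq, fderiv_const_apply]

theorem BasuConditions.ae_fderiv_rpow (hB : BasuConditions μ Θ ω f β θ₀)
    (hf : IsDensityFamily μ Θ f) (hβ : 0 ≤ β) (hθ : θ ∈ ω) :
    ∀ᵐ x ∂μ, fderiv ℝ (fun t => f t x ^ (1 + β)) θ =
      (1 + β) • innerSL ℝ (f θ x ^ (1 + β) • score f θ x) := by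
  filter_upwards [hB.ae_posSmoothOn hf] with x hx
  rcases hx with hx | hx
  · rw [fderiv_rpow_of_eq_zero hB.isOpen hx (by positivity) hθ, hx θ hθ,
      Real.zero_rpow (by positivity), zero_smul, map_zero, smul_zero]
  · rw [hx.fderiv_rpow hB.isOpen hθ, map_smul, innerSL_score, smul_smul]

theorem BasuConditions.integrable_rpow_smul_score (hB : BasuConditions μ Θ ω f β θ₀)
    (hf : IsDensityFamily μ Θ f) (hβ : 0 ≤ β) (hθ : θ ∈ ω) :
    Integrable (fun x => f θ x ^ (1 + β) • score f θ x) μ := by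
  have h1 := (riesz (E := Vec p)).toContinuousLinearEquiv.toContinuousLinearMap.integrable_comp
    (hB.diff_integral_model.integrable_fderiv (by norm_num) hθ)
  refine (h1.smul (1 + β)⁻¹).congr ?_
  filter_upwards [hB.ae_fderiv_rpow hf hβ hθ] with x hx
  have hb : (1 + β) ≠ 0 := by positivity
  have h2 : riesz (fderiv ℝ (fun t => f t x ^ (1 + β)) θ) =
      (1 + β) • (f θ x ^ (1 + β) • score f θ x) := by
    rw [hx, LinearIsometryEquiv.map_smul, riesz_innerSL]
  change (1 + β)⁻¹ • riesz (fderiv ℝ (fun t => f t x ^ (1 + β)) θ) = _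
  rw [h2, inv_smul_smul₀ hb]

theorem BasuConditions.integral_fderiv_rpow (hB : BasuConditions μ Θ ω f β θ₀)
    (hf : IsDensityFamily μ Θ f) (hβ : 0 ≤ β) (hθ : θ ∈ ω) :
    ∫ x, fderiv ℝ (fun t => f t x ^ (1 + β)) θ ∂μ = (1 + β) • innerSL ℝ (xiVec μ f β θ) := by
  rw [integral_congr_ae (hB.ae_fderiv_rpow hf hβ hθ), integral_smul, xiVec,
    ContinuousLinearMap.integral_comp_comm _ (hB.integrable_rpow_smul_score hf hβ hθ)]

/-- The second derivative of `θ ↦ ∫ f_θ^{1+β}`. -/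
def hessPow (μ : Measure X) (f : Vec p → X → ℝ) (β : ℝ) (θ : Vec p) :
    Vec p →L[ℝ] StrongDual ℝ (Vec p) :=
  ∫ x, fderiv ℝ (fderiv ℝ (fun t => f t x ^ (1 + β))) θ ∂μ

theorem BasuConditions.hasFDerivAt_integral_rpow (hB : BasuConditions μ Θ ω f β θ₀)
    (hf : IsDensityFamily μ Θ f) (hβ : 0 ≤ β) (hθ : θ ∈ ω) :
    HasFDerivAt (fun t => (1 + β)⁻¹ * ∫ z, f t z ^ (1 + β) ∂μ)
      (innerSL ℝ (xiVec μ f β θ)) θ := by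
  have h1 := (hB.diff_integral_model.hasFDerivAt hB.isOpen (by norm_num) hθ).const_mul (1 + β)⁻¹
  rwa [hB.integral_fderiv_rpow hf hβ hθ, inv_smul_smul₀ (by positivity)] at h1

theorem BasuConditions.hasFDerivAt_innerSL_xiVec (hB : BasuConditions μ Θ ω f β θ₀)
    (hf : IsDensityFamily μ Θ f) (hβ : 0 ≤ β) (hθ : θ ∈ ω) :
    HasFDerivAt (fun t => innerSL ℝ (xiVec μ f β t)) ((1 + β)⁻¹ • hessPow μ f β θ) θ := by
  have h1 := (hB.diff_integral_model.hasFDerivAt_fderiv hB.isOpen (by norm_num) hθ).const_smul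
    (1 + β)⁻¹
  refine h1.congr_of_eventuallyEq ?_
  filter_upwards [hB.isOpen.mem_nhds hθ] with t ht
  rw [Pi.smul_apply, hB.integral_fderiv_rpow hf hβ ht, inv_smul_smul₀ (by positivity)]

theorem BasuConditions.hasFDerivAt_dpdObj (hB : BasuConditions μ Θ ω f β θ₀)
    (hf : IsDensityFamily μ Θ f) (hβ : 0 ≤ β) (hθ : θ ∈ ω) {x : X}
    (hx : PosSmoothOn (fun t => f t x) ω) :
    HasFDerivAt (fun t => dpdObj μ f β t x) (innerSL ℝ (psi μ f β θ x)) θ := by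
  refine ((hx.hasFDerivAt_boxCox hB.isOpen hθ β).sub
    (hB.hasFDerivAt_integral_rpow hf hβ hθ)).congr_fderiv ?_
  rw [psi, map_sub, map_smul, innerSL_score]

/-- The second derivative of `dpdObj`. -/
def dpdHess (μ : Measure X) (f : Vec p → X → ℝ) (β : ℝ) (x : X) (θ : Vec p) :
    Vec p →L[ℝ] StrongDual ℝ (Vec p) :=
  f θ x ^ β • fderiv ℝ (fderiv ℝ (fun t => Real.log (f t x))) θ +
    (β * f θ x ^ β) • (fderiv ℝ (fun t => Real.log (f t x)) θ).smulRight
      (fderiv ℝ (fun t => Real.log (f t x)) θ) - (1 + β)⁻¹ • hessPow μ f β θ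

theorem BasuConditions.hasFDerivAt_innerSL_psi (hB : BasuConditions μ Θ ω f β θ₀)
    (hf : IsDensityFamily μ Θ f) (hβ : 0 ≤ β) (hθ : θ ∈ ω) {x : X}
    (hx : PosSmoothOn (fun t => f t x) ω) :
    HasFDerivAt (fun t => innerSL ℝ (psi μ f β t x)) (dpdHess μ f β x θ) θ := by
  refine ((hx.hasFDerivAt_rpow_smul hB.isOpen hθ β).sub
    (hB.hasFDerivAt_innerSL_xiVec hf hβ hθ)).congr_of_eventuallyEq (Eventually.of_forall fun t => ?_)
  simp only [psi, map_sub, map_smul, innerSL_score, Pi.sub_apply]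

theorem BasuConditions.differentiableAt_dpdHess (hB : BasuConditions μ Θ ω f β θ₀)
    (hθ : θ ∈ ω) {x : X} (hx : PosSmoothOn (fun t => f t x) ω) :
    DifferentiableAt ℝ (dpdHess μ f β x) θ := by
  have h1 : DifferentiableAt ℝ (hessPow μ f β) θ :=
    hB.diff_integral_model.differentiableAt_fderiv_fderiv hB.isOpen le_rfl hθ
  have h2 : DifferentiableAt ℝ (fun t => f t x ^ β) θ :=
    (hx.hasFDerivAt_rpow hB.isOpen hθ β).differentiableAt
  have h3 := (hx.hasFDerivAt_fderiv_log hB.isOpen hθ).differentiableAt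
  have h4 : DifferentiableAt ℝ (fderiv ℝ (fderiv ℝ (fun t => Real.log (f t x)))) θ :=
    ((((hx.log.contDiffAt (hB.isOpen.mem_nhds hθ)).fderiv_right (m := 2)
      (by norm_num)).fderiv_right (m := 1) (by norm_num)).differentiableAt (by norm_num))
  have h5 : DifferentiableAt ℝ (fun t => (fderiv ℝ (fun t => Real.log (f t x)) t).smulRight
      (fderiv ℝ (fun t => Real.log (f t x)) t)) θ := by
    let S := ContinuousLinearMap.smulRightL ℝ (Vec p) (StrongDual ℝ (Vec p))
    exact S.isBoundedBilinearMap.differentiableAt (_, _) |>.comp θ (h3.prodMk h3)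
  exact ((h2.smul h4).add ((h2.const_mul β).smul h5)).sub (h1.fun_const_smul (1 + β)⁻¹)

theorem riesz_comp_dpdHess (hB : BasuConditions μ Θ ω f β θ₀)
    (hf : IsDensityFamily μ Θ f) (hβ : 0 ≤ β) (hθ : θ ∈ ω) {x : X}
    (hx : PosSmoothOn (fun t => f t x) ω) :
    psiDeriv μ f β θ x =
      (riesz (E := Vec p)).toContinuousLinearEquiv.toContinuousLinearMap ∘L dpdHess μ f β x θ := by
  have h1 := (riesz (E := Vec p)).toContinuousLinearEquiv.toContinuousLinearMap.hasFDerivAt.comp θ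
    (hB.hasFDerivAt_innerSL_psi hf hβ hθ hx)
  rw [← h1.fderiv, psiDeriv]
  congr 1
  funext t
  exact (riesz_innerSL _).symm

theorem scoreRegularAt_psi (hB : BasuConditions μ Θ ω f β θ₀)
    (hf : IsDensityFamily μ Θ f) (hβ : 0 ≤ β) {x : X} (hx : PosSmoothOn (fun t => f t x) ω)
    {M ρ : ℝ} (hM0 : 0 ≤ M) (hρ : Metric.ball θ₀ ρ ⊆ ω) (hM : ∀ θ ∈ Metric.ball θ₀ ρ,
      ‖dpdHess μ f β x θ - dpdHess μ f β x θ₀‖ ≤ M * ‖θ - θ₀‖) :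
    ScoreRegularAt (fun t => dpdObj μ f β t x) (fun t => psi μ f β t x)
      (psiDeriv μ f β θ₀ x) M ρ θ₀ := by
  have := ScoreRegularAt.of_hasFDerivAt (T := fun t => innerSL ℝ (psi μ f β t x))
    (fun θ hθ => hB.hasFDerivAt_dpdObj hf hβ (hρ hθ) hx)
    (fun θ hθ => hB.hasFDerivAt_innerSL_psi hf hβ (hρ hθ) hx) hM hM0
  simp only [riesz_innerSL] at this
  rwa [riesz_comp_dpdHess hB hf hβ hB.mem hx]

/-- The objective is the loss up to the factor `-(1 + β)` and a constant, so the bound assumed for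
third derivatives of the loss carries over. The constant is nonzero only for `β = 0`, where `∫ f_θ =
1` enters the objective. -/
theorem dpdLoss_eq (hf : IsDensityFamily μ Θ f) (hβ : 0 ≤ β) (hθ : θ ∈ Θ) (x : X) :
    dpdLoss μ f β θ x = -(1 + β) * dpdObj μ f β θ x - if β = 0 then 1 else 0 := by
  by_cases h : β = 0
  · subst h
    have : ∫ z, f θ z ^ (1 + 0 : ℝ) ∂μ = 1 := by simpa using hf.integral_eq_one θ hθ
    simp only [dpdLoss, dpdObj, boxCox, this, if_true]
    norm_num
  · have : 1 + β ≠ 0 := by positivity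
    simp only [dpdLoss, dpdObj, boxCox, h, if_false]
    field_simp
    ring

/-- The second derivative of the loss is `-(1 + β) dpdHess`; as `1 + β ≥ 1`, dividing by the factor
does not worsen the Lipschitz bound. -/
theorem BasuConditions.norm_dpdHess_sub_le (hB : BasuConditions μ Θ ω f β θ₀)
    (hf : IsDensityFamily μ Θ f) (hβ : 0 ≤ β) {x : X} (hx : PosSmoothOn (fun t => f t x) ω)
    {M ρ : ℝ} (hρ : Metric.ball θ₀ ρ ⊆ ω)
    (hM : ∀ θ ∈ ω, ‖iteratedFDeriv ℝ 3 (fun t => dpdLoss μ f β t x) θ‖ ≤ M) {θ : Vec p}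
    (hθ : θ ∈ Metric.ball θ₀ ρ) :
    ‖dpdHess μ f β x θ - dpdHess μ f β x θ₀‖ ≤ M * ‖θ - θ₀‖ := by
  have hM0 : 0 ≤ M := (norm_nonneg _).trans (hM θ₀ hB.mem)
  have h1 : ∀ θ ∈ ω, fderiv ℝ (fun t => dpdLoss μ f β t x) θ =
      -(1 + β) • innerSL ℝ (psi μ f β θ x) := by
    intro θ hθ
    have h2 := ((hB.hasFDerivAt_dpdObj hf hβ hθ hx).const_mul (-(1 + β))).sub_const
      (if β = 0 then (1 : ℝ) else 0)
    have h3 : (fun t => dpdLoss μ f β t x) =ᶠ[𝓝 θ] fun t =>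
        -(1 + β) * dpdObj μ f β t x - if β = 0 then 1 else 0 := by
      filter_upwards [hB.isOpen.mem_nhds hθ] with t ht using dpdLoss_eq hf hβ (hB.subset ht) x
    rw [h3.fderiv_eq, h2.fderiv]
  have h4 : ∀ θ ∈ ω, fderiv ℝ (fderiv ℝ (fun t => dpdLoss μ f β t x)) θ =
      -(1 + β) • dpdHess μ f β x θ := by
    intro θ hθ
    have h2 := (hB.hasFDerivAt_innerSL_psi hf hβ hθ hx).const_smul (-(1 + β))
    have h3 : fderiv ℝ (fun t => dpdLoss μ f β t x) =ᶠ[𝓝 θ] fun t =>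
        -(1 + β) • innerSL ℝ (psi μ f β t x) := by
      filter_upwards [hB.isOpen.mem_nhds hθ] with t ht using h1 t ht
    rw [h3.fderiv_eq]
    exact h2.fderiv
  have h5 : ∀ θ ∈ Metric.ball θ₀ ρ,
      DifferentiableAt ℝ (fderiv ℝ (fderiv ℝ (fun t => dpdLoss μ f β t x))) θ := by
    intro θ hθ
    refine ((hB.differentiableAt_dpdHess (hρ hθ) hx).const_smul
      (-(1 + β))).congr_of_eventuallyEq ?_
    filter_upwards [hB.isOpen.mem_nhds (hρ hθ)] with t ht using h4 t ht
  have h6 := norm_fderiv_fderiv_sub_le h5 (fun θ hθ => hM θ (hρ hθ)) hθ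
  rw [h4 θ (hρ hθ), h4 θ₀ hB.mem, ← smul_sub, norm_smul] at h6
  refine le_trans ?_ h6
  refine le_mul_of_one_le_left (norm_nonneg _) ?_
  rw [norm_neg, Real.norm_eq_abs]
  exact (by linarith : (1 : ℝ) ≤ 1 + β).trans (le_abs_self _)

theorem ae_modelMeasure (hf : IsDensityFamily μ Θ f) (hθ : θ ∈ Θ) {P : X → Prop} :
    (∀ᵐ x ∂(modelMeasure μ f θ), P x) ↔ ∀ᵐ x ∂μ, 0 < f θ x → P x := by
  rw [modelMeasure, ae_withDensity_iff (hf.measurable θ hθ).ennreal_ofReal]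
  simp only [ne_eq, ENNReal.ofReal_eq_zero, not_le]

theorem integral_modelMeasure {G : Type*} [NormedAddCommGroup G] [NormedSpace ℝ G]
    (hf : IsDensityFamily μ Θ f) (hθ : θ ∈ Θ) (φ : X → G) :
    ∫ x, φ x ∂(modelMeasure μ f θ) = ∫ x, f θ x • φ x ∂μ := by
  rw [modelMeasure, integral_withDensity_eq_integral_toReal_smul
    (hf.measurable θ hθ).ennreal_ofReal (by simp)]
  refine integral_congr_ae (ae_of_all _ fun x => ?_)
  simp only [ENNReal.toReal_ofReal (hf.nonneg θ hθ x)]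

theorem integrable_modelMeasure_iff {G : Type*} [NormedAddCommGroup G] [NormedSpace ℝ G]
    (hf : IsDensityFamily μ Θ f) (hθ : θ ∈ Θ) {φ : X → G} :
    Integrable φ (modelMeasure μ f θ) ↔ Integrable (fun x => f θ x • φ x) μ := by
  rw [modelMeasure, integrable_withDensity_iff_integrable_smul'
    (hf.measurable θ hθ).ennreal_ofReal (by simp)]
  refine integrable_congr (ae_of_all _ fun x => ?_)
  simp only [ENNReal.toReal_ofReal (hf.nonneg θ hθ x)]

theorem isProbabilityMeasure_modelMeasure (hf : IsDensityFamily μ Θ f) (hθ : θ ∈ Θ) :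
    IsProbabilityMeasure (modelMeasure μ f θ) := by
  have h1 : Integrable (f θ) μ := by
    by_contra h
    have := hf.integral_eq_one θ hθ
    rw [integral_undef h] at this
    exact zero_ne_one this
  constructor
  rw [modelMeasure, withDensity_apply _ MeasurableSet.univ, Measure.restrict_univ,
    ← ofReal_integral_eq_lintegral_ofReal h1 (ae_of_all _ (hf.nonneg θ hθ)),
    hf.integral_eq_one θ hθ, ENNReal.ofReal_one]

theorem BasuConditions.ae_modelMeasure_posSmoothOn (hB : BasuConditions μ Θ ω f β θ₀)
    (hf : IsDensityFamily μ Θ f) :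
    ∀ᵐ x ∂(modelMeasure μ f θ₀), PosSmoothOn (fun t => f t x) ω := by
  rw [ae_modelMeasure hf (hB.subset hB.mem)]
  filter_upwards [hB.ae_posSmoothOn hf] with x hx h0
  exact hx.resolve_left fun h => h0.ne' (h θ₀ hB.mem)

/-- The estimating equation has regular summands at almost all points, and at `y`. -/
theorem exists_scoreRegularAt [MeasurableSingletonClass X] (hB : BasuConditions μ Θ ω f β θ₀)
    (hf : IsDensityFamily μ Θ f) (hβ : 0 ≤ β) {y : X} (hy : PosSmoothOn (fun t => f t y) ω) :
    ∃ ρ > 0, Metric.ball θ₀ ρ ⊆ ω ∧ ∃ M : X → ℝ, Integrable M (modelMeasure μ f θ₀) ∧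
      (∀ x, 0 ≤ M x) ∧
      (∀ᵐ x ∂(modelMeasure μ f θ₀), ScoreRegularAt (fun t => dpdObj μ f β t x)
        (fun t => psi μ f β t x) (psiDeriv μ f β θ₀ x) (M x) ρ θ₀) ∧
      ScoreRegularAt (fun t => dpdObj μ f β t y)
        (fun t => psi μ f β t y) (psiDeriv μ f β θ₀ y) (M y) ρ θ₀ := by
  have := isProbabilityMeasure_modelMeasure hf (hB.subset hB.mem)
  obtain ⟨M, hM, hMb⟩ := hB.third_bound
  -- The point `y` may be exceptional for the almost sure bound. There the Hessian is differentiable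
  -- at `θ₀`, which gives a Lipschitz estimate at `θ₀` on some smaller ball.
  obtain ⟨K, hK⟩ := (hB.differentiableAt_dpdHess hB.mem hy).isBigO_sub.bound
  obtain ⟨ρ, hρ, hball⟩ := Metric.mem_nhds_iff.1 (inter_mem (hB.isOpen.mem_nhds hB.mem) hK)
  have hω : Metric.ball θ₀ ρ ⊆ ω := fun θ hθ => (hball hθ).1
  -- The constant for `y` is added to the bound at the single point `y`, which keeps it integrable
  -- and defines it everywhere.
  refine ⟨ρ, hρ, hω, fun x => |M x| + Set.indicator {y} (fun _ => |K|) x, ?_, fun x => ?_, ?_, ?_⟩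
  · exact hM.abs.add ((integrable_const _).indicator (measurableSet_singleton y))
  · exact add_nonneg (abs_nonneg _) (Set.indicator_nonneg (fun _ _ => abs_nonneg _) _)
  · filter_upwards [hMb, hB.ae_modelMeasure_posSmoothOn hf] with x hx hx'
    refine scoreRegularAt_psi hB hf hβ hx'
      (add_nonneg (abs_nonneg _) (Set.indicator_nonneg (fun _ _ => abs_nonneg _) _)) hω
      fun θ hθ => (hB.norm_dpdHess_sub_le hf hβ hx' hω hx hθ).trans ?_
    refine mul_le_mul_of_nonneg_right ?_ (norm_nonneg _)
    exact (le_abs_self _).trans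
      (le_add_of_nonneg_right (Set.indicator_nonneg (fun _ _ => abs_nonneg _) _))
  · refine scoreRegularAt_psi hB hf hβ hy
      (add_nonneg (abs_nonneg _) (Set.indicator_nonneg (fun _ _ => abs_nonneg _) _)) hω
      fun θ hθ => (hball hθ).2.trans ?_
    refine mul_le_mul_of_nonneg_right ?_ (norm_nonneg _)
    simp only [Set.indicator_of_mem (Set.mem_singleton y)]
    exact (le_abs_self _).trans (le_add_of_nonneg_left (abs_nonneg _))

end ModelCalculus

/-! ### Moments of the estimating function -/

section Moments

variable {X : Type*} [MeasurableSpace X] {p : ℕ} {μ : Measure X} {Θ ω : Set (Vec p)}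
  {f : Vec p → X → ℝ} {θ₀ θ : Vec p} {β : ℝ}

/-- Measurability of the score is not assumed; it is recovered from that of the weighted score by
dividing by the weight, which is nonzero almost surely. -/
theorem aestronglyMeasurable_modelMeasure_of_smul {G : Type*} [NormedAddCommGroup G]
    [NormedSpace ℝ G] (hf : IsDensityFamily μ Θ f) (hθ : θ ∈ Θ) {g : X → ℝ} (hg : Measurable g)
    (hpos : ∀ x, 0 < f θ x → g x ≠ 0) {φ : X → G}
    (hφ : AEStronglyMeasurable (fun x => g x • φ x) μ) :
    AEStronglyMeasurable φ (modelMeasure μ f θ) := by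
  have h1 : AEStronglyMeasurable (fun x => (g x)⁻¹ • g x • φ x) (modelMeasure μ f θ) :=
    (hg.inv.aestronglyMeasurable.smul hφ).mono_ac (withDensity_absolutelyContinuous _ _)
  refine h1.congr ?_
  rw [EventuallyEq, ae_modelMeasure hf hθ]
  exact ae_of_all _ fun x hx => inv_smul_smul₀ (hpos x hx) _

theorem mul_rpow_eq (hf : IsDensityFamily μ Θ f) (hθ : θ ∈ Θ) {a : ℝ} (ha : 0 ≤ a) (x : X) :
    f θ x * f θ x ^ a = f θ x ^ (1 + a) := by
  rcases (hf.nonneg θ hθ x).eq_or_lt with h | h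
  · rw [← h, zero_mul, Real.zero_rpow (by positivity)]
  · rw [Real.rpow_add h, Real.rpow_one]

/-- The common support makes `F_{θ₀}` absolutely continuous with respect to `F_θ`, so measurability
passes from one to the other. -/
theorem BasuConditions.aestronglyMeasurable_score (hB : BasuConditions μ Θ ω f β θ₀)
    (hf : IsDensityFamily μ Θ f) (hβ : 0 ≤ β) (hθ : θ ∈ ω) :
    AEStronglyMeasurable (score f θ) (modelMeasure μ f θ₀) := by
  have h1 : AEStronglyMeasurable (score f θ) (modelMeasure μ f θ) :=
    aestronglyMeasurable_modelMeasure_of_smul hf (hB.subset hθ)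
    ((hf.measurable θ (hB.subset hθ)).pow_const _) (fun x hx => (Real.rpow_pos_of_pos hx _).ne')
    (hB.integrable_rpow_smul_score hf hβ hθ).aestronglyMeasurable
  refine h1.mono_ac ?_
  refine Measure.AbsolutelyContinuous.mk fun s _ hs => ?_
  have h2 : ∀ᵐ x ∂(modelMeasure μ f θ), x ∉ s := measure_eq_zero_iff_ae_notMem.1 hs
  rw [ae_modelMeasure hf (hB.subset hθ)] at h2
  refine measure_eq_zero_iff_ae_notMem.2 ?_
  rw [ae_modelMeasure hf (hB.subset hB.mem)]
  filter_upwards [h2] with x hx h0 using hx ((hB.common_support θ (hB.subset hθ) x).2 h0)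

theorem BasuConditions.aestronglyMeasurable_psi (hB : BasuConditions μ Θ ω f β θ₀)
    (hf : IsDensityFamily μ Θ f) (hβ : 0 ≤ β) (hθ : θ ∈ ω) :
    AEStronglyMeasurable (psi μ f β θ) (modelMeasure μ f θ₀) :=
  (((hf.measurable θ (hB.subset hθ)).pow_const β).aestronglyMeasurable.smul
    (hB.aestronglyMeasurable_score hf hβ hθ)).sub aestronglyMeasurable_const

theorem BasuConditions.aestronglyMeasurable_dpdObj (hB : BasuConditions μ Θ ω f β θ₀)
    (hf : IsDensityFamily μ Θ f) (hθ : θ ∈ ω) :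
    AEStronglyMeasurable (dpdObj μ f β θ) (modelMeasure μ f θ₀) := by
  refine Measurable.aestronglyMeasurable (Measurable.sub_const ?_ _)
  have hm := hf.measurable θ (hB.subset hθ)
  by_cases h : β = 0
  · simpa [boxCox, h] using hm.log
  · simp only [boxCox, h, if_false]
    exact (hm.pow_const β).div_const β

theorem norm_sq_score_eq (u : Vec p) : ‖u‖ ^ 2 = ∑ j, u j * u j := by
  rw [EuclideanSpace.real_norm_sq_eq]
  simp [sq]

theorem LehmannConditions.integrable_norm_sq_score (hL : LehmannConditions μ Θ ω f θ₀)
    (hθ : θ ∈ ω) : Integrable (fun x => ‖score f θ x‖ ^ 2 * f θ x) μ := by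
  have h1 : Integrable (fun x => ∑ j, score f θ x j * score f θ x j * f θ x) μ :=
    integrable_finsetSum _ fun j _ => hL.fisher_finite θ hθ j j
  refine h1.congr (ae_of_all _ fun x => ?_)
  simp only [norm_sq_score_eq, Finset.sum_mul]

theorem outerSelf_smul (c : ℝ) (u : Vec p) : outerSelf (c • u) = (c * c) • outerSelf u := by
  ext d i
  simp [outerSelf_apply, inner_smul_left]
  ring

theorem BasuConditions.integrable_smul_outerSelf_score (hB : BasuConditions μ Θ ω f β θ₀)
    (hL : LehmannConditions μ Θ ω f θ₀) (hf : IsDensityFamily μ Θ f) (hβ : 0 ≤ β)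
    (hV : Integrable (fun x => ‖score f θ₀ x‖ ^ 2 * f θ₀ x ^ (1 + 2 * β)) μ) :
    Integrable (fun x => f θ₀ x ^ (1 + β) • outerSelf (score f θ₀ x)) μ := by
  have hm := hf.measurable θ₀ (hB.subset hB.mem)
  have h0 := hf.nonneg θ₀ (hB.subset hB.mem)
  refine ((hL.integrable_norm_sq_score hB.mem).add hV).mono' ?_ (ae_of_all _ fun x => ?_)
  -- `outerSelf` is quadratic, so at `f^{1+β} u` it carries the weight `f^{2(1+β)}`; one factor is
  -- divided out.
  · have h1 := ((hm.pow_const (1 + β)).inv.aestronglyMeasurable (μ := μ)).smul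
      (continuous_outerSelf.comp_aestronglyMeasurable
        (hB.integrable_rpow_smul_score hf hβ hB.mem).aestronglyMeasurable)
    refine h1.congr (ae_of_all _ fun x => ?_)
    rcases (h0 x).eq_or_lt with h | h
    · simp only [Pi.smul_apply', Pi.inv_apply, ← h, Real.zero_rpow (by positivity : 1 + β ≠ 0)]
      simp
    · have := (Real.rpow_pos_of_pos h (1 + β)).ne'
      simp only [Pi.smul_apply', Pi.inv_apply, outerSelf_smul, smul_smul]
      rw [inv_mul_cancel_left₀ this]
  · rw [norm_smul, Real.norm_of_nonneg (Real.rpow_nonneg (h0 x) _)]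
    -- The exponent `1 + β` lies between those of the Fisher information and of `V`, so the power is
    -- bounded by the sum of the other two.
    have h1 : f θ₀ x ^ (1 + β) ≤ f θ₀ x + f θ₀ x ^ (1 + 2 * β) := by
      rcases (h0 x).eq_or_lt with h | h
      · rw [← h, Real.zero_rpow (by positivity), Real.zero_rpow (by positivity), add_zero]
      · rcases le_total (f θ₀ x) 1 with h' | h'
        · have := Real.rpow_le_rpow_of_exponent_ge h h' (by linarith : (1 : ℝ) ≤ 1 + β)
          rw [Real.rpow_one] at this
          linarith [Real.rpow_nonneg h.le (1 + 2 * β)]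
        · have := Real.rpow_le_rpow_of_exponent_le h' (by linarith : 1 + β ≤ 1 + 2 * β)
          linarith
    calc f θ₀ x ^ (1 + β) * ‖outerSelf (score f θ₀ x)‖
        ≤ (f θ₀ x + f θ₀ x ^ (1 + 2 * β)) * ‖score f θ₀ x‖ ^ 2 := by
          gcongr
          · exact add_nonneg (h0 x) (Real.rpow_nonneg (h0 x) _)
          · exact norm_outerSelf_le _
      _ = _ := by rw [Pi.add_apply]; ring

theorem BasuConditions.integral_smul_outerSelf_score (hB : BasuConditions μ Θ ω f β θ₀)
    (hL : LehmannConditions μ Θ ω f θ₀) (hf : IsDensityFamily μ Θ f) (hβ : 0 ≤ β)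
    (hV : Integrable (fun x => ‖score f θ₀ x‖ ^ 2 * f θ₀ x ^ (1 + 2 * β)) μ) :
    ∫ x, f θ₀ x ^ (1 + β) • outerSelf (score f θ₀ x) ∂μ =
      toEuclideanCLM (𝕜 := ℝ) (Jmat μ f β θ₀) := by
  have hint := hB.integrable_smul_outerSelf_score hL hf hβ hV
  have hc : ∀ (T : Vec p →L[ℝ] Vec p), T = toEuclideanCLM (𝕜 := ℝ)
      (Matrix.of fun j k => T (EuclideanSpace.single k 1) j) := by
    intro T
    refine ContinuousLinearMap.ext fun d => ?_
    have h1 : d = ∑ k, d k • EuclideanSpace.single k (1 : ℝ) := by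
      simpa using ((EuclideanSpace.basisFun (Fin p) ℝ).sum_repr d).symm
    ext j
    rw [ofLp_toEuclideanCLM]
    conv_lhs => rw [h1]
    simp [mulVec, dotProduct, mul_comm]
  rw [hc (∫ x, f θ₀ x ^ (1 + β) • outerSelf (score f θ₀ x) ∂μ)]
  congr 1
  ext j k
  rw [of_apply, Jmat, of_apply, ContinuousLinearMap.integral_apply hint]
  have h2 : Integrable (fun x => (f θ₀ x ^ (1 + β) • outerSelf (score f θ₀ x))
      (EuclideanSpace.single k 1)) μ := hint.apply_continuousLinearMap _
  have h3 := (EuclideanSpace.proj (𝕜 := ℝ) j : Vec p →L[ℝ] ℝ).integral_comp_comm h2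
  rw [EuclideanSpace.coe_proj] at h3
  refine h3.symm.trans (integral_congr_ae (ae_of_all _ fun x => ?_))
  simp [outerSelf_apply, EuclideanSpace.inner_single_right]
  ring

/-- The first and last terms on the right have the same integral, because `f_{θ₀}` integrates to
one. What remains is `-J`, the mean derivative of `ψ`. -/
theorem smul_psiDeriv_eq (hB : BasuConditions μ Θ ω f β θ₀)
    (hf : IsDensityFamily μ Θ f) (hβ : 0 ≤ β) :
    ∀ᵐ x ∂μ, f θ₀ x • psiDeriv μ f β θ₀ x =
      (1 + β)⁻¹ • ((riesz (E := Vec p)).toContinuousLinearEquiv.toContinuousLinearMap ∘L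
        fderiv ℝ (fderiv ℝ (fun t => f t x ^ (1 + β))) θ₀) -
      f θ₀ x ^ (1 + β) • outerSelf (score f θ₀ x) -
      f θ₀ x • ((1 + β)⁻¹ • ((riesz (E := Vec p)).toContinuousLinearEquiv.toContinuousLinearMap ∘L
        hessPow μ f β θ₀)) := by
  have hb : 1 + β ≠ 0 := by positivity
  filter_upwards [hB.ae_posSmoothOn hf] with x hx
  rcases hx with hx | hx
  · rw [fderiv_fderiv_rpow_of_eq_zero hB.isOpen hx hb hB.mem, hx _ hB.mem, Real.zero_rpow hb]
    simp
  · rw [riesz_comp_dpdHess hB hf hβ hB.mem hx, hx.fderiv_fderiv_rpow hB.isOpen hB.mem, dpdHess,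
      ← innerSL_score]
    have h1 : f θ₀ x ^ (1 + β) = f θ₀ x * f θ₀ x ^ β :=
      (mul_rpow_eq hf (hB.subset hB.mem) hβ x).symm
    have h2 : (riesz (E := Vec p)).toContinuousLinearEquiv.toContinuousLinearMap ∘L
        ((innerSL ℝ (score f θ₀ x)).smulRight (innerSL ℝ (score f θ₀ x))) =
        outerSelf (score f θ₀ x) := by
      refine ContinuousLinearMap.ext fun d => ?_
      change riesz (inner ℝ (score f θ₀ x) d • innerSL ℝ (score f θ₀ x)) = _
      rw [LinearIsometryEquiv.map_smul, riesz_innerSL, outerSelf_apply]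
    rw [← h2, h1]
    simp only [ContinuousLinearMap.comp_sub, ContinuousLinearMap.comp_add,
      ContinuousLinearMap.comp_smul]
    match_scalars <;> field_simp <;> ring

theorem BasuConditions.integrable_comp_hess (hB : BasuConditions μ Θ ω f β θ₀) :
    Integrable (fun x => (riesz (E := Vec p)).toContinuousLinearEquiv.toContinuousLinearMap ∘L
        fderiv ℝ (fderiv ℝ (fun t => f t x ^ (1 + β))) θ₀) μ :=
  (ContinuousLinearMap.compL ℝ (Vec p) (StrongDual ℝ (Vec p)) (Vec p)
    (riesz (E := Vec p)).toContinuousLinearEquiv.toContinuousLinearMap).integrable_comp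
    (hB.diff_integral_model.integrable_fderiv_fderiv (by norm_num) hB.mem)

theorem integrable_density (hf : IsDensityFamily μ Θ f) (hθ : θ ∈ Θ) : Integrable (f θ) μ := by
  by_contra h
  have := hf.integral_eq_one θ hθ
  rw [integral_undef h] at this
  exact zero_ne_one this

theorem BasuConditions.integrable_psiDeriv (hB : BasuConditions μ Θ ω f β θ₀)
    (hL : LehmannConditions μ Θ ω f θ₀) (hf : IsDensityFamily μ Θ f) (hβ : 0 ≤ β)
    (hV : Integrable (fun x => ‖score f θ₀ x‖ ^ 2 * f θ₀ x ^ (1 + 2 * β)) μ) :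
    Integrable (psiDeriv μ f β θ₀) (modelMeasure μ f θ₀) := by
  rw [integrable_modelMeasure_iff hf (hB.subset hB.mem)]
  refine Integrable.congr ?_ ((smul_psiDeriv_eq hB hf hβ).mono fun x hx => hx.symm)
  exact ((hB.integrable_comp_hess.smul (1 + β)⁻¹).sub
    (hB.integrable_smul_outerSelf_score hL hf hβ hV)).sub
    ((integrable_density hf (hB.subset hB.mem)).smul_const _)

theorem BasuConditions.integral_psiDeriv (hB : BasuConditions μ Θ ω f β θ₀)
    (hL : LehmannConditions μ Θ ω f θ₀) (hf : IsDensityFamily μ Θ f) (hβ : 0 ≤ β)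
    (hV : Integrable (fun x => ‖score f θ₀ x‖ ^ 2 * f θ₀ x ^ (1 + 2 * β)) μ) :
    ∫ x, psiDeriv μ f β θ₀ x ∂(modelMeasure μ f θ₀) =
      -toEuclideanCLM (𝕜 := ℝ) (Jmat μ f β θ₀) := by
  have h1 : Integrable (fun x => (1 + β)⁻¹ •
      ((riesz (E := Vec p)).toContinuousLinearEquiv.toContinuousLinearMap ∘L
        fderiv ℝ (fderiv ℝ (fun t => f t x ^ (1 + β))) θ₀)) μ :=
    hB.integrable_comp_hess.smul (1 + β)⁻¹
  have h2 := hB.integrable_smul_outerSelf_score hL hf hβ hV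
  have h3 := integrable_density hf (hB.subset hB.mem)
  have h4 : ∫ x, (riesz (E := Vec p)).toContinuousLinearEquiv.toContinuousLinearMap ∘L
        fderiv ℝ (fderiv ℝ (fun t => f t x ^ (1 + β))) θ₀ ∂μ =
      (riesz (E := Vec p)).toContinuousLinearEquiv.toContinuousLinearMap ∘L hessPow μ f β θ₀ :=
    (ContinuousLinearMap.compL ℝ (Vec p) (StrongDual ℝ (Vec p)) (Vec p)
      (riesz (E := Vec p)).toContinuousLinearEquiv.toContinuousLinearMap).integral_comp_comm
      (hB.diff_integral_model.integrable_fderiv_fderiv (by norm_num) hB.mem)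
  rw [integral_modelMeasure hf (hB.subset hB.mem), integral_congr_ae (smul_psiDeriv_eq hB hf hβ),
    integral_sub (by exact h1.sub h2) (h3.smul_const _), integral_sub h1 h2, integral_smul, h4,
    integral_smul_const, hf.integral_eq_one _ (hB.subset hB.mem),
    hB.integral_smul_outerSelf_score hL hf hβ hV]
  module

theorem BasuConditions.memLp_rpow_smul_score (hB : BasuConditions μ Θ ω f β θ₀)
    (hf : IsDensityFamily μ Θ f) (hβ : 0 ≤ β)
    (hV : Integrable (fun x => ‖score f θ₀ x‖ ^ 2 * f θ₀ x ^ (1 + 2 * β)) μ) :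
    MemLp (fun x => f θ₀ x ^ β • score f θ₀ x) 2 (modelMeasure μ f θ₀) := by
  have hΘ := hB.subset hB.mem
  have hm : AEStronglyMeasurable (fun x => f θ₀ x ^ β • score f θ₀ x) (modelMeasure μ f θ₀) :=
    ((hf.measurable _ hΘ).pow_const β).aestronglyMeasurable.smul
      (hB.aestronglyMeasurable_score hf hβ hB.mem)
  rw [memLp_two_iff_integrable_sq_norm hm, integrable_modelMeasure_iff hf hΘ]
  refine hV.congr (ae_of_all _ fun x => ?_)
  have h1 : f θ₀ x ^ (1 + 2 * β) = f θ₀ x * (f θ₀ x ^ β * f θ₀ x ^ β) := by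
    rw [← mul_assoc, mul_rpow_eq hf hΘ hβ]
    rcases (hf.nonneg _ hΘ x).eq_or_lt with h | h
    · rw [← h, Real.zero_rpow (by positivity), Real.zero_rpow (by positivity), zero_mul]
    · rw [← Real.rpow_add h]; congr 1; ring
  simp only [norm_smul, Real.norm_of_nonneg (Real.rpow_nonneg (hf.nonneg _ hΘ x) β), smul_eq_mul, h1]
  ring

theorem BasuConditions.memLp_psi (hB : BasuConditions μ Θ ω f β θ₀)
    (hf : IsDensityFamily μ Θ f) (hβ : 0 ≤ β)
    (hV : Integrable (fun x => ‖score f θ₀ x‖ ^ 2 * f θ₀ x ^ (1 + 2 * β)) μ) :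
    MemLp (psi μ f β θ₀) 2 (modelMeasure μ f θ₀) := by
  have := isProbabilityMeasure_modelMeasure hf (hB.subset hB.mem)
  exact (hB.memLp_rpow_smul_score hf hβ hV).sub (memLp_const _)

theorem BasuConditions.integral_rpow_smul_score (hB : BasuConditions μ Θ ω f β θ₀)
    (hf : IsDensityFamily μ Θ f) (hβ : 0 ≤ β) :
    ∫ x, f θ₀ x ^ β • score f θ₀ x ∂(modelMeasure μ f θ₀) = xiVec μ f β θ₀ := by
  rw [integral_modelMeasure hf (hB.subset hB.mem), xiVec]
  simp only [smul_smul, mul_rpow_eq hf (hB.subset hB.mem) hβ]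

theorem BasuConditions.integral_psi (hB : BasuConditions μ Θ ω f β θ₀)
    (hf : IsDensityFamily μ Θ f) (hβ : 0 ≤ β)
    (hV : Integrable (fun x => ‖score f θ₀ x‖ ^ 2 * f θ₀ x ^ (1 + 2 * β)) μ) :
    ∫ x, psi μ f β θ₀ x ∂(modelMeasure μ f θ₀) = 0 := by
  have := isProbabilityMeasure_modelMeasure hf (hB.subset hB.mem)
  simp only [psi]
  rw [integral_sub ((hB.memLp_rpow_smul_score hf hβ hV).integrable (by norm_num))
    (integrable_const _), hB.integral_rpow_smul_score hf hβ]
  simp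

theorem BasuConditions.Vmat_eq (hB : BasuConditions μ Θ ω f β θ₀)
    (hf : IsDensityFamily μ Θ f) (hβ : 0 ≤ β)
    (hV : Integrable (fun x => ‖score f θ₀ x‖ ^ 2 * f θ₀ x ^ (1 + 2 * β)) μ) (j k : Fin p) :
    Vmat μ f β θ₀ j k =
      ∫ x, psi μ f β θ₀ x j * psi μ f β θ₀ x k ∂(modelMeasure μ f θ₀) := by
  have hΘ := hB.subset hB.mem
  have := isProbabilityMeasure_modelMeasure hf hΘ
  set a : X → Vec p := fun x => f θ₀ x ^ β • score f θ₀ x with ha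
  set ξ := xiVec μ f β θ₀ with hξ
  have hm := hB.memLp_rpow_smul_score hf hβ hV
  have hc : ∀ i, MemLp (fun x => a x i) 2 (modelMeasure μ f θ₀) := fun i => hm.eval_piLp i
  have hci : ∀ i, ∫ x, a x i ∂(modelMeasure μ f θ₀) = ξ i := fun i => by
    rw [hξ, ← hB.integral_rpow_smul_score hf hβ]
    have := (EuclideanSpace.proj (𝕜 := ℝ) i : Vec p →L[ℝ] ℝ).integral_comp_comm
      (hm.integrable (by norm_num))
    rwa [EuclideanSpace.coe_proj] at this
  have hI : ∀ i, Integrable (fun x => a x i) (modelMeasure μ f θ₀) := fun i =>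
    (hc i).integrable (by norm_num)
  have h1 : ∀ x, psi μ f β θ₀ x j * psi μ f β θ₀ x k =
      a x j * a x k - ξ k * a x j - ξ j * a x k + ξ j * ξ k := by
    intro x
    simp only [psi, PiLp.sub_apply]
    ring
  simp_rw [h1]
  have hjk : Integrable (fun x => a x j * a x k) (modelMeasure μ f θ₀) := (hc j).integrable_mul (hc k)
  have hj1 : Integrable (fun x => a x j * a x k - ξ k * a x j) (modelMeasure μ f θ₀) :=
    hjk.sub ((hI j).const_mul _)
  rw [integral_add (by exact hj1.sub ((hI k).const_mul _)) (integrable_const _),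
    integral_sub hj1 ((hI k).const_mul _),
    integral_sub hjk ((hI j).const_mul _), integral_const_mul, integral_const_mul, hci, hci,
    integral_modelMeasure hf hΘ, Vmat, of_apply]
  have h2 : ∀ x, f θ₀ x • (a x j * a x k) =
      score f θ₀ x j * score f θ₀ x k * f θ₀ x ^ (1 + 2 * β) := by
    intro x
    have h1 : f θ₀ x ^ (1 + 2 * β) = f θ₀ x * (f θ₀ x ^ β * f θ₀ x ^ β) := by
      rw [← mul_assoc, mul_rpow_eq hf hΘ hβ]
      rcases (hf.nonneg _ hΘ x).eq_or_lt with h | h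
      · rw [← h, Real.zero_rpow (by positivity), Real.zero_rpow (by positivity), zero_mul]
      · rw [← Real.rpow_add h]; congr 1; ring
    rw [h1]
    simp only [ha, PiLp.smul_apply, smul_eq_mul]
    ring
  simp_rw [h2]
  simp
  ring

/-- The Fisher information is nondegenerate: no direction of the score vanishes. -/
theorem LehmannConditions.eq_zero_of_ae_inner_score (hL : LehmannConditions μ Θ ω f θ₀)
    (hf : IsDensityFamily μ Θ f) {d : Vec p}
    (hd : ∀ᵐ x ∂(modelMeasure μ f θ₀), inner ℝ (score f θ₀ x) d = 0) : d = 0 := by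
  by_contra hne
  have hpos := (hL.fisher_posDef θ₀ hL.mem).dotProduct_mulVec_pos
    (x := d.ofLp) (by simpa using hne)
  rw [star_trivial] at hpos
  have h1 : d.ofLp ⬝ᵥ (fisher μ f θ₀) *ᵥ d.ofLp =
      ∫ x, ∑ j, d j * ∑ k, score f θ₀ x j * score f θ₀ x k * f θ₀ x * d k ∂μ := by
    have hi : ∀ j k, Integrable (fun x => score f θ₀ x j * score f θ₀ x k * f θ₀ x * d k) μ :=
      fun j k => (hL.fisher_finite θ₀ hL.mem j k).mul_const _
    rw [integral_finsetSum _ fun j _ => (integrable_finsetSum _ fun k _ => hi j k).const_mul _]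
    rw [dotProduct]
    refine Finset.sum_congr rfl fun j _ => ?_
    rw [integral_const_mul, integral_finsetSum _ fun k _ => hi j k, mulVec, dotProduct]
    congr 1
    refine Finset.sum_congr rfl fun k _ => ?_
    rw [integral_mul_const, fisher, of_apply]
  rw [h1, integral_eq_zero_of_ae] at hpos
  · exact lt_irrefl _ hpos
  · rw [ae_modelMeasure hf (hL.subset hL.mem)] at hd
    filter_upwards [hd] with x hx
    rcases (hf.nonneg _ (hL.subset hL.mem) x).eq_or_lt with h | h
    · simp [← h]
    · have h2 : ∑ j, d j * ∑ k, score f θ₀ x j * score f θ₀ x k * f θ₀ x * d k =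
          f θ₀ x * (inner ℝ (score f θ₀ x) d * inner ℝ (score f θ₀ x) d) := by
        rw [PiLp.inner_apply, Finset.sum_mul_sum, Finset.mul_sum]
        refine Finset.sum_congr rfl fun j _ => ?_
        rw [Finset.mul_sum, Finset.mul_sum]
        refine Finset.sum_congr rfl fun k _ => ?_
        simp
        ring
      rw [h2, hx h]
      simp

/-- `V` is the covariance of `ψ`. If `dᵀ V d = 0` then `⟪u, d⟫ = κ f^{-β}` almost surely with `κ =
⟪ξ, d⟫`. The score has mean zero and `f^{-β}` is positive, so `κ = 0`; then `⟪u, d⟫ = 0` and the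
Fisher information gives `d = 0`. -/
theorem BasuConditions.posDef_Vmat (hB : BasuConditions μ Θ ω f β θ₀)
    (hL : LehmannConditions μ Θ ω f θ₀) (hf : IsDensityFamily μ Θ f) (hβ : 0 ≤ β)
    (hV : Integrable (fun x => ‖score f θ₀ x‖ ^ 2 * f θ₀ x ^ (1 + 2 * β)) μ) :
    (Vmat μ f β θ₀).PosDef := by
  have hΘ := hB.subset hB.mem
  have := isProbabilityMeasure_modelMeasure hf hΘ
  have hm := hB.memLp_psi hf hβ hV
  have hc : ∀ i, MemLp (fun x => psi μ f β θ₀ x i) 2 (modelMeasure μ f θ₀) :=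
    fun i => hm.eval_piLp i
  have hquad : ∀ d : Vec p, d.ofLp ⬝ᵥ (Vmat μ f β θ₀) *ᵥ d.ofLp =
      ∫ x, inner ℝ (psi μ f β θ₀ x) d ^ 2 ∂(modelMeasure μ f θ₀) := by
    intro d
    have h1 : ∀ x, inner ℝ (psi μ f β θ₀ x) d ^ 2 =
        ∑ j, d j * ∑ k, psi μ f β θ₀ x j * psi μ f β θ₀ x k * d k := by
      intro x
      rw [PiLp.inner_apply, sq, Finset.sum_mul_sum]
      refine Finset.sum_congr rfl fun j _ => ?_
      rw [Finset.mul_sum]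
      refine Finset.sum_congr rfl fun k _ => ?_
      simp
      ring
    simp_rw [h1]
    have hi : ∀ j k, Integrable (fun x => psi μ f β θ₀ x j * psi μ f β θ₀ x k * d k)
        (modelMeasure μ f θ₀) := fun j k => ((hc j).integrable_mul (hc k)).mul_const _
    rw [integral_finsetSum _ fun j _ => (integrable_finsetSum _ fun k _ => hi j k).const_mul _]
    rw [dotProduct]
    refine Finset.sum_congr rfl fun j _ => ?_
    rw [integral_const_mul, integral_finsetSum _ fun k _ => hi j k, mulVec, dotProduct]
    congr 1
    refine Finset.sum_congr rfl fun k _ => ?_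
    rw [integral_mul_const, hB.Vmat_eq hf hβ hV]
  refine PosDef.of_dotProduct_mulVec_pos ?_ fun z hz => ?_
  · ext j k
    simp [hB.Vmat_eq hf hβ hV, mul_comm]
  · set d : Vec p := WithLp.toLp 2 z with hd
    have hz' : z = d.ofLp := rfl
    rw [star_trivial, hz', hquad]
    refine lt_of_le_of_ne (integral_nonneg fun x => sq_nonneg _) fun h0 => hz ?_
    have hi : Integrable (fun x => inner ℝ (psi μ f β θ₀ x) d ^ 2) (modelMeasure μ f θ₀) :=
      (hm.inner_const d).integrable_sq
    have hae := (integral_eq_zero_iff_of_nonneg (fun x => sq_nonneg _) hi).1 h0.symm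
    set κ := inner ℝ (xiVec μ f β θ₀) d
    have h2 : ∀ᵐ x ∂(modelMeasure μ f θ₀),
        inner ℝ (score f θ₀ x) d = κ * (f θ₀ x ^ β)⁻¹ := by
      have hp : ∀ᵐ x ∂(modelMeasure μ f θ₀), 0 < f θ₀ x :=
        (ae_modelMeasure hf hΘ).2 (ae_of_all _ fun x h => h)
      filter_upwards [hae, hp] with x hx hx0
      have h3 : inner ℝ (psi μ f β θ₀ x) d = 0 := by simpa using hx
      rw [psi, inner_sub_left, inner_smul_left] at h3
      have h4 := (Real.rpow_pos_of_pos hx0 β).ne'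
      field_simp
      simp only [conj_trivial] at h3
      linarith
    have hs : Integrable (score f θ₀) (modelMeasure μ f θ₀) := by
      have : MemLp (score f θ₀) 2 (modelMeasure μ f θ₀) := by
        rw [memLp_two_iff_integrable_sq_norm (hB.aestronglyMeasurable_score hf hβ hB.mem),
          integrable_modelMeasure_iff hf hΘ]
        simpa [mul_comm] using hL.integrable_norm_sq_score hL.mem
      exact this.integrable (by norm_num)
    have h3 : ∫ x, κ * (f θ₀ x ^ β)⁻¹ ∂(modelMeasure μ f θ₀) = 0 := by
      rw [← integral_congr_ae h2]
      have h4 : ∫ x, score f θ₀ x ∂(modelMeasure μ f θ₀) = 0 := by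
        rw [integral_modelMeasure hf hΘ, hL.score_mean θ₀ hL.mem]
      have := (innerSL ℝ d).integral_comp_comm hs
      rw [h4, map_zero] at this
      simpa [real_inner_comm] using this
    have hκ : κ = 0 := by
      by_contra hκ
      rw [integral_const_mul] at h3
      -- A zero Bochner integral is informative only for an integrable function. If `κ ≠ 0`,
      -- integrability follows from that of the score.
      have h4 : Integrable (fun x => (f θ₀ x ^ β)⁻¹) (modelMeasure μ f θ₀) := by
        have h5 : Integrable (fun x => κ * (f θ₀ x ^ β)⁻¹) (modelMeasure μ f θ₀) :=
          (hs.inner_const d).congr h2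
        simpa [hκ] using h5.const_mul κ⁻¹
      have h5 := (integral_eq_zero_iff_of_nonneg (fun x =>
        inv_nonneg.2 (Real.rpow_nonneg (hf.nonneg _ hΘ x) β)) h4).1
        ((mul_eq_zero.1 h3).resolve_left hκ)
      have hp : ∀ᵐ x ∂(modelMeasure μ f θ₀), 0 < f θ₀ x :=
        (ae_modelMeasure hf hΘ).2 (ae_of_all _ fun x h => h)
      obtain ⟨x, hx, hx0⟩ := (h5.and hp).exists
      exact (inv_pos.2 (Real.rpow_pos_of_pos hx0 β)).ne' hx
    have h6 : d = 0 := hL.eq_zero_of_ae_inner_score hf (by simpa [hκ] using h2)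
    simpa [hd] using h6

end Moments

/-! ### Roots of estimating equations -/

section Regular

variable {X : Type*} [MeasurableSpace X] {p : ℕ} {lam : Vec p → X → ℝ} {ψ : Vec p → X → Vec p}
  {B : X → Vec p →L[ℝ] Vec p} {M : X → ℝ} {ρ : ℝ} {θ₀ : Vec p} {G F : Measure X}

/-- The estimating equation with summand `ψ` is regular at `θ₀` for the distribution `G`. -/
structure RegularFor (lam : Vec p → X → ℝ) (ψ : Vec p → X → Vec p)
    (B : X → Vec p →L[ℝ] Vec p) (M : X → ℝ) (ρ : ℝ) (θ₀ : Vec p) (G : Measure X) : Prop where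
  nonneg : ∀ x, 0 ≤ M x
  ae : ∀ᵐ x ∂G, ScoreRegularAt (fun t => lam t x) (fun t => ψ t x) (B x) (M x) ρ θ₀
  meas_lam : ∀ θ ∈ Metric.ball θ₀ ρ, AEStronglyMeasurable (lam θ) G
  meas_psi : ∀ θ ∈ Metric.ball θ₀ ρ, AEStronglyMeasurable (ψ θ) G
  integrable_psi : Integrable (ψ θ₀) G
  integrable_deriv : Integrable B G
  integrable_bound : Integrable M G

theorem ScoreRegularAt.norm_sub_le {l : Vec p → ℝ} {φ : Vec p → Vec p} {T : Vec p →L[ℝ] Vec p}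
    {m : ℝ} (h : ScoreRegularAt l φ T m ρ θ₀) {θ : Vec p} (hθ : θ ∈ Metric.ball θ₀ ρ) :
    ‖φ θ - φ θ₀ - T (θ - θ₀)‖ ≤ m * ‖θ - θ₀‖ * ‖θ - θ₀‖ := by
  have hθ' : ‖θ - θ₀‖ < ρ := by simpa [dist_eq_norm] using hθ
  exact h.approx ‖θ - θ₀‖ hθ' θ (by simp [dist_eq_norm]) θ₀ (by simp)

theorem ScoreRegularAt.norm_le {l : Vec p → ℝ} {φ : Vec p → Vec p} {T : Vec p →L[ℝ] Vec p}
    {m : ℝ} (h : ScoreRegularAt l φ T m ρ θ₀) (hm : 0 ≤ m) {θ : Vec p}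
    (hθ : θ ∈ Metric.ball θ₀ ρ) : ‖φ θ‖ ≤ ‖φ θ₀‖ + ‖T‖ * ρ + m * ρ * ρ := by
  have hθ' : ‖θ - θ₀‖ ≤ ρ := le_of_lt (by simpa [dist_eq_norm] using hθ)
  have hρ : 0 ≤ ρ := (norm_nonneg _).trans hθ'
  have h1 := h.norm_sub_le hθ
  have h2 : ‖T (θ - θ₀)‖ ≤ ‖T‖ * ρ := (T.le_opNorm _).trans (by gcongr)
  have h3 : m * ‖θ - θ₀‖ * ‖θ - θ₀‖ ≤ m * ρ * ρ := by gcongr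
  have h4 : φ θ = φ θ₀ + T (θ - θ₀) + (φ θ - φ θ₀ - T (θ - θ₀)) := by abel
  rw [h4]
  refine (norm_add_le _ _).trans (add_le_add ((norm_add_le _ _).trans (by gcongr)) (h1.trans h3))

namespace RegularFor

theorem integrable (h : RegularFor lam ψ B M ρ θ₀ G) {θ : Vec p} (hθ : θ ∈ Metric.ball θ₀ ρ) :
    Integrable (ψ θ) G := by
  refine ((h.integrable_psi.norm.add (h.integrable_deriv.norm.mul_const ρ)).add
    ((h.integrable_bound.mul_const ρ).mul_const ρ)).mono' (h.meas_psi θ hθ) ?_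
  filter_upwards [h.ae] with x hx using hx.norm_le (h.nonneg x) hθ

/-- The estimating function is approximately linear near `θ₀`. -/
theorem norm_integral_sub_le (h : RegularFor lam ψ B M ρ θ₀ G) {s : ℝ} (hs : s < ρ)
    {θ θ' : Vec p} (hθ : θ ∈ Metric.closedBall θ₀ s) (hθ' : θ' ∈ Metric.closedBall θ₀ s) :
    ‖(∫ x, ψ θ x ∂G) - (∫ x, ψ θ' x ∂G) - (∫ x, B x ∂G) (θ - θ')‖ ≤
      (∫ x, M x ∂G) * s * ‖θ - θ'‖ := by
  have hsub : Metric.closedBall θ₀ s ⊆ Metric.ball θ₀ ρ := Metric.closedBall_subset_ball hs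
  have h1 := h.integrable (hsub hθ)
  have h2 := h.integrable (hsub hθ')
  have h3 : Integrable (fun x => B x (θ - θ')) G := h.integrable_deriv.apply_continuousLinearMap _
  rw [ContinuousLinearMap.integral_apply h.integrable_deriv, ← integral_sub h1 h2,
    ← integral_sub (by exact h1.sub h2) h3, mul_assoc, ← integral_mul_const]
  refine norm_integral_le_of_norm_le (h.integrable_bound.mul_const _) ?_
  filter_upwards [h.ae] with x hx
  rw [← mul_assoc]
  exact hx.approx s hs θ hθ θ' hθ'

/-- The estimating function is a gradient. -/
theorem exists_hasGradientAt [IsFiniteMeasure G] (h : RegularFor lam ψ B M ρ θ₀ G) :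
    ∀ θ ∈ Metric.ball θ₀ ρ,
      HasGradientAt (fun t => ∫ x, (lam t x - lam θ₀ x) ∂G) (∫ x, ψ θ x ∂G) θ := by
  intro θ hθ
  have hρ : 0 < ρ := dist_nonneg.trans_lt (Metric.mem_ball.1 hθ)
  have h0 : θ₀ ∈ Metric.ball θ₀ ρ := Metric.mem_ball_self hρ
  -- Only differences of the objective are integrated: `lam θ` itself need not be integrable, while
  -- the mean value inequality dominates `lam θ - lam θ₀`.
  have hint : ∀ θ ∈ Metric.ball θ₀ ρ, ∀ x,
      ScoreRegularAt (fun t => lam t x) (fun t => ψ t x) (B x) (M x) ρ θ₀ →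
      ‖lam θ x - lam θ₀ x‖ ≤ (‖ψ θ₀ x‖ + ‖B x‖ * ρ + M x * ρ * ρ) * ρ := by
    intro θ hθ x hx
    have := Convex.norm_image_sub_le_of_norm_hasFDerivWithin_le (𝕜 := ℝ) (G := ℝ)
      (f := fun t => lam t x) (C := ‖ψ θ₀ x‖ + ‖B x‖ * ρ + M x * ρ * ρ)
      (f' := fun t => innerSL ℝ (ψ t x)) (s := Metric.ball θ₀ ρ)
      (fun t ht => (hx.hasGradientAt t ht).hasFDerivAt.hasFDerivWithinAt)
      (fun t ht => by rw [innerSL_apply_norm]; exact hx.norm_le (h.nonneg x) ht)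
      (convex_ball θ₀ ρ) h0 hθ
    refine this.trans (mul_le_mul_of_nonneg_left ?_ ?_)
    · exact le_of_lt (by simpa [dist_eq_norm] using hθ)
    · have := h.nonneg x
      positivity
  have hbound : Integrable (fun x => ‖ψ θ₀ x‖ + ‖B x‖ * ρ + M x * ρ * ρ) G :=
    (h.integrable_psi.norm.add (h.integrable_deriv.norm.mul_const ρ)).add
    ((h.integrable_bound.mul_const ρ).mul_const ρ)
  have key := hasFDerivAt_integral_of_dominated_of_fderiv_le (𝕜 := ℝ) (μ := G)
    (F := fun t x => lam t x - lam θ₀ x) (F' := fun t x => innerSL ℝ (ψ t x)) (x₀ := θ)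
    (bound := fun x => ‖ψ θ₀ x‖ + ‖B x‖ * ρ + M x * ρ * ρ)
    (Metric.isOpen_ball.mem_nhds hθ)
    (by filter_upwards [Metric.isOpen_ball.mem_nhds hθ] with t ht
        exact (h.meas_lam t ht).sub (h.meas_lam θ₀ h0))
    (by refine (hbound.mul_const ρ).mono' ((h.meas_lam θ hθ).sub (h.meas_lam θ₀ h0)) ?_
        filter_upwards [h.ae] with x hx using hint θ hθ x hx)
    ((innerSL ℝ).continuous.comp_aestronglyMeasurable (h.meas_psi θ hθ))
    (by filter_upwards [h.ae] with x hx t ht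
        rw [innerSL_apply_norm]; exact hx.norm_le (h.nonneg x) ht)
    hbound
    (by filter_upwards [h.ae] with x hx t ht
        exact ((hx.hasGradientAt t ht).hasFDerivAt).sub_const _)
  rw [ContinuousLinearMap.integral_comp_comm _ (h.integrable hθ)] at key
  have := hasGradientAt_riesz key
  rwa [riesz_innerSL] at this

variable [MeasurableSingletonClass X]

theorem contam (h : RegularFor lam ψ B M ρ θ₀ F) {y : X}
    (hy : ScoreRegularAt (fun t => lam t y) (fun t => ψ t y) (B y) (M y) ρ θ₀) (t : ℝ) :
    RegularFor lam ψ B M ρ θ₀ (contam F t y) where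
  nonneg := h.nonneg
  ae := ae_contam h.ae t hy
  meas_lam θ hθ := aestronglyMeasurable_contam (h.meas_lam θ hθ) t y
  meas_psi θ hθ := aestronglyMeasurable_contam (h.meas_psi θ hθ) t y
  integrable_psi := integrable_contam h.integrable_psi t y
  integrable_deriv := integrable_contam h.integrable_deriv t y
  integrable_bound := integrable_contam h.integrable_bound t y

theorem empirical (h : RegularFor lam ψ B M ρ θ₀ F) {n : ℕ} (hn : n ≠ 0) {x : Fin n → X}
    (hx : ∀ i, ScoreRegularAt (fun t => lam t (x i)) (fun t => ψ t (x i)) (B (x i)) (M (x i)) ρ θ₀) :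
    RegularFor lam ψ B M ρ θ₀ (empirical x) where
  nonneg := h.nonneg
  ae := ae_empirical hx
  meas_lam _ _ := (integrable_empirical x hn _).aestronglyMeasurable
  meas_psi _ _ := (integrable_empirical x hn _).aestronglyMeasurable
  integrable_psi := integrable_empirical x hn _
  integrable_deriv := integrable_empirical x hn _
  integrable_bound := integrable_empirical x hn _

end RegularFor

/-- Existence of constrained roots near `θ₀`. -/
theorem exists_root_of_regularFor {r : ℕ} {J : Vec p →L[ℝ] Vec p} {c : ℝ} (hc : 0 < c)
    (hJ : ∀ d, c * ‖d‖ ^ 2 ≤ inner ℝ (J d) d) {h : Vec p → Vec r} (hρ : 0 < ρ)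
    (hd : ∀ θ ∈ Metric.ball θ₀ ρ, HasStrictFDerivAt h (fderiv ℝ h θ) θ)
    (hsurj : ∀ θ ∈ Metric.ball θ₀ ρ, Function.Surjective (fderiv ℝ h θ)) (h0 : h θ₀ = 0)
    {K : ℝ} (hK : 0 ≤ K) :
    ∃ κ > 0, ∀ G : Measure X, IsFiniteMeasure G → RegularFor lam ψ B M ρ θ₀ G →
      ∫ x, M x ∂G ≤ K → ‖(∫ x, B x ∂G) + J‖ ≤ κ → ‖∫ x, ψ θ₀ x ∂G‖ ≤ κ →
      ∃ θ ∈ Metric.ball θ₀ ρ, ‖θ - θ₀‖ ≤ 4 / c * ‖∫ x, ψ θ₀ x ∂G‖ ∧ h θ = 0 ∧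
        ∃ l : Vec r, (∫ x, ψ θ x ∂G) + ContinuousLinearMap.adjoint (fderiv ℝ h θ) l = 0 := by
  -- The Lipschitz error `c / 2` allowed by `exists_constrained_root` is shared equally between the
  -- second order remainder, at most `K * s`, and the deviation of the mean derivative from `-J`.
  obtain ⟨s, hs0, hsρ, hsK⟩ : ∃ s > 0, s < ρ ∧ K * s ≤ c / 4 := by
    refine ⟨min (ρ / 2) (c / 4 / (K + 1)), by positivity, ?_, ?_⟩
    · exact (min_le_left _ _).trans_lt (by linarith)
    · calc K * min (ρ / 2) (c / 4 / (K + 1)) ≤ (K + 1) * (c / 4 / (K + 1)) := by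
            gcongr
            · linarith
            · exact min_le_right _ _
        _ = c / 4 := by field_simp
  -- The bound `c * s / 8` on the score makes the distance `4 / c * ‖Ψ‖` at most `s / 2`.
  refine ⟨min (c / 4) (c * s / 8), by positivity, fun G hG hreg hM hB hψ => ?_⟩
  have hsub : Metric.closedBall θ₀ s ⊆ Metric.ball θ₀ ρ := Metric.closedBall_subset_ball hsρ
  have happ : ApproximatesLinearOn (fun θ => ∫ x, ψ θ x ∂G) (-J) (Metric.closedBall θ₀ s)
      ⟨c / 2, by positivity⟩ := by
    intro θ hθ θ' hθ'
    have h1 := hreg.norm_integral_sub_le hsρ hθ hθ'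
    have h2 : ‖((∫ x, B x ∂G) + J) (θ - θ')‖ ≤ c / 4 * ‖θ - θ'‖ :=
      (ContinuousLinearMap.le_opNorm _ _).trans
        (by gcongr; exact hB.trans (min_le_left _ _))
    have h3 : (∫ x, M x ∂G) * s * ‖θ - θ'‖ ≤ c / 4 * ‖θ - θ'‖ := by
      gcongr
      exact le_trans (by gcongr) hsK
    have h4 : (∫ x, ψ θ x ∂G) - (∫ x, ψ θ' x ∂G) - (-J) (θ - θ') =
        ((∫ x, ψ θ x ∂G) - (∫ x, ψ θ' x ∂G) - (∫ x, B x ∂G) (θ - θ')) +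
          ((∫ x, B x ∂G) + J) (θ - θ') := by
      rw [_root_.add_apply, _root_.neg_apply]; abel
    rw [h4]
    refine (norm_add_le _ _).trans ?_
    change _ ≤ c / 2 * ‖θ - θ'‖
    linarith
  have hlt : 4 / c * ‖∫ x, ψ θ₀ x ∂G‖ < s := by
    calc 4 / c * ‖∫ x, ψ θ₀ x ∂G‖ ≤ 4 / c * (c * s / 8) := by
          gcongr; exact hψ.trans (min_le_right _ _)
      _ = s / 2 := by field_simp; ring
      _ < s := by linarith
  obtain ⟨θ, h1, h2, h3⟩ := exists_constrained_root hc hJ (fun θ hθ => hd θ (hsub hθ))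
    (fun θ hθ => hsurj θ (hsub hθ)) h0 (κ := ⟨c / 2, by positivity⟩) le_rfl happ
    (fun θ hθ => hreg.exists_hasGradientAt θ (hsub hθ)) hlt
  refine ⟨θ, ?_, h1, h2, h3⟩
  rw [Metric.mem_ball, dist_eq_norm]
  exact (h1.trans_lt hlt).trans hsρ

/-- First order expansion of constrained roots near `θ₀`. -/
theorem root_expansion_of_regularFor {r : ℕ} {J P : Vec p →L[ℝ] Vec p} {Hc : Vec r →L[ℝ] Vec p}
    {Ht : Vec p →L[ℝ] Vec r} {N : Vec r →L[ℝ] Vec p} {N' : Vec p →L[ℝ] Vec r}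
    (hPJ : ∀ d, P (J d) = d - N (Ht d)) (hPH : ∀ l, P (Hc l) = 0) (hN' : ∀ l, N' (Hc l) = l)
    {h : Vec p → Vec r} (hd : HasFDerivAt h Ht θ₀) (h0 : h θ₀ = 0)
    {Hf : Vec p → Vec r →L[ℝ] Vec p} (hHf : ContinuousAt Hf θ₀) (hHc : Hf θ₀ = Hc) (hρ : 0 < ρ)
    {K : ℝ} (hK : 0 ≤ K) {κ' : ℝ} (hκ' : 0 < κ') :
    ∃ κ > 0, ∀ G : Measure X, RegularFor lam ψ B M ρ θ₀ G →
      ∫ x, M x ∂G ≤ K → ‖(∫ x, B x ∂G) + J‖ ≤ κ → ∀ (θ : Vec p) (l : Vec r), ‖θ - θ₀‖ ≤ κ →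
      h θ = 0 → (∫ x, ψ θ x ∂G) + Hf θ l = 0 →
      ‖θ - θ₀ - P (∫ x, ψ θ₀ x ∂G)‖ ≤ κ' * ‖∫ x, ψ θ₀ x ∂G‖ := by
  obtain ⟨κ, hκ, hroot⟩ := constrained_root_expansion hPJ hPH hN' hd h0 hHf hHc hκ'
  obtain ⟨s, hs0, hsρ, hsκ, hsK⟩ : ∃ s > 0, s < ρ ∧ s ≤ κ / 2 ∧ K * s ≤ κ / 2 := by
    refine ⟨min (min (ρ / 2) (κ / 2)) (κ / 2 / (K + 1)), by positivity, ?_, ?_, ?_⟩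
    · exact ((min_le_left _ _).trans (min_le_left _ _)).trans_lt (by linarith)
    · exact (min_le_left _ _).trans (min_le_right _ _)
    · calc K * min (min (ρ / 2) (κ / 2)) (κ / 2 / (K + 1)) ≤ (K + 1) * (κ / 2 / (K + 1)) := by
            gcongr
            · linarith
            · exact min_le_right _ _
        _ = κ / 2 := by field_simp
  refine ⟨s, hs0, fun G hreg hM hB θ l hθ hhθ hl => ?_⟩
  refine hroot θ l _ _ (hθ.trans (by linarith)) ?_ hhθ hl
  have h1 := hreg.norm_integral_sub_le hsρ (θ := θ) (θ' := θ₀) (by simpa [dist_eq_norm] using hθ)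
    (Metric.mem_closedBall_self hs0.le)
  have h2 : ‖((∫ x, B x ∂G) + J) (θ - θ₀)‖ ≤ κ / 2 * ‖θ - θ₀‖ :=
    (ContinuousLinearMap.le_opNorm _ _).trans (by gcongr; exact hB.trans hsκ)
  have h3 : (∫ x, M x ∂G) * s * ‖θ - θ₀‖ ≤ κ / 2 * ‖θ - θ₀‖ := by
    gcongr
    exact le_trans (by gcongr) hsK
  have h4 : (∫ x, ψ θ x ∂G) - (∫ x, ψ θ₀ x ∂G) + J (θ - θ₀) =
      ((∫ x, ψ θ x ∂G) - (∫ x, ψ θ₀ x ∂G) - (∫ x, B x ∂G) (θ - θ₀)) +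
        ((∫ x, B x ∂G) + J) (θ - θ₀) := by
    rw [_root_.add_apply]; abel
  rw [h4]
  refine (norm_add_le _ _).trans ?_
  linarith

end Regular

/-! ### Restrictions as linear maps -/

section Restriction

variable {p r : ℕ}

/-- A rectangular matrix as a linear map of Euclidean spaces. -/
def matCLM (N : Matrix (Fin p) (Fin r) ℝ) : Vec r →L[ℝ] Vec p :=
  (Matrix.toEuclideanLin N).toContinuousLinearMap

theorem ofLp_matCLM (N : Matrix (Fin p) (Fin r) ℝ) (v : Vec r) :
    (matCLM N v).ofLp = N *ᵥ v.ofLp := rfl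

theorem fderiv_eq_matCLM (h : Vec p → Vec r) (θ : Vec p) :
    fderiv ℝ h θ = matCLM (Hmat h θ)ᵀ := by
  refine ContinuousLinearMap.ext fun d => ?_
  have h1 : d = ∑ j, d j • (coordVec j : Vec p) := by
    simpa [coordVec] using ((EuclideanSpace.basisFun (Fin p) ℝ).sum_repr d).symm
  ext k
  rw [ofLp_matCLM]
  conv_lhs => rw [h1]
  simp [mulVec, dotProduct, Hmat, mul_comm]

/-- With gradients as columns, `H` is the transposed Jacobian, so the multiplier term `H l` is the
adjoint form delivered by Lagrange's theorem. -/
theorem adjoint_fderiv_eq_matCLM (h : Vec p → Vec r) (θ : Vec p) :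
    ContinuousLinearMap.adjoint (fderiv ℝ h θ) = matCLM (Hmat h θ) := by
  refine ContinuousLinearMap.ext fun l => ext_inner_right ℝ fun d => ?_
  rw [ContinuousLinearMap.adjoint_inner_left, fderiv_eq_matCLM,
    EuclideanSpace.inner_eq_star_dotProduct, EuclideanSpace.inner_eq_star_dotProduct, ofLp_matCLM,
    ofLp_matCLM]
  simp only [star_trivial]
  rw [mulVec_transpose, ← dotProduct_mulVec]

theorem surjective_fderiv_of_rank_eq {h : Vec p → Vec r} {θ : Vec p} (hH : (Hmat h θ).rank = r) :
    Function.Surjective (fderiv ℝ h θ) := by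
  rw [fderiv_eq_matCLM]
  have h1 : LinearMap.range ((Hmat h θ)ᵀ).mulVecLin = ⊤ := by
    refine Submodule.eq_top_of_finrank_eq ?_
    have h2 := rank_transpose (Hmat h θ)
    rw [hH, Matrix.rank] at h2
    rw [h2]; simp
  intro w
  obtain ⟨d, hd⟩ := LinearMap.range_eq_top.1 h1 w.ofLp
  refine ⟨WithLp.toLp 2 d, ?_⟩
  ext k
  rw [ofLp_matCLM]
  exact congrFun hd k

/-- `⟪J d, d⟫ = ‖J^{1/2} d‖²`, and an injective linear map in finite dimension is bounded below. -/
theorem exists_coercive {J : Matrix (Fin p) (Fin p) ℝ} (hJ : J.PosDef) :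
    ∃ c > 0, ∀ d : Vec p, c * ‖d‖ ^ 2 ≤ inner ℝ (toEuclideanCLM (𝕜 := ℝ) J d) d := by
  have hinj : LinearMap.ker (matCLM (sqrtMat J) : Vec p →ₗ[ℝ] Vec p) = ⊥ := by
    rw [LinearMap.ker_eq_bot']
    intro d hd
    have h1 : sqrtMat J *ᵥ d.ofLp = 0 := congrArg WithLp.ofLp hd
    have h2 := congrArg (fun z => (sqrtMat J)⁻¹ *ᵥ z) h1
    simp only [mulVec_mulVec, nonsing_inv_mul _ (isUnit_det_sqrtMat hJ), one_mulVec,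
      mulVec_zero] at h2
    ext i
    exact congrFun h2 i
  obtain ⟨K, hK, hanti⟩ := LinearMap.exists_antilipschitzWith _ hinj
  refine ⟨((K : ℝ) ^ 2)⁻¹, by positivity, fun d => ?_⟩
  have h1 : ‖d‖ ≤ K * ‖matCLM (sqrtMat J) d‖ := by
    simpa using hanti.le_mul_dist d 0
  have h2 : inner ℝ (toEuclideanCLM (𝕜 := ℝ) J d) d = ‖matCLM (sqrtMat J) d‖ ^ 2 := by
    rw [← real_inner_self_eq_norm_sq, EuclideanSpace.inner_eq_star_dotProduct,
      EuclideanSpace.inner_eq_star_dotProduct, ofLp_matCLM, ofLp_toEuclideanCLM]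
    simp only [star_trivial]
    conv_lhs => rw [← sqrtMat_mul_self hJ.posSemidef]
    rw [← mulVec_mulVec, dotProduct_mulVec, ← mulVec_transpose, transpose_sqrtMat hJ.posSemidef]
  rw [h2, inv_mul_le_iff₀ (by positivity), ← mul_pow]
  gcongr

theorem Pmat_eq {X : Type*} [MeasurableSpace X] (μ : Measure X) (f : Vec p → X → ℝ) (β : ℝ)
    (h : Vec p → Vec r) (θ : Vec p) :
    Pmat μ f β h θ = (Jmat μ f β θ)⁻¹ - projMat (Jmat μ f β θ) (Hmat h θ) := rfl

end Restriction

/-! ### Events of probability tending to one -/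

section Whp

variable {X : Type*} [MeasurableSpace X] {Q : ℕ → Measure X}

/-- The event `q n` has probability tending to one, for samples of size `n` from `Q n`. -/
def Whp (Q : ℕ → Measure X) (q : (n : ℕ) → (Fin n → X) → Prop) : Prop :=
  Tendsto (fun n => sampleLaw Q n {x | ¬ q n x}) atTop (𝓝 0)

/-- Only monotonicity of the outer measure is used, here and in `Whp.and`, so neither the estimators
nor the events need to be measurable. -/
theorem Whp.mono {q q' : (n : ℕ) → (Fin n → X) → Prop} (hq : Whp Q q)
    (h : ∀ᶠ n in atTop, ∀ x, q n x → q' n x) : Whp Q q' := by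
  refine tendsto_of_tendsto_of_tendsto_of_le_of_le' tendsto_const_nhds hq
    (Eventually.of_forall fun _ => bot_le) ?_
  filter_upwards [h] with n hn
  exact measure_mono fun x hx h' => hx (hn x h')

theorem Whp.and {q q' : (n : ℕ) → (Fin n → X) → Prop} (hq : Whp Q q) (hq' : Whp Q q') :
    Whp Q fun n x => q n x ∧ q' n x := by
  have := hq.add hq'
  rw [add_zero] at this
  refine tendsto_of_tendsto_of_tendsto_of_le_of_le tendsto_const_nhds this
    (fun _ => bot_le) fun n => ?_
  refine (measure_mono fun x hx => ?_).trans (measure_union_le _ _)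
  rcases not_and_or.1 hx with h | h
  · exact Or.inl h
  · exact Or.inr h

theorem whp_of_forall {q : (n : ℕ) → (Fin n → X) → Prop} (h : ∀ᶠ n in atTop, ∀ x, q n x) :
    Whp Q q := by
  refine tendsto_const_nhds.congr' ?_
  filter_upwards [h] with n hn
  symm
  refine measure_mono_null (t := ∅) (fun x hx => hx (hn x)) measure_empty

theorem eventually_isProbabilityMeasure_levelContam (F : Measure X) [IsProbabilityMeasure F]
    {ε : ℝ} (hε : 0 ≤ ε) (y : X) :
    ∀ᶠ n in atTop, IsProbabilityMeasure (levelContam F ε y n) := by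
  filter_upwards [eventually_contam_rate_le ε] with n hn
  exact isProbabilityMeasure_contam F (by positivity) hn y

theorem whp_forall_sample [MeasurableSingletonClass X] {F : Measure X} [IsProbabilityMeasure F]
    {ε : ℝ} (hε : 0 ≤ ε) {y : X} {q : X → Prop} (hq : ∀ᵐ x ∂F, q x) (hy : q y) :
    Whp (levelContam F ε y) fun _ x => ∀ i, q (x i) := by
  refine tendsto_const_nhds.congr' ?_
  filter_upwards [eventually_isProbabilityMeasure_levelContam F hε y] with n hn
  symm
  have h1 : ∀ i : Fin n, ∀ᵐ x ∂(sampleLaw (levelContam F ε y) n), q (x i) := fun i =>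
    (Measure.quasiMeasurePreserving_eval (fun _ : Fin n => levelContam F ε y n) i).ae
      (ae_contam hq _ hy)
  exact (ae_all_iff.2 h1 : ∀ᵐ x ∂(sampleLaw (levelContam F ε y) n), ∀ i, q (x i))

theorem whp_average [MeasurableSingletonClass X] {F : Measure X} [IsProbabilityMeasure F]
    {G : Type*} [NormedAddCommGroup G] [NormedSpace ℝ G] [FiniteDimensional ℝ G] {φ : X → G}
    (hφ : Integrable φ F) {ε : ℝ} (hε : 0 ≤ ε) (y : X) {η : ℝ} (hη : 0 < η) :
    Whp (levelContam F ε y) fun _ x => ‖(∫ z, φ z ∂(empirical x)) - ∫ z, φ z ∂F‖ < η := by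
  have : CompleteSpace G := FiniteDimensional.complete ℝ G
  refine (tendsto_sampleLaw_average hφ hε y hη).congr fun n => ?_
  congr 1
  ext x
  simp only [integral_empirical, Set.mem_ofPred_eq, not_lt]

end Whp

/-! ### Roots of the density power divergence equations -/

section ModelRoots

variable {X : Type*} [MeasurableSpace X] {μ : Measure X} {p r : ℕ}
  {Θ ω : Set (Vec p)} {f : Vec p → X → ℝ} {h : Vec p → Vec r} {θ₀ : Vec p} {β : ℝ} {y : X}

/-- The regularity assumptions on the model, at the contamination point `y`. -/
structure RegularModel (μ : Measure X) (Θ ω : Set (Vec p)) (f : Vec p → X → ℝ) (θ₀ : Vec p)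
    (β : ℝ) (y : X) : Prop where
  density : IsDensityFamily μ Θ f
  lehmann : LehmannConditions μ Θ ω f θ₀
  basu : BasuConditions μ Θ ω f β θ₀
  nonneg : 0 ≤ β
  integrable : Integrable (fun x => ‖score f θ₀ x‖ ^ 2 * f θ₀ x ^ (1 + 2 * β)) μ
  posSmoothOn : PosSmoothOn (fun t => f t y) ω

/-- The regularity assumptions on the restrictions. -/
structure RegularRestriction (ω : Set (Vec p)) (h : Vec p → Vec r) (θ₀ : Vec p) : Prop where
  contDiffOn : ContDiffOn ℝ 1 h ω
  rank_eq : ∀ θ ∈ ω, (Hmat h θ).rank = r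
  eq_zero : h θ₀ = 0

/-- `G` is a distribution close to the model, in the sense of a few moments. -/
structure NearModel (μ : Measure X) (f : Vec p → X → ℝ) (β : ℝ) (θ₀ : Vec p) (M : X → ℝ)
    (ρ κ : ℝ) (G : Measure X) : Prop where
  prob : IsProbabilityMeasure G
  regular : RegularFor (dpdObj μ f β) (psi μ f β) (psiDeriv μ f β θ₀) M ρ θ₀ G
  bound : ∫ x, M x ∂G ≤ (∫ x, M x ∂(modelMeasure μ f θ₀)) + 1
  deriv : ‖(∫ x, psiDeriv μ f β θ₀ x ∂G) + toEuclideanCLM (𝕜 := ℝ) (Jmat μ f β θ₀)‖ ≤ κ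
  score : ‖∫ x, psi μ f β θ₀ x ∂G‖ ≤ κ

/-- As `G` has mass one, the centring `ξ(θ)` may be moved under the integral. -/
theorem estFun_eq_integral_psi {G : Measure X} [IsProbabilityMeasure G] {θ : Vec p}
    (h : Integrable (psi μ f β θ) G) : estFun μ f β G θ = ∫ x, psi μ f β θ x ∂G := by
  have h1 : Integrable (fun x => f θ x ^ β • SDT.score f θ x) G := by
    refine (h.add (integrable_const (xiVec μ f β θ))).congr (ae_of_all _ fun x => ?_)
    simp [psi]
  simp only [psi]
  rw [integral_sub h1 (integrable_const _), integral_const]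
  simp [estFun, xiVec]

theorem isRootR_iff {G : Measure X} [IsProbabilityMeasure G] {θ : Vec p}
    (hi : Integrable (psi μ f β θ) G) :
    IsRootR μ Θ f β h G θ ↔ θ ∈ Θ ∧ h θ = 0 ∧ ∃ l : Vec r, (∫ x, psi μ f β θ x ∂G) +
      ContinuousLinearMap.adjoint (fderiv ℝ h θ) l = 0 := by
  rw [IsRootR, estFun_eq_integral_psi hi, adjoint_fderiv_eq_matCLM]
  refine and_congr_right fun _ => and_congr_right fun _ => ?_
  constructor
  · rintro ⟨l, hl⟩
    refine ⟨WithLp.toLp 2 l, ?_⟩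
    ext i
    exact congrFun hl i
  · rintro ⟨l, hl⟩
    exact ⟨l.ofLp, congrArg WithLp.ofLp hl⟩

theorem RegularModel.isProbabilityMeasure (S : RegularModel μ Θ ω f θ₀ β y) :
    IsProbabilityMeasure (modelMeasure μ f θ₀) :=
  isProbabilityMeasure_modelMeasure S.density (S.basu.subset S.basu.mem)

theorem RegularRestriction.hasStrictFDerivAt (hR : RegularRestriction ω h θ₀) (hω : IsOpen ω)
    {θ : Vec p} (hθ : θ ∈ ω) : HasStrictFDerivAt h (fderiv ℝ h θ) θ :=
  (hR.contDiffOn.contDiffAt (hω.mem_nhds hθ)).hasStrictFDerivAt (by norm_num)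

/-- A functional that is a root at all distributions close to the model. -/
theorem exists_functional (S : RegularModel μ Θ ω f θ₀ β y) (hR : RegularRestriction ω h θ₀)
    {ρ : ℝ} (hρ : 0 < ρ) {M : X → ℝ} (hω : Metric.ball θ₀ ρ ⊆ ω)
    (hM : 0 ≤ ∫ x, M x ∂(modelMeasure μ f θ₀)) :
    ∃ κ > 0, ∃ C > 0, ∃ U : Measure X → Vec p, ∀ G, NearModel μ f β θ₀ M ρ κ G →
      IsRootR μ Θ f β h G (U G) ∧ ‖U G - θ₀‖ ≤ C * ‖∫ x, psi μ f β θ₀ x ∂G‖ := by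
  obtain ⟨c, hc, hJ⟩ := exists_coercive S.basu.J_posDef
  obtain ⟨κ, hκ, hroot⟩ := exists_root_of_regularFor (X := X) (lam := dpdObj μ f β)
    (ψ := psi μ f β) (B := psiDeriv μ f β θ₀) (M := M) hc hJ hρ
    (fun θ hθ => hR.hasStrictFDerivAt S.basu.isOpen (hω hθ))
    (fun θ hθ => surjective_fderiv_of_rank_eq (hR.rank_eq θ (hω hθ))) hR.eq_zero
    (K := (∫ x, M x ∂(modelMeasure μ f θ₀)) + 1) (by linarith)
  -- A root is selected for every `G` near the model by choice. The one map `U` supplies both the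
  -- functional, at contaminated distributions, and the estimator, at empirical ones.
  have key : ∀ G, ∃ θ, NearModel μ f β θ₀ M ρ κ G →
      IsRootR μ Θ f β h G θ ∧ ‖θ - θ₀‖ ≤ 4 / c * ‖∫ x, psi μ f β θ₀ x ∂G‖ := by
    intro G
    by_cases hG : NearModel μ f β θ₀ M ρ κ G
    · have := hG.prob
      obtain ⟨θ, h1, h2, h3, h4⟩ := hroot G inferInstance hG.regular hG.bound hG.deriv hG.score
      exact ⟨θ, fun _ => ⟨(isRootR_iff (hG.regular.integrable h1)).2
        ⟨S.basu.subset (hω h1), h3, h4⟩, h2⟩⟩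
    · exact ⟨θ₀, fun h => absurd h hG⟩
  choose U hU using key
  exact ⟨κ, hκ, 4 / c, by positivity, U, hU⟩

theorem NearModel.mono {M : X → ℝ} {ρ κ κ' : ℝ} {G : Measure X}
    (hG : NearModel μ f β θ₀ M ρ κ G) (h : κ ≤ κ') : NearModel μ f β θ₀ M ρ κ' G :=
  ⟨hG.prob, hG.regular, hG.bound, hG.deriv.trans h, hG.score.trans h⟩

/-- First order expansion of roots at distributions close to the model. -/
theorem root_expansion (S : RegularModel μ Θ ω f θ₀ β y) (hR : RegularRestriction ω h θ₀)
    {ρ : ℝ} (hρ : 0 < ρ) {M : X → ℝ}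
    (hM : 0 ≤ ∫ x, M x ∂(modelMeasure μ f θ₀)) {κ' : ℝ} (hκ' : 0 < κ') :
    ∃ κ > 0, ∀ G θ, NearModel μ f β θ₀ M ρ κ G → IsRootR μ Θ f β h G θ → dist θ θ₀ < κ →
      ‖θ - θ₀ - toEuclideanCLM (𝕜 := ℝ) (Pmat μ f β h θ₀) (∫ x, psi μ f β θ₀ x ∂G)‖ ≤
        κ' * ‖∫ x, psi μ f β θ₀ x ∂G‖ := by
  set J := Jmat μ f β θ₀ with hJdef
  set H := Hmat h θ₀ with hHdef
  have hJ : J.PosDef := S.basu.J_posDef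
  have hH : H.rank = r := hR.rank_eq θ₀ S.basu.mem
  have hcont : ContinuousAt (fun θ => ContinuousLinearMap.adjoint (fderiv ℝ h θ)) θ₀ :=
    (ContinuousLinearMap.adjoint (𝕜 := ℝ)).continuous.continuousAt.comp
      ((hR.contDiffOn.contDiffAt (S.basu.isOpen.mem_nhds S.basu.mem)).continuousAt_fderiv
        (by norm_num))
  obtain ⟨κ, hκ, hroot⟩ := root_expansion_of_regularFor (X := X) (lam := dpdObj μ f β)
    (ψ := psi μ f β) (B := psiDeriv μ f β θ₀) (M := M) (θ₀ := θ₀)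
    (J := toEuclideanCLM (𝕜 := ℝ) J) (P := toEuclideanCLM (𝕜 := ℝ) (Pmat μ f β h θ₀))
    (Hc := ContinuousLinearMap.adjoint (fderiv ℝ h θ₀)) (Ht := fderiv ℝ h θ₀)
    -- `P J` differs from the identity by `N` after the derivative of `h`; `N'` is a left inverse of
    -- `H`.
    (N := matCLM (J⁻¹ * H * (Hᵀ * J⁻¹ * H)⁻¹)) (N' := matCLM ((Hᵀ * J⁻¹ * H)⁻¹ * Hᵀ * J⁻¹))
    (by
      intro d
      ext1
      rw [WithLp.ofLp_sub, ofLp_toEuclideanCLM, ofLp_toEuclideanCLM, ofLp_matCLM,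
        fderiv_eq_matCLM, ofLp_matCLM, mulVec_mulVec, mulVec_mulVec, Pmat_eq,
        inv_sub_projMat_mul hJ, sub_mulVec, one_mulVec])
    (by
      intro l
      ext1
      rw [adjoint_fderiv_eq_matCLM, ofLp_toEuclideanCLM, ofLp_matCLM, mulVec_mulVec, Pmat_eq,
        inv_sub_projMat_mul_eq_zero hJ hH, zero_mulVec]; rfl)
    (by
      intro l
      ext1
      rw [adjoint_fderiv_eq_matCLM, ofLp_matCLM, ofLp_matCLM, mulVec_mulVec,
        leftInverse_of_rank_eq hJ hH, one_mulVec])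
    (hR.hasStrictFDerivAt S.basu.isOpen S.basu.mem).hasFDerivAt hR.eq_zero hcont rfl hρ
    (K := (∫ x, M x ∂(modelMeasure μ f θ₀)) + 1) (by linarith) hκ'
  refine ⟨min κ ρ, by positivity, fun G θ hG hθ hd => ?_⟩
  have := hG.prob
  have hmem : θ ∈ Metric.ball θ₀ ρ := hd.trans_le (min_le_right _ _)
  obtain ⟨-, h1, l, hl⟩ := (isRootR_iff (hG.regular.integrable hmem)).1 hθ
  exact hroot G hG.regular hG.bound (hG.deriv.trans (min_le_left _ _)) θ l
    (by rw [← dist_eq_norm]; exact hd.le.trans (min_le_left _ _)) h1 hl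

variable [MeasurableSingletonClass X]

/-- The model distribution, its contaminations and the empirical distributions are regular for
the estimating equation. -/
theorem RegularModel.exists_bound (S : RegularModel μ Θ ω f θ₀ β y) :
    ∃ ρ > 0, ∃ M : X → ℝ, Metric.ball θ₀ ρ ⊆ ω ∧ 0 ≤ ∫ x, M x ∂(modelMeasure μ f θ₀) ∧
      (∀ κ > 0, ∀ᶠ t in 𝓝[≥] (0 : ℝ),
        NearModel μ f β θ₀ M ρ κ (contam (modelMeasure μ f θ₀) t y)) ∧
      ∀ κ > 0, ∀ ε, 0 ≤ ε → Whp (levelContam (modelMeasure μ f θ₀) ε y)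
        fun _ x => NearModel μ f β θ₀ M ρ κ (empirical x) := by
  have hF := S.isProbabilityMeasure
  obtain ⟨ρ, hρ, hω, M, hM, hM0, hae, hy⟩ :=
    exists_scoreRegularAt S.basu S.density S.nonneg S.posSmoothOn
  have hψ := (S.basu.memLp_psi S.density S.nonneg S.integrable).integrable (by norm_num)
  have hB := S.basu.integrable_psiDeriv S.lehmann S.density S.nonneg S.integrable
  have hψ0 := S.basu.integral_psi S.density S.nonneg S.integrable
  have hBJ := S.basu.integral_psiDeriv S.lehmann S.density S.nonneg S.integrable
  have hreg : RegularFor (dpdObj μ f β) (psi μ f β) (psiDeriv μ f β θ₀) M ρ θ₀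
      (modelMeasure μ f θ₀) :=
    ⟨hM0, hae, fun θ hθ => S.basu.aestronglyMeasurable_dpdObj S.density (hω hθ),
      fun θ hθ => S.basu.aestronglyMeasurable_psi S.density S.nonneg (hω hθ), hψ, hB, hM⟩
  refine ⟨ρ, hρ, M, hω, integral_nonneg hM0, fun κ hκ => ?_, fun κ hκ ε hε => ?_⟩
  · have hsmall : ∀ a b : ℝ, 0 < b → ∀ᶠ t in 𝓝[≥] (0 : ℝ), t * a ≤ b := by
      intro a b hb
      refine (Tendsto.mono_left ?_ nhdsWithin_le_nhds).eventually (ge_mem_nhds hb)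
      have : Continuous fun t : ℝ => t * a := by fun_prop
      simpa using this.tendsto 0
    -- The moments at the contaminated distribution are affine in `t`, so all requirements hold for
    -- small `t`.
    filter_upwards [self_mem_nhdsWithin, hsmall 1 1 one_pos, hsmall (M y) 1 one_pos,
      hsmall ‖psiDeriv μ f β θ₀ y + toEuclideanCLM (𝕜 := ℝ) (Jmat μ f β θ₀)‖ κ hκ,
      hsmall ‖psi μ f β θ₀ y‖ κ hκ] with t ht0 ht1 ht2 ht3 ht4
    rw [mul_one] at ht1
    have ht0' : (0 : ℝ) ≤ t := ht0
    refine ⟨isProbabilityMeasure_contam _ ht0' ht1 y, hreg.contam hy t, ?_, ?_, ?_⟩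
    · rw [integral_contam hM ht0' ht1, smul_eq_mul, smul_eq_mul]
      have : 0 ≤ t * ∫ x, M x ∂(modelMeasure μ f θ₀) := mul_nonneg ht0' (integral_nonneg hM0)
      linarith
    · rw [integral_contam hB ht0' ht1, hBJ]
      have h1 : (1 - t) • (-toEuclideanCLM (𝕜 := ℝ) (Jmat μ f β θ₀)) + t • psiDeriv μ f β θ₀ y +
          toEuclideanCLM (𝕜 := ℝ) (Jmat μ f β θ₀) =
          t • (psiDeriv μ f β θ₀ y + toEuclideanCLM (𝕜 := ℝ) (Jmat μ f β θ₀)) := by module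
      rw [h1, norm_smul, Real.norm_of_nonneg ht0']
      exact ht3
    · rw [integral_contam hψ ht0' ht1, hψ0, smul_zero, zero_add, norm_smul,
        Real.norm_of_nonneg ht0']
      exact ht4
  -- For samples, the pointwise regularity holds at all observations almost surely, and the moments
  -- follow from the law of large numbers.
  · refine ((((whp_of_forall (q := fun n _ => n ≠ 0) ?_).and (whp_forall_sample hε hae hy)).and
      (whp_average hM hε y one_pos)).and ((whp_average hB hε y hκ).and
      (whp_average hψ hε y hκ))).mono (Eventually.of_forall ?_)
    · filter_upwards [eventually_ne_atTop 0] with n hn x using hn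
    rintro n x ⟨⟨⟨hn, hx⟩, h1⟩, h2, h3⟩
    refine ⟨isProbabilityMeasure_empirical x hn, hreg.empirical hn hx, ?_, ?_, ?_⟩
    · rw [Real.norm_eq_abs] at h1
      linarith [(abs_lt.1 h1).2]
    · rw [hBJ, sub_neg_eq_add] at h2
      exact h2.le
    · rw [hψ0, sub_zero] at h3
      exact h3.le

theorem exists_isRootFunctional (S : RegularModel μ Θ ω f θ₀ β y)
    (hR : RegularRestriction ω h θ₀) :
    ∃ U, IsRootFunctional (IsRootR μ Θ f β h) (modelMeasure μ f θ₀) y θ₀ U := by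
  obtain ⟨ρ, hρ, M, hω, hM, hcon, -⟩ := S.exists_bound
  obtain ⟨κ, hκ, C, hC, U, hU⟩ := exists_functional S hR hρ hω hM
  refine ⟨U, ⟨(hcon κ hκ).mono fun t ht => (hU _ ht).1, ?_⟩⟩
  rw [Metric.tendsto_nhds]
  intro η hη
  filter_upwards [hcon (min κ (η / (2 * C))) (by positivity)] with t ht
  rw [dist_eq_norm]
  calc ‖U (contam (modelMeasure μ f θ₀) t y) - θ₀‖ ≤ C * (η / (2 * C)) :=
        (hU _ (ht.mono (min_le_left _ _))).2.trans
          (by gcongr; exact ht.score.trans (min_le_right _ _))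
    _ = η / 2 := by field_simp
    _ < η := by linarith

/-- The selected root at the empirical distribution does not involve `ε`, so one sequence serves all
contamination rates. Consistency follows from the bound of its distance to `θ₀` by the mean score.
-/
theorem exists_isConsistentRoot (S : RegularModel μ Θ ω f θ₀ β y)
    (hR : RegularRestriction ω h θ₀) :
    ∃ T : (n : ℕ) → (Fin n → X) → Vec p, ∀ ε : ℝ, 0 ≤ ε → IsConsistentRoot (IsRootR μ Θ f β h)
      (levelContam (modelMeasure μ f θ₀) ε y) θ₀ T := by
  obtain ⟨ρ, hρ, M, hω, hM, -, hemp⟩ := S.exists_bound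
  obtain ⟨κ, hκ, C, hC, U, hU⟩ := exists_functional S hR hρ hω hM
  refine ⟨fun n x => U (empirical x), fun ε hε => ⟨?_, fun η hη => ?_⟩⟩
  · exact (hemp κ hκ ε hε).mono (Eventually.of_forall fun n x hx => (hU _ hx).1)
  · have : Whp (levelContam (modelMeasure μ f θ₀) ε y)
        fun n x => ¬ η ≤ dist (U (empirical x)) θ₀ := by
      refine (hemp (min κ (η / (2 * C))) (by positivity) ε hε).mono
        (Eventually.of_forall fun n x hx => ?_)
      rw [not_le, dist_eq_norm]
      calc ‖U (empirical x) - θ₀‖ ≤ C * (η / (2 * C)) :=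
            (hU _ (hx.mono (min_le_left _ _))).2.trans
              (by gcongr; exact hx.score.trans (min_le_right _ _))
        _ = η / 2 := by field_simp
        _ < η := by linarith
    simpa only [Whp, not_not] using this

/-- The influence function of a root functional. -/
theorem IsRootFunctional.hasDerivWithinAt (S : RegularModel μ Θ ω f θ₀ β y)
    (hR : RegularRestriction ω h θ₀) {U : Measure X → Vec p}
    (hU : IsRootFunctional (IsRootR μ Θ f β h) (modelMeasure μ f θ₀) y θ₀ U) :
    HasDerivWithinAt (fun t => U (contam (modelMeasure μ f θ₀) t y))
      (toEuclideanCLM (𝕜 := ℝ) (Pmat μ f β h θ₀) (psi μ f β θ₀ y)) (Set.Ici 0) 0 := by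
  have hF := S.isProbabilityMeasure
  obtain ⟨ρ, hρ, M, hω, hM, hcon, -⟩ := S.exists_bound
  have hψ := (S.basu.memLp_psi S.density S.nonneg S.integrable).integrable (by norm_num)
  have hψ0 := S.basu.integral_psi S.density S.nonneg S.integrable
  -- `ψ` is centred under the model, so at contamination `t` the mean score is exactly `t ψ(y)` and
  -- the relative error in the expansion is an error of order `t`.
  have key : ∀ κ' > 0, ∀ᶠ t in 𝓝[≥] (0 : ℝ), ‖U (contam (modelMeasure μ f θ₀) t y) - θ₀ -
      t • toEuclideanCLM (𝕜 := ℝ) (Pmat μ f β h θ₀) (psi μ f β θ₀ y)‖ ≤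
        κ' * (t * ‖psi μ f β θ₀ y‖) := by
    intro κ' hκ'
    obtain ⟨κ, hκ, hexp⟩ := root_expansion S hR hρ hM hκ'
    have ht1 : ∀ᶠ t in 𝓝[≥] (0 : ℝ), t ≤ 1 :=
      nhdsWithin_le_nhds (ge_mem_nhds one_pos)
    filter_upwards [hcon κ hκ, hU.root_eventually, Metric.tendsto_nhds.1 hU.tendsto κ hκ, ht1,
      self_mem_nhdsWithin] with t h1 h2 h3 h4 h5
    have h5' : (0 : ℝ) ≤ t := h5
    have h6 := hexp _ _ h1 h2 h3
    rwa [integral_contam hψ h5' h4, hψ0, smul_zero, zero_add, map_smul, norm_smul,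
      Real.norm_of_nonneg h5'] at h6
  -- The estimate at `t = 0` itself identifies the value at the model, which the definition of a
  -- root functional leaves implicit.
  have h0 : U (contam (modelMeasure μ f θ₀) 0 y) = θ₀ := by
    have h1 := (key 1 one_pos).self_of_nhdsWithin (Set.mem_Ici.2 le_rfl)
    simpa [sub_eq_zero] using h1
  rw [hasDerivWithinAt_iff_isLittleO, Asymptotics.isLittleO_iff]
  intro c hc
  -- The `1` avoids dividing by zero when `ψ(y) = 0`.
  have hpos : 0 < ‖psi μ f β θ₀ y‖ + 1 := by positivity
  filter_upwards [key (c / (‖psi μ f β θ₀ y‖ + 1)) (by positivity), self_mem_nhdsWithin] with t h1 h2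
  have h2' : (0 : ℝ) ≤ t := h2
  rw [h0, sub_zero, Real.norm_of_nonneg h2']
  refine h1.trans ?_
  calc c / (‖psi μ f β θ₀ y‖ + 1) * (t * ‖psi μ f β θ₀ y‖)
      ≤ c / (‖psi μ f β θ₀ y‖ + 1) * (t * (‖psi μ f β θ₀ y‖ + 1)) := by
        gcongr; linarith
    _ = c * t := by field_simp

/-- The asymptotic expansion of consistent roots. -/
theorem IsConsistentRoot.whp_expansion (S : RegularModel μ Θ ω f θ₀ β y)
    (hR : RegularRestriction ω h θ₀) {ε : ℝ} (hε : 0 ≤ ε) {T : (n : ℕ) → (Fin n → X) → Vec p}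
    (hT : IsConsistentRoot (IsRootR μ Θ f β h) (levelContam (modelMeasure μ f θ₀) ε y) θ₀ T)
    {κ' : ℝ} (hκ' : 0 < κ') :
    Whp (levelContam (modelMeasure μ f θ₀) ε y) fun n x =>
      ‖T n x - θ₀ - toEuclideanCLM (𝕜 := ℝ) (Pmat μ f β h θ₀)
        (∫ z, psi μ f β θ₀ z ∂(empirical x))‖ ≤ κ' * ‖∫ z, psi μ f β θ₀ z ∂(empirical x)‖ := by
  obtain ⟨ρ, hρ, M, hω, hM, -, hemp⟩ := S.exists_bound
  obtain ⟨κ, hκ, hexp⟩ := root_expansion S hR hρ hM hκ'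
  have h1 : Whp (levelContam (modelMeasure μ f θ₀) ε y) fun n x =>
      IsRootR μ Θ f β h (empirical x) (T n x) := hT.root_whp
  have h2 : Whp (levelContam (modelMeasure μ f θ₀) ε y) fun n x => dist (T n x) θ₀ < κ := by
    simpa only [Whp, not_lt] using hT.consistent κ hκ
  exact (((hemp κ hκ ε hε).and h1).and h2).mono
    (Eventually.of_forall fun n x hx => hexp _ _ hx.1.1 hx.1.2 hx.2)

end ModelRoots

/-! ### The unrestricted equations as restricted equations without restrictions -/

section Unrestricted

variable {X : Type*} [MeasurableSpace X] {μ : Measure X} {p : ℕ} {Θ ω : Set (Vec p)}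
  {f : Vec p → X → ℝ} {θ₀ : Vec p} {β : ℝ}

/-- A constraint with values in the zero space is void and has only the zero multiplier, so results
on restricted roots cover both equations. -/
theorem isRootR_zero_eq :
    IsRootR μ Θ f β (0 : Vec p → Vec 0) = IsRootU μ Θ f β := by
  funext G θ
  refine propext ⟨?_, ?_⟩
  · rintro ⟨h1, -, l, hl⟩
    refine ⟨h1, ?_⟩
    ext i
    have := congrFun hl i
    simpa [mulVec, dotProduct] using this
  · rintro ⟨h1, h2⟩
    refine ⟨h1, Subsingleton.elim _ _, 0, ?_⟩
    rw [h2, mulVec_zero]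
    simp

theorem regularRestriction_zero (ω : Set (Vec p)) (θ₀ : Vec p) :
    RegularRestriction ω (0 : Vec p → Vec 0) θ₀ where
  contDiffOn := contDiffOn_const
  rank_eq θ _ := by
    have := (Hmat (0 : Vec p → Vec 0) θ).rank_le_width
    omega
  eq_zero := rfl

theorem Pmat_zero : Pmat μ f β (0 : Vec p → Vec 0) θ₀ = (Jmat μ f β θ₀)⁻¹ := by
  have h1 : projMat (Jmat μ f β θ₀) (Hmat (0 : Vec p → Vec 0) θ₀) = 0 := by
    have : (Jmat μ f β θ₀)⁻¹ * Hmat (0 : Vec p → Vec 0) θ₀ *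
        ((Hmat (0 : Vec p → Vec 0) θ₀)ᵀ * (Jmat μ f β θ₀)⁻¹ * Hmat (0 : Vec p → Vec 0) θ₀)⁻¹ *
        (Hmat (0 : Vec p → Vec 0) θ₀)ᵀ = 0 := by
      ext i j
      simp [Matrix.mul_apply]
    rw [projMat, this, Matrix.zero_mul]
  rw [Pmat_eq, h1, sub_zero]

end Unrestricted

/-! ### Second order expansions -/

section Taylor

/-- The difference of `g` and its quadratic part has derivative of norm at most `κ ‖x - x₀‖` on the
ball through `x`; the mean value inequality concludes. -/
theorem eventually_abs_sub_le_of_contDiffAt {E : Type*} [NormedAddCommGroup E] [NormedSpace ℝ E]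
    {g : E → ℝ} {x₀ : E} (hg : ContDiffAt ℝ 2 g x₀) (h0 : g x₀ = 0) (h1 : fderiv ℝ g x₀ = 0)
    {κ : ℝ} (hκ : 0 < κ) :
    ∀ᶠ x in 𝓝 x₀, |g x - 1 / 2 * fderiv ℝ (fderiv ℝ g) x₀ (x - x₀) (x - x₀)| ≤
      κ * ‖x - x₀‖ ^ 2 := by
  set Q : E →L[ℝ] E →L[ℝ] ℝ := fderiv ℝ (fderiv ℝ g) x₀ with hQ
  have hsymm : ∀ v w, Q v w = Q w v := fun v w => hg.isSymmSndFDerivAt (by simp) v w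
  have hd : HasFDerivAt (fderiv ℝ g) Q x₀ :=
    ((hg.fderiv_right (m := 1) (by norm_num)).differentiableAt (by norm_num)).hasFDerivAt
  have h2 : ∀ᶠ x in 𝓝 x₀, ‖fderiv ℝ g x - Q (x - x₀)‖ ≤ κ * ‖x - x₀‖ := by
    have := (hasFDerivAt_iff_isLittleO.1 hd).def hκ
    simpa [h1] using this
  have h3 : ∀ᶠ x in 𝓝 x₀, DifferentiableAt ℝ g x :=
    (hg.eventually (by simp)).mono fun x hx => hx.differentiableAt (by norm_num)
  obtain ⟨δ, hδ, hball⟩ := Metric.mem_nhds_iff.1 (h2.and h3)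
  filter_upwards [Metric.ball_mem_nhds x₀ hδ] with x hx
  have hsub : Metric.closedBall x₀ ‖x - x₀‖ ⊆ Metric.ball x₀ δ :=
    Metric.closedBall_subset_ball (by simpa [dist_eq_norm] using hx)
  have hderiv : ∀ z ∈ Metric.closedBall x₀ ‖x - x₀‖,
      HasFDerivWithinAt (fun z => g z - 1 / 2 * Q (z - x₀) (z - x₀))
        (fderiv ℝ g z - Q (z - x₀)) (Metric.closedBall x₀ ‖x - x₀‖) z := by
    intro z hz
    have h4 : HasFDerivAt (fun z => z - x₀) (ContinuousLinearMap.id ℝ E) z :=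
      (hasFDerivAt_id z).sub_const x₀
    have h5 := ((Q.hasFDerivAt (x := z - x₀)).comp z h4).clm_apply h4
    have h6 := ((hball (hsub hz)).2.hasFDerivAt.sub (h5.const_mul (1 / 2))).hasFDerivWithinAt
      (s := Metric.closedBall x₀ ‖x - x₀‖)
    refine h6.congr_fderiv ?_
    ext v
    simp
    rw [hsymm v z, hsymm v x₀]
    ring
  have h7 := Convex.norm_image_sub_le_of_norm_hasFDerivWithin_le (𝕜 := ℝ) (C := κ * ‖x - x₀‖) hderiv
    (fun z hz => ((hball (hsub hz)).1).trans
      (by gcongr; simpa [dist_eq_norm] using hz)) (convex_closedBall x₀ ‖x - x₀‖)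
    (Metric.mem_closedBall_self (norm_nonneg _)) (y := x) (by simp [dist_eq_norm])
  simp only [h0, sub_self, map_zero, mul_zero, sub_zero] at h7
  rw [sq, ← mul_assoc]
  exact h7

theorem tendsto_div_sq_of_contDiffAt {E : Type*} [NormedAddCommGroup E] [NormedSpace ℝ E]
    {g : E → ℝ} {x₀ : E} (hg : ContDiffAt ℝ 2 g x₀) (h0 : g x₀ = 0) (h1 : fderiv ℝ g x₀ = 0)
    (v : E) : Tendsto (fun t : ℝ => g (x₀ + t • v) / t ^ 2) (𝓝[>] 0)
      (𝓝 (1 / 2 * fderiv ℝ (fderiv ℝ g) x₀ v v)) := by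
  rw [Metric.tendsto_nhds]
  intro η hη
  have hlim : Tendsto (fun t : ℝ => x₀ + t • v) (𝓝[>] 0) (𝓝 x₀) := by
    have : Continuous fun t : ℝ => x₀ + t • v := by fun_prop
    simpa using (this.tendsto 0).mono_left nhdsWithin_le_nhds
  have hκ : 0 < η / (2 * (‖v‖ ^ 2 + 1)) := by positivity
  filter_upwards [hlim.eventually (eventually_abs_sub_le_of_contDiffAt hg h0 h1 hκ), self_mem_nhdsWithin]
    with t ht ht0
  have ht0' : (0 : ℝ) < t := ht0
  rw [add_sub_cancel_left, norm_smul, map_smul, map_smul, _root_.smul_apply, smul_eq_mul,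
    smul_eq_mul] at ht
  rw [Real.dist_eq]
  have h2 : g (x₀ + t • v) / t ^ 2 - 1 / 2 * fderiv ℝ (fderiv ℝ g) x₀ v v =
      (g (x₀ + t • v) - 1 / 2 * (t * (t * fderiv ℝ (fderiv ℝ g) x₀ v v))) / t ^ 2 := by
    field_simp
  rw [h2, abs_div, abs_of_pos (pow_pos ht0' 2), div_lt_iff₀ (pow_pos ht0' 2)]
  refine ht.trans_lt ?_
  rw [mul_pow, Real.norm_eq_abs, sq_abs]
  have h3 : η / (2 * (‖v‖ ^ 2 + 1)) * ‖v‖ ^ 2 < η := by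
    rw [div_mul_eq_mul_div, div_lt_iff₀ (by positivity)]
    nlinarith [sq_nonneg ‖v‖]
  calc η / (2 * (‖v‖ ^ 2 + 1)) * (t ^ 2 * ‖v‖ ^ 2)
      = (η / (2 * (‖v‖ ^ 2 + 1)) * ‖v‖ ^ 2) * t ^ 2 := by ring
    _ < η * t ^ 2 := by gcongr

/-- Along `w + s v` the form is affine in `s`, as `Q v v = 0`; being nonnegative, it must have zero
slope. -/
theorem eq_zero_of_form_nonneg {E : Type*} [NormedAddCommGroup E] [NormedSpace ℝ E]
    {Q : E →L[ℝ] E →L[ℝ] ℝ} (hsymm : ∀ v w, Q v w = Q w v) (hnn : ∀ v, 0 ≤ Q v v) {v : E}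
    (hv : Q v v = 0) (w : E) : Q v w = 0 := by
  by_contra hne
  -- This multiple of `v` is chosen to make the form equal to `-1`.
  have h1 := hnn (w + (-(Q w w + 1) / (2 * Q v w)) • v)
  simp only [map_add, map_smul, _root_.add_apply, _root_.smul_apply, smul_eq_mul, hv,
    hsymm w v, mul_zero, add_zero] at h1
  have h2 : -(Q w w + 1) / (2 * Q v w) * Q v w = -(Q w w + 1) / 2 := by field_simp
  rw [h2] at h1
  linarith

end Taylor

/-! ### The `S`-divergence near the diagonal -/

section Kernel

variable {γ lam : ℝ}

theorem Aof_add_Bof (γ lam : ℝ) : Aof γ lam + Bof γ lam = 1 + γ := by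
  simp [Aof, Bof]

/-- The integrand of the `S`-divergence. -/
def sKer (γ lam g f : ℝ) : ℝ :=
  if Aof γ lam = 0 then
    f ^ (1 + γ) * Real.log (f / g) - (f ^ (1 + γ) - g ^ (1 + γ)) / (1 + γ)
  else if Bof γ lam = 0 then
    g ^ (1 + γ) * Real.log (g / f) - (g ^ (1 + γ) - f ^ (1 + γ)) / (1 + γ)
  else
    1 / Aof γ lam * f ^ (1 + γ) - (1 + γ) / (Aof γ lam * Bof γ lam) *
      (f ^ Bof γ lam * g ^ Aof γ lam) + 1 / Bof γ lam * g ^ (1 + γ)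

/-- The generator of the `S`-divergence, as a function of the log-likelihood ratio. -/
def sGen (γ lam l : ℝ) : ℝ :=
  if Aof γ lam = 0 then
    (Real.exp ((1 + γ) * l) - 1) / (1 + γ) - l
  else if Bof γ lam = 0 then
    Real.exp ((1 + γ) * l) * l - (Real.exp ((1 + γ) * l) - 1) / (1 + γ)
  else
    1 / Aof γ lam - (1 + γ) / (Aof γ lam * Bof γ lam) * Real.exp (Aof γ lam * l)
      + 1 / Bof γ lam * Real.exp ((1 + γ) * l)

/-- `(e^{b l} - 1) / b`. -/
def expQuot (b l : ℝ) : ℝ := if b = 0 then l else (Real.exp (b * l) - 1) / b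

theorem expQuot_nonneg {b l : ℝ} (hl : 0 ≤ l) : 0 ≤ expQuot b l := by
  unfold expQuot
  split_ifs with h
  · exact hl
  · rcases lt_or_gt_of_ne h with h' | h'
    · refine div_nonneg_of_nonpos ?_ h'.le
      have : b * l ≤ 0 := mul_nonpos_of_nonpos_of_nonneg h'.le hl
      linarith [Real.exp_le_one_iff.2 this]
    · refine div_nonneg ?_ h'.le
      have : 0 ≤ b * l := mul_nonneg h'.le hl
      linarith [Real.one_le_exp_iff.2 this]

theorem expQuot_neg (b l : ℝ) : expQuot b (-l) = -expQuot (-b) l := by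
  unfold expQuot
  split_ifs with h1 h2 h2
  · rfl
  · exact absurd (neg_eq_zero.2 h1) h2
  · exact absurd (neg_eq_zero.1 h2) h1
  · rw [mul_neg, ← neg_mul, div_neg, neg_neg]

theorem hasDerivAt_expQuot_zero (b : ℝ) : HasDerivAt (expQuot b) 1 0 := by
  by_cases h : b = 0
  · have : expQuot b = id := by funext l; simp [expQuot, h]
    rw [this]; exact hasDerivAt_id 0
  · have h1 : expQuot b = fun l => (Real.exp (b * l) - 1) / b := by funext l; simp [expQuot, h]
    rw [h1]
    have h2 := ((((hasDerivAt_id (0 : ℝ)).const_mul b).exp).sub_const 1).div_const b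
    simpa [h] using h2

/-- The three cases of the definition share this derivative, which has the sign of `l` for all
values of `A` and `B`. Nonnegativity and the expansion at `0` follow from it without further cases.
-/
theorem hasDerivAt_sGen (hγ : 0 ≤ γ) (l : ℝ) :
    HasDerivAt (sGen γ lam) ((1 + γ) * (Real.exp (Aof γ lam * l) * expQuot (Bof γ lam) l)) l := by
  have hAB := Aof_add_Bof γ lam
  have ha : 1 + γ ≠ 0 := by positivity
  have hexp : ∀ c : ℝ, HasDerivAt (fun l => Real.exp (c * l)) (Real.exp (c * l) * c) l := fun c => by
    simpa using ((hasDerivAt_id l).const_mul c).exp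
  by_cases hA : Aof γ lam = 0
  · have hB : Bof γ lam = 1 + γ := by linarith
    have h1 : sGen γ lam = fun l => (Real.exp ((1 + γ) * l) - 1) / (1 + γ) - l := by
      funext l; simp [sGen, hA]
    rw [h1]
    refine ((((hexp (1 + γ)).sub_const 1).div_const (1 + γ)).sub (hasDerivAt_id l)).congr_deriv ?_
    simp only [hA, hB, expQuot, ha, if_false, zero_mul, Real.exp_zero]
    field_simp
  · by_cases hB : Bof γ lam = 0
    · have hA' : Aof γ lam = 1 + γ := by linarith
      have h1 : sGen γ lam = fun l => Real.exp ((1 + γ) * l) * l -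
          (Real.exp ((1 + γ) * l) - 1) / (1 + γ) := by
        funext l; simp [sGen, hA, hB]
      rw [h1]
      refine (((hexp (1 + γ)).mul (hasDerivAt_id l)).sub
        (((hexp (1 + γ)).sub_const 1).div_const (1 + γ))).congr_deriv ?_
      simp only [hA', hB, expQuot, if_true, id_eq]
      field_simp
      ring
    · have h1 : sGen γ lam = fun l => 1 / Aof γ lam - (1 + γ) / (Aof γ lam * Bof γ lam) *
          Real.exp (Aof γ lam * l) + 1 / Bof γ lam * Real.exp ((1 + γ) * l) := by
        funext l; simp [sGen, hA, hB]
      rw [h1]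
      refine ((((hexp (Aof γ lam)).const_mul ((1 + γ) / (Aof γ lam * Bof γ lam))).const_sub
        (1 / Aof γ lam)).add ((hexp (1 + γ)).const_mul (1 / Bof γ lam))).congr_deriv ?_
      have h2 : Real.exp ((1 + γ) * l) = Real.exp (Aof γ lam * l) * Real.exp (Bof γ lam * l) := by
        rw [← Real.exp_add, ← hAB]; ring_nf
      simp only [expQuot, hB, if_false, h2]
      field_simp
      ring

theorem sGen_zero (hγ : 0 ≤ γ) : sGen γ lam 0 = 0 := by
  have hAB := Aof_add_Bof γ lam
  have ha : 1 + γ ≠ 0 := by positivity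
  unfold sGen
  split_ifs with hA hB
  · simp
  · simp
  · simp only [mul_zero, Real.exp_zero, mul_one]
    rw [← hAB]
    field_simp
    ring

theorem sGen_nonneg (hγ : 0 ≤ γ) (l : ℝ) : 0 ≤ sGen γ lam l := by
  have hd : Differentiable ℝ (sGen γ lam) := fun l => (hasDerivAt_sGen hγ l).differentiableAt
  rw [← sGen_zero (γ := γ) (lam := lam) hγ]
  rcases le_total 0 l with hl | hl
  · refine monotoneOn_of_deriv_nonneg (convex_Ici (0 : ℝ)) hd.continuous.continuousOn
      hd.differentiableOn (fun x hx => ?_) (Set.mem_Ici.2 le_rfl) hl hl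
    rw [interior_Ici] at hx
    rw [(hasDerivAt_sGen hγ x).deriv]
    have := expQuot_nonneg (b := Bof γ lam) (le_of_lt hx)
    positivity
  · refine antitoneOn_of_deriv_nonpos (convex_Iic (0 : ℝ)) hd.continuous.continuousOn
      hd.differentiableOn (fun x hx => ?_) hl (Set.mem_Iic.2 le_rfl) hl
    rw [interior_Iic] at hx
    rw [(hasDerivAt_sGen hγ x).deriv]
    have h1 := expQuot_nonneg (b := -Bof γ lam) (neg_nonneg.2 (le_of_lt hx))
    have h2 := expQuot_neg (-Bof γ lam) x
    rw [neg_neg] at h2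
    rw [h2] at h1
    have h3 : (1 + γ) * Real.exp (Aof γ lam * x) * expQuot (Bof γ lam) x ≤ 0 :=
      mul_nonpos_of_nonneg_of_nonpos (by positivity) (by linarith)
    linarith

/-- The generator is quadratic at zero. -/
theorem exists_sGen_eq_mul_sq (hγ : 0 ≤ γ) :
    ∃ m : ℝ → ℝ, ContinuousAt m 0 ∧ m 0 = (1 + γ) / 2 ∧ ∀ l, sGen γ lam l = m l * l ^ 2 := by
  refine ⟨fun l => if l = 0 then (1 + γ) / 2 else sGen γ lam l / l ^ 2, ?_, by simp, fun l => ?_⟩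
  swap
  · by_cases hl : l = 0
    · simp [hl, sGen_zero hγ]
    · simp only [hl, if_false]; field_simp
  have hd' : HasDerivAt (fun l => (1 + γ) * (Real.exp (Aof γ lam * l) * expQuot (Bof γ lam) l))
      (1 + γ) 0 := by
    have h1 : HasDerivAt (fun l => Real.exp (Aof γ lam * l)) (Aof γ lam) 0 := by
      simpa using ((hasDerivAt_id (0 : ℝ)).const_mul (Aof γ lam)).exp
    refine ((h1.mul (hasDerivAt_expQuot_zero (Bof γ lam))).const_mul (1 + γ)).congr_deriv ?_
    simp [expQuot]
  have h0 : (1 + γ) * (Real.exp (Aof γ lam * 0) * expQuot (Bof γ lam) 0) = 0 := by simp [expQuot]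
  rw [Metric.continuousAt_iff]
  intro η hη
  have h1 := (hasDerivAt_iff_isLittleO.1 hd').def (half_pos hη)
  obtain ⟨δ, hδ, hball⟩ := Metric.mem_nhds_iff.1 h1
  refine ⟨δ, hδ, fun {l} hl => ?_⟩
  by_cases hl0 : l = 0
  · simp [hl0, hη]
  have hsub : Metric.closedBall (0 : ℝ) |l| ⊆ Metric.ball 0 δ :=
    Metric.closedBall_subset_ball (by simpa [Real.dist_eq] using hl)
  -- The mean value inequality is applied to `sGen` minus its quadratic part, whose derivative is at
  -- most `η / 2 * |l|` on the ball of radius `|l|`.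
  have hder : ∀ z ∈ Metric.closedBall (0 : ℝ) |l|,
      HasDerivWithinAt (fun z => sGen γ lam z - (1 + γ) / 2 * z ^ 2)
        ((1 + γ) * (Real.exp (Aof γ lam * z) * expQuot (Bof γ lam) z) - z * (1 + γ))
        (Metric.closedBall (0 : ℝ) |l|) z := by
    intro z _
    refine (((hasDerivAt_sGen hγ z).sub ((hasDerivAt_pow 2 z).const_mul
      ((1 + γ) / 2))).congr_deriv ?_).hasDerivWithinAt
    simp only [Nat.cast_ofNat, Nat.add_one_sub_one, pow_one]
    ring
  have h2 := Convex.norm_image_sub_le_of_norm_hasDerivWithin_le (𝕜 := ℝ) (C := η / 2 * |l|) hder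
    (fun z hz => by
      have h3 := hball (hsub hz)
      simp only [h0, sub_zero, smul_eq_mul, Set.mem_ofPred_eq] at h3
      refine h3.trans ?_
      rw [Real.norm_eq_abs]
      exact mul_le_mul_of_nonneg_left (by simpa using hz) (by positivity))
    (convex_closedBall (0 : ℝ) |l|) (Metric.mem_closedBall_self (abs_nonneg _)) (y := l)
    (by simp)
  simp only [sGen_zero hγ, Real.norm_eq_abs] at h2
  have hl2 : 0 < l ^ 2 := by positivity
  have h4 : sGen γ lam l / l ^ 2 - (1 + γ) / 2 =
      (sGen γ lam l - (1 + γ) / 2 * l ^ 2) / l ^ 2 := by field_simp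
  simp only [hl0, if_false, if_true, Real.dist_eq]
  rw [h4, abs_div, abs_of_pos hl2, div_lt_iff₀ hl2]
  have h5 : |sGen γ lam l - (1 + γ) / 2 * l ^ 2| ≤ η / 2 * |l| * |l| := by simpa using h2
  rw [mul_assoc, abs_mul_abs_self, ← sq] at h5
  nlinarith

/-- By homogeneity and `A + B = 1 + γ`, the integrand is `f^{1+γ}` times a function of the
log-likelihood ratio alone. -/
theorem sKer_eq {g f : ℝ} (hg : 0 < g) (hf : 0 < f) :
    sKer γ lam g f = f ^ (1 + γ) * sGen γ lam (Real.log g - Real.log f) := by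
  have hAB := Aof_add_Bof γ lam
  have hpow : ∀ c : ℝ, Real.exp (c * (Real.log g - Real.log f)) = g ^ c * (f ^ c)⁻¹ := by
    intro c
    rw [mul_sub, Real.exp_sub, Real.rpow_def_of_pos hg, Real.rpow_def_of_pos hf, div_eq_mul_inv,
      mul_comm c, mul_comm c]
  have hf1 : f ^ (1 + γ) ≠ 0 := (Real.rpow_pos_of_pos hf _).ne'
  unfold sKer sGen
  split_ifs with hA hB
  · rw [hpow, Real.log_div hf.ne' hg.ne']
    field_simp
    ring
  · rw [hpow, Real.log_div hg.ne' hf.ne']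
    field_simp
  · have hfA : f ^ Aof γ lam ≠ 0 := (Real.rpow_pos_of_pos hf _).ne'
    have h1 : f ^ (1 + γ) = f ^ Aof γ lam * f ^ Bof γ lam := by rw [← Real.rpow_add hf, hAB]
    rw [hpow, hpow]
    have h2 : f ^ (1 + γ) * (1 / Aof γ lam - (1 + γ) / (Aof γ lam * Bof γ lam) *
        (g ^ Aof γ lam * (f ^ Aof γ lam)⁻¹) + 1 / Bof γ lam * (g ^ (1 + γ) * (f ^ (1 + γ))⁻¹)) =
        1 / Aof γ lam * f ^ (1 + γ) - (1 + γ) / (Aof γ lam * Bof γ lam) *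
          (f ^ (1 + γ) * (f ^ Aof γ lam)⁻¹ * g ^ Aof γ lam) +
          1 / Bof γ lam * g ^ (1 + γ) * (f ^ (1 + γ) * (f ^ (1 + γ))⁻¹) := by ring
    rw [h2, mul_inv_cancel₀ hf1, mul_one]
    congr 3
    rw [h1]
    field_simp

theorem sKer_zero (hγ : 0 ≤ γ) : sKer γ lam 0 0 = 0 := by
  have ha : 1 + γ ≠ 0 := by positivity
  unfold sKer
  split_ifs with hA hB
  · simp
  · simp
  -- The convention `0 ^ A = 0` for every nonzero `A`, even negative, makes the cross term vanish
  -- off the common support.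
  · simp [Real.zero_rpow ha, Real.zero_rpow hA]

end Kernel

/-! ### The Hessian of the divergence -/

section FatouZero

/-- If nonnegative functions converge almost everywhere and their integrals tend to zero, then the
limit vanishes almost everywhere. -/
theorem ae_eq_zero_of_tendsto_integral {X : Type*} [MeasurableSpace X] {μ : Measure X}
    {F : ℕ → X → ℝ} {G : X → ℝ} (hi : ∀ᶠ n in atTop, Integrable (F n) μ)
    (hnn : ∀ᶠ n in atTop, ∀ x, 0 ≤ F n x)
    (hlim : ∀ᵐ x ∂μ, Tendsto (fun n => F n x) atTop (𝓝 (G x)))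
    (h0 : Tendsto (fun n => ∫ x, F n x ∂μ) atTop (𝓝 0)) : G =ᵐ[μ] 0 := by
  -- The sequence is shifted by `N` so that the eventual hypotheses hold for every index in Fatou's
  -- lemma.
  obtain ⟨N, hN⟩ := eventually_atTop.1 (hi.and hnn)
  have h1 : ∫⁻ x, liminf (fun n => ENNReal.ofReal (F (n + N) x)) atTop ∂μ ≤ 0 := by
    refine (lintegral_liminf_le' fun n =>
      (hN (n + N) (by omega)).1.aestronglyMeasurable.aemeasurable.ennreal_ofReal).trans ?_
    have h2 : Tendsto (fun n => ∫⁻ x, ENNReal.ofReal (F (n + N) x) ∂μ) atTop (𝓝 0) := by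
      have h3 : Tendsto (fun n => ENNReal.ofReal (∫ x, F (n + N) x ∂μ)) atTop (𝓝 0) := by
        have := (ENNReal.continuous_ofReal.tendsto 0).comp
          (h0.comp (tendsto_add_atTop_nat N))
        rwa [ENNReal.ofReal_zero] at this
      refine h3.congr fun n => ?_
      exact ofReal_integral_eq_lintegral_ofReal (hN (n + N) (by omega)).1
        (ae_of_all _ (hN (n + N) (by omega)).2)
    rw [h2.liminf_eq]
  have h4 : ∫⁻ x, ENNReal.ofReal (G x) ∂μ = 0 := by
    refine le_antisymm (le_of_eq_of_le (lintegral_congr_ae ?_) h1) bot_le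
    filter_upwards [hlim] with x hx
    exact (((ENNReal.continuous_ofReal.tendsto _).comp
      (hx.comp (tendsto_add_atTop_nat N))).liminf_eq).symm
  have hGnn : ∀ᵐ x ∂μ, 0 ≤ G x := by
    filter_upwards [hlim] with x hx
    exact ge_of_tendsto hx (hnn.mono fun n hn => hn x)
  have hGm : AEMeasurable G μ := by
    refine aemeasurable_of_tendsto_metrizable_ae' (f := fun n => F (n + N))
      (fun n => (hN (n + N) (by omega)).1.aestronglyMeasurable.aemeasurable) ?_
    filter_upwards [hlim] with x hx
    exact hx.comp (tendsto_add_atTop_nat N)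
  rw [lintegral_eq_zero_iff' hGm.ennreal_ofReal] at h4
  filter_upwards [h4, hGnn] with x h5 h6
  exact le_antisymm (ENNReal.ofReal_eq_zero.1 h5) h6

end FatouZero

/-! ### Hessian of the divergence: dependence on the difference and positive definiteness. -/

section SDivExpansion

variable {X : Type*} [MeasurableSpace X] {μ : Measure X} {p : ℕ}
  {Θ ω : Set (Vec p)} {f : Vec p → X → ℝ} {θ₀ : Vec p} {β γ lam : ℝ}

theorem SDivFinite.integrable_sKer {g f : X → ℝ} (h : SDivFinite μ γ lam g f) :
    Integrable (fun x => sKer γ lam (g x) (f x)) μ := by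
  obtain ⟨h1, h2, h3⟩ := h
  unfold sKer
  split_ifs at h3 ⊢ with hA hB
  · exact h3.sub ((h1.sub h2).div_const _)
  · exact h3.sub ((h2.sub h1).div_const _)
  · exact ((h1.const_mul _).sub (h3.const_mul _)).add (h2.const_mul _)

theorem SDivFinite.sDiv_eq_integral {g f : X → ℝ} (h : SDivFinite μ γ lam g f) :
    SDiv μ γ lam g f = ∫ x, sKer γ lam (g x) (f x) ∂μ := by
  obtain ⟨h1, h2, h3⟩ := h
  unfold sKer SDiv
  split_ifs at h3 ⊢ with hA hB
  · have h4 : Integrable (fun x => (f x ^ (1 + γ) - g x ^ (1 + γ)) / (1 + γ)) μ :=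
      (h1.sub h2).div_const _
    rw [integral_sub h3 h4, integral_div, integral_sub h1 h2]
  · have h4 : Integrable (fun x => (g x ^ (1 + γ) - f x ^ (1 + γ)) / (1 + γ)) μ :=
      (h2.sub h1).div_const _
    rw [integral_sub h3 h4, integral_div, integral_sub h2 h1]
  · have h4 : Integrable (fun x => 1 / Aof γ lam * f x ^ (1 + γ) - (1 + γ) /
        (Aof γ lam * Bof γ lam) * (f x ^ Bof γ lam * g x ^ Aof γ lam)) μ :=
      (h1.const_mul _).sub (h3.const_mul _)
    rw [integral_add h4 (h2.const_mul _), integral_sub (h1.const_mul _) (h3.const_mul _),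
      integral_const_mul, integral_const_mul, integral_const_mul]

theorem sKer_nonneg (hB : BasuConditions μ Θ ω f β θ₀) (hf : IsDensityFamily μ Θ f) (hγ : 0 ≤ γ)
    {θ θ' : Vec p} (hθ : θ ∈ Θ) (hθ' : θ' ∈ Θ) (x : X) :
    0 ≤ sKer γ lam (f θ x) (f θ' x) := by
  by_cases h : 0 < f θ₀ x
  · have h1 := (hB.common_support θ hθ x).2 h
    have h2 := (hB.common_support θ' hθ' x).2 h
    rw [sKer_eq h1 h2]
    exact mul_nonneg (by positivity) (sGen_nonneg hγ _)
  · have h1 : f θ x = 0 := le_antisymm (not_lt.1 fun h' => h ((hB.common_support θ hθ x).1 h'))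
      (hf.nonneg θ hθ x)
    have h2 : f θ' x = 0 := le_antisymm
      (not_lt.1 fun h' => h ((hB.common_support θ' hθ' x).1 h')) (hf.nonneg θ' hθ' x)
    rw [h1, h2, sKer_zero hγ]

theorem sKer_self (hγ : 0 ≤ γ) {a : ℝ} (ha : 0 ≤ a) : sKer γ lam a a = 0 := by
  rcases ha.eq_or_lt with h | h
  · rw [← h, sKer_zero hγ]
  · rw [sKer_eq h h, sub_self, sGen_zero hγ, mul_zero]

theorem BasuConditions.mem_nhds (hB : BasuConditions μ Θ ω f β θ₀) : Θ ∈ 𝓝 θ₀ :=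
  mem_of_superset (hB.isOpen.mem_nhds hB.mem) hB.subset

theorem SDivRegular.eventually_nonneg (hS : SDivRegular μ f γ lam θ₀)
    (hB : BasuConditions μ Θ ω f β θ₀) (hf : IsDensityFamily μ Θ f) (hγ : 0 ≤ γ) :
    ∀ᶠ q : Vec p × Vec p in 𝓝 (θ₀, θ₀), 0 ≤ SDiv μ γ lam (f q.1) (f q.2) := by
  filter_upwards [hS.1, prod_mem_nhds hB.mem_nhds hB.mem_nhds] with q hq hΘ
  rw [hq.sDiv_eq_integral]
  exact integral_nonneg fun x => sKer_nonneg hB hf hγ hΘ.1 hΘ.2 x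

theorem SDivRegular.eventually_diag (hS : SDivRegular μ f γ lam θ₀)
    (hB : BasuConditions μ Θ ω f β θ₀) (hf : IsDensityFamily μ Θ f) (hγ : 0 ≤ γ) :
    ∀ᶠ θ in 𝓝 θ₀, SDiv μ γ lam (f θ) (f θ) = 0 := by
  have hc : Tendsto (fun θ : Vec p => (θ, θ)) (𝓝 θ₀) (𝓝 (θ₀, θ₀)) :=
    (continuous_id.prodMk continuous_id).tendsto θ₀
  filter_upwards [hc.eventually hS.1, hB.mem_nhds] with θ hθ hΘ
  rw [hθ.sDiv_eq_integral]
  simp [sKer_self hγ (hf.nonneg θ hΘ _)]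

/-- The second derivative of the divergence on the diagonal. -/
def sHess (μ : Measure X) (f : Vec p → X → ℝ) (γ lam : ℝ) (θ₀ : Vec p) :
    (Vec p × Vec p) →L[ℝ] (Vec p × Vec p) →L[ℝ] ℝ :=
  fderiv ℝ (fderiv ℝ fun q : Vec p × Vec p => SDiv μ γ lam (f q.1) (f q.2)) (θ₀, θ₀)

theorem SDivRegular.sHess_comm (hS : SDivRegular μ f γ lam θ₀) (v w : Vec p × Vec p) :
    sHess μ f γ lam θ₀ v w = sHess μ f γ lam θ₀ w v :=
  hS.2.isSymmSndFDerivAt (by simp) v w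

/-- The divergence is locally nonnegative and vanishes at `(θ₀, θ₀)`, which is thus a local minimum.
-/
theorem SDivRegular.fderiv_eq_zero (hS : SDivRegular μ f γ lam θ₀)
    (hB : BasuConditions μ Θ ω f β θ₀) (hf : IsDensityFamily μ Θ f) (hγ : 0 ≤ γ) :
    fderiv ℝ (fun q : Vec p × Vec p => SDiv μ γ lam (f q.1) (f q.2)) (θ₀, θ₀) = 0 := by
  refine IsLocalMin.fderiv_eq_zero ?_
  filter_upwards [hS.eventually_nonneg hB hf hγ] with q hq
  simpa [(hS.eventually_diag hB hf hγ).self_of_nhds] using hq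

theorem SDivRegular.tendsto_div_sq (hS : SDivRegular μ f γ lam θ₀)
    (hB : BasuConditions μ Θ ω f β θ₀) (hf : IsDensityFamily μ Θ f) (hγ : 0 ≤ γ)
    (v : Vec p × Vec p) :
    Tendsto (fun t : ℝ => SDiv μ γ lam (f (θ₀ + t • v.1)) (f (θ₀ + t • v.2)) / t ^ 2) (𝓝[>] 0)
      (𝓝 (1 / 2 * sHess μ f γ lam θ₀ v v)) :=
  tendsto_div_sq_of_contDiffAt hS.2 (hS.eventually_diag hB hf hγ).self_of_nhds
    (hS.fderiv_eq_zero hB hf hγ) v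

theorem tendsto_add_smul_nhdsGT (v : Vec p) :
    Tendsto (fun t : ℝ => θ₀ + t • v) (𝓝[>] 0) (𝓝 θ₀) := by
  have : Continuous fun t : ℝ => θ₀ + t • v := by fun_prop
  simpa using (this.tendsto 0).mono_left nhdsWithin_le_nhds

theorem SDivRegular.sHess_nonneg (hS : SDivRegular μ f γ lam θ₀)
    (hB : BasuConditions μ Θ ω f β θ₀) (hf : IsDensityFamily μ Θ f) (hγ : 0 ≤ γ)
    (v : Vec p × Vec p) : 0 ≤ sHess μ f γ lam θ₀ v v := by
  have h1 := ((tendsto_add_smul_nhdsGT (θ₀ := θ₀) v.1).prodMk_nhds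
    (tendsto_add_smul_nhdsGT v.2)).eventually (hS.eventually_nonneg hB hf hγ)
  have h2 := ge_of_tendsto (hS.tendsto_div_sq hB hf hγ v)
    (h1.mono fun t ht => div_nonneg ht (sq_nonneg t))
  linarith

/-- The divergence vanishes along the diagonal, so `(d, d)` is a null vector of the form; for a
nonnegative symmetric form such a vector is in the kernel. -/
theorem SDivRegular.sHess_diag (hS : SDivRegular μ f γ lam θ₀)
    (hB : BasuConditions μ Θ ω f β θ₀) (hf : IsDensityFamily μ Θ f) (hγ : 0 ≤ γ)
    (d : Vec p) (w : Vec p × Vec p) : sHess μ f γ lam θ₀ (d, d) w = 0 := by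
  refine eq_zero_of_form_nonneg hS.sHess_comm (hS.sHess_nonneg hB hf hγ) ?_ w
  have h1 : Tendsto (fun t : ℝ => SDiv μ γ lam (f (θ₀ + t • d)) (f (θ₀ + t • d)) / t ^ 2) (𝓝[>] 0)
      (𝓝 0) := by
    refine tendsto_const_nhds.congr' ?_
    filter_upwards [(tendsto_add_smul_nhdsGT d).eventually (hS.eventually_diag hB hf hγ)] with t ht
    simp [ht]
  have := tendsto_nhds_unique (hS.tendsto_div_sq hB hf hγ (d, d)) h1
  linarith

/-- The vector splits into the diagonal vector `(v.2, v.2)`, which lies in the kernel, and `(v.1 -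
v.2, 0)`. -/
theorem SDivRegular.sHess_eq (hS : SDivRegular μ f γ lam θ₀)
    (hB : BasuConditions μ Θ ω f β θ₀) (hf : IsDensityFamily μ Θ f) (hγ : 0 ≤ γ)
    (v : Vec p × Vec p) :
    sHess μ f γ lam θ₀ v v = sHess μ f γ lam θ₀ (v.1 - v.2, 0) (v.1 - v.2, 0) := by
  have h1 : v = (v.2, v.2) + (v.1 - v.2, 0) := by ext <;> simp
  conv_lhs => rw [h1]
  rw [map_add, map_add, _root_.add_apply, _root_.add_apply, hS.sHess_diag hB hf hγ,
    hS.sHess_diag hB hf hγ, hS.sHess_comm _ (v.2, v.2), hS.sHess_diag hB hf hγ]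
  ring

theorem SDivRegular.Amat_apply (hS : SDivRegular μ f γ lam θ₀) (j k : Fin p) :
    Amat μ f γ lam θ₀ j k = sHess μ f γ lam θ₀ (coordVec j, 0) (coordVec k, 0) := by
  rw [Amat, of_apply, iteratedFDeriv_two_apply]
  set g : Vec p × Vec p → ℝ := fun q => SDiv μ γ lam (f q.1) (f q.2) with hg
  have hinl : ∀ θ : Vec p, HasFDerivAt (fun θ : Vec p => (θ, θ₀))
      (ContinuousLinearMap.inl ℝ (Vec p) (Vec p)) θ := fun θ => hasFDerivAt_prodMk_left θ θ₀
  have hd : ∀ᶠ θ in 𝓝 θ₀, fderiv ℝ (fun θ => SDiv μ γ lam (f θ) (f θ₀)) θ =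
      (fderiv ℝ g (θ, θ₀)).comp (ContinuousLinearMap.inl ℝ (Vec p) (Vec p)) := by
    have h1 : ∀ᶠ q in 𝓝 (θ₀, θ₀), DifferentiableAt ℝ g q :=
      (hS.2.eventually (by simp)).mono fun x hx => hx.differentiableAt (by norm_num)
    filter_upwards [(hinl θ₀).continuousAt.eventually h1] with θ hθ
    exact (hθ.hasFDerivAt.comp θ (hinl θ)).fderiv
  have h2 : HasFDerivAt (fderiv ℝ g) (sHess μ f γ lam θ₀) (θ₀, θ₀) :=
    ((hS.2.fderiv_right (m := 1) (by norm_num)).differentiableAt (by norm_num)).hasFDerivAt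
  have h3 : HasFDerivAt (fun θ => fderiv ℝ g (θ, θ₀))
      ((sHess μ f γ lam θ₀).comp (ContinuousLinearMap.inl ℝ (Vec p) (Vec p))) θ₀ :=
    HasFDerivAt.comp (g := fderiv ℝ g) θ₀ h2 (hinl θ₀)
  have h4 := h3.clm_comp (hasFDerivAt_const (ContinuousLinearMap.inl ℝ (Vec p) (Vec p)) θ₀)
  rw [Filter.EventuallyEq.fderiv_eq hd, h4.fderiv]
  simp

theorem sum_coordVec (d : Vec p) : ∑ j, d j • coordVec j = d := by
  ext i
  simp [coordVec, Finset.sum_apply, Pi.single_apply]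

theorem SDivRegular.dotProduct_Amat_mulVec (hS : SDivRegular μ f γ lam θ₀) (d : Vec p) :
    d.ofLp ⬝ᵥ Amat μ f γ lam θ₀ *ᵥ d.ofLp = sHess μ f γ lam θ₀ (d, 0) (d, 0) := by
  have h1 : ((d, 0) : Vec p × Vec p) = ∑ j, d j • (coordVec j, 0) := by
    conv_lhs => rw [← sum_coordVec d]
    rw [Prod.ext_iff]
    simp [Prod.fst_sum, Prod.snd_sum]
  rw [h1]
  simp only [map_sum, map_smul, _root_.sum_apply, _root_.smul_apply, smul_eq_mul,
    ← hS.Amat_apply, dotProduct, mulVec]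
  refine Finset.sum_congr rfl fun j _ => ?_
  congr 1
  refine Finset.sum_congr rfl fun k _ => ?_
  rw [hS.Amat_apply, hS.Amat_apply, hS.sHess_comm, mul_comm]

/-- If the form vanishes at `(d, 0)`, then `S(f_{θ₀+td}, f_{θ₀}) / t² → 0`. The integrands, divided
by `t²`, are nonnegative and converge to `f^{1+γ} (1+γ)/2 ⟪u, d⟫²`, so by Fatou this limit is zero
almost everywhere and the Fisher information forces `d = 0`. No second derivative has to be taken
under the integral. -/
theorem SDivRegular.eq_zero_of_sHess_eq_zero (hS : SDivRegular μ f γ lam θ₀)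
    (hL : LehmannConditions μ Θ ω f θ₀)
    (hB : BasuConditions μ Θ ω f β θ₀) (hf : IsDensityFamily μ Θ f) (hγ : 0 ≤ γ) {d : Vec p}
    (hd : sHess μ f γ lam θ₀ (d, 0) (d, 0) = 0) : d = 0 := by
  obtain ⟨m, hm, hm0, hsm⟩ := exists_sGen_eq_mul_sq (γ := γ) (lam := lam) hγ
  -- A positive sequence tending to zero, since Fatou's lemma is applied along a sequence.
  set t : ℕ → ℝ := fun n => 1 / ((n : ℝ) + 1) with ht
  have htpos : ∀ n, 0 < t n := fun n => by positivity
  have htlim : Tendsto t atTop (𝓝[>] 0) :=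
    tendsto_nhdsWithin_iff.2 ⟨tendsto_one_div_add_atTop_nhds_zero_nat,
      Eventually.of_forall htpos⟩
  have hθ : Tendsto (fun n => θ₀ + t n • d) atTop (𝓝 θ₀) :=
    (tendsto_add_smul_nhdsGT d).comp htlim
  have hfin : ∀ᶠ n in atTop, SDivFinite μ γ lam (f (θ₀ + t n • d)) (f θ₀) :=
    (hθ.prodMk_nhds tendsto_const_nhds).eventually hS.1
  have hΘ₀ := hB.subset hB.mem
  have hG := ae_eq_zero_of_tendsto_integral (μ := μ)
    (F := fun n x => sKer γ lam (f (θ₀ + t n • d) x) (f θ₀ x) / t n ^ 2)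
    (G := fun x => f θ₀ x ^ (1 + γ) * ((1 + γ) / 2 * inner ℝ (score f θ₀ x) d ^ 2))
    (hfin.mono fun n hn => hn.integrable_sKer.div_const _)
    ((hθ.eventually hB.mem_nhds).mono fun n hn x =>
      div_nonneg (sKer_nonneg hB hf hγ hn hΘ₀ x) (sq_nonneg _)) ?_ ?_
  · refine hL.eq_zero_of_ae_inner_score hf ((ae_modelMeasure hf hΘ₀).2 ?_)
    filter_upwards [hG] with x hx hpos
    have h1 : f θ₀ x ^ (1 + γ) ≠ 0 := (Real.rpow_pos_of_pos hpos _).ne'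
    have h2 : (1 + γ) / 2 ≠ 0 := by positivity
    simpa [h1, h2] using hx
  · filter_upwards [hB.ae_posSmoothOn hf] with x hx
    rcases hx with h0 | hpos
    · refine (tendsto_const_nhds (x := (0 : ℝ))).congr' ?_ |>.trans (by
        rw [h0 _ hB.mem, Real.zero_rpow (by positivity), zero_mul])
      filter_upwards [hθ.eventually (hB.isOpen.mem_nhds hB.mem)] with n hn
      rw [h0 _ hn, h0 _ hB.mem, sKer_zero hγ, zero_div]
    · have hlog := hpos.hasFDerivAt_log hB.isOpen hB.mem
      have h1 : Tendsto (fun n => Real.log (f (θ₀ + t n • d) x) - Real.log (f θ₀ x)) atTop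
          (𝓝 0) := by
        have := (hlog.continuousAt.tendsto.comp hθ).sub_const (Real.log (f θ₀ x))
        simpa using this
      have h2 : Tendsto (fun n => (Real.log (f (θ₀ + t n • d) x) - Real.log (f θ₀ x)) / t n) atTop
          (𝓝 (inner ℝ (score f θ₀ x) d)) := by
        have h3 := (hlog.hasLineDerivAt d).tendsto_slope_zero_right.comp htlim
        rw [← innerSL_score] at h3
        refine h3.congr fun n => ?_
        simp [div_eq_inv_mul]
      have h4 := (hm.tendsto.comp h1).mul (h2.pow 2)
      rw [hm0] at h4
      refine (h4.const_mul (f θ₀ x ^ (1 + γ))).congr' ?_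
      filter_upwards [hθ.eventually (hB.isOpen.mem_nhds hB.mem)] with n hn
      rw [sKer_eq (hpos.pos _ hn) (hpos.pos _ hB.mem), hsm, Function.comp_apply, div_pow]
      ring
  · have h1 := (hS.tendsto_div_sq hB hf hγ (d, 0)).comp htlim
    rw [hd, mul_zero] at h1
    refine h1.congr' ?_
    filter_upwards [hfin] with n hn
    rw [integral_div, ← hn.sDiv_eq_integral]
    simp

theorem SDivRegular.posDef_Amat (hS : SDivRegular μ f γ lam θ₀)
    (hL : LehmannConditions μ Θ ω f θ₀)
    (hB : BasuConditions μ Θ ω f β θ₀) (hf : IsDensityFamily μ Θ f) (hγ : 0 ≤ γ) :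
    (Amat μ f γ lam θ₀).PosDef := by
  refine PosDef.of_dotProduct_mulVec_pos ?_ fun z hz => ?_
  · ext j k
    simp [hS.Amat_apply, hS.sHess_comm (coordVec k, 0)]
  · have h1 := hS.dotProduct_Amat_mulVec (WithLp.toLp 2 z)
    rw [star_trivial]
    refine lt_of_le_of_ne ((hS.sHess_nonneg hB hf hγ _).trans_eq h1.symm) fun h2 => hz ?_
    have h3 := hS.eq_zero_of_sHess_eq_zero hL hB hf hγ (d := WithLp.toLp 2 z)
      (h1.symm.trans h2.symm)
    simpa using h3

/-- The divergence is a quadratic form in the difference of the parameters, up to second order. -/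
theorem SDivRegular.eventually_abs_sub_le (hS : SDivRegular μ f γ lam θ₀)
    (hB : BasuConditions μ Θ ω f β θ₀) (hf : IsDensityFamily μ Θ f) (hγ : 0 ≤ γ) {κ : ℝ}
    (hκ : 0 < κ) :
    ∀ᶠ q : Vec p × Vec p in 𝓝 (θ₀, θ₀), |SDiv μ γ lam (f q.1) (f q.2) -
      1 / 2 * ((q.1 - q.2).ofLp ⬝ᵥ Amat μ f γ lam θ₀ *ᵥ (q.1 - q.2).ofLp)| ≤
        κ * (‖q.1 - θ₀‖ + ‖q.2 - θ₀‖) ^ 2 := by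
  filter_upwards [eventually_abs_sub_le_of_contDiffAt hS.2
    (hS.eventually_diag hB hf hγ).self_of_nhds (hS.fderiv_eq_zero hB hf hγ) hκ] with q hq
  have h1 := hS.sHess_eq hB hf hγ (q - (θ₀, θ₀))
  have h2 : (q - (θ₀, θ₀)).1 - (q - (θ₀, θ₀)).2 = q.1 - q.2 := by simp
  rw [h2, ← hS.dotProduct_Amat_mulVec] at h1
  rw [← h1]
  refine hq.trans ?_
  have h3 : ‖q - (θ₀, θ₀)‖ ≤ ‖q.1 - θ₀‖ + ‖q.2 - θ₀‖ :=
    max_le (le_add_of_nonneg_right (norm_nonneg _)) (le_add_of_nonneg_left (norm_nonneg _))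
  gcongr

end SDivExpansion

/-! ### Asymptotically equivalent statistics -/

section Slutsky

variable {X : Type*} [MeasurableSpace X] {E : Type*} [NormedAddCommGroup E] [MeasurableSpace E]
  [BorelSpace E]

/-- The event `t < T n` is squeezed between events in `W n` alone, with `g` perturbed by `∓ c ‖w‖²`.
The portmanteau theorem applies to these, and `c ↓ 0` afterwards. Bounding the error by `‖W n‖²`
makes a tightness argument unnecessary, and `T n` need not be measurable. -/
theorem tendsto_sampleLaw_lt {Q : ℕ → Measure X} {W : (n : ℕ) → (Fin n → X) → E}
    {T : (n : ℕ) → (Fin n → X) → ℝ} {g : E → ℝ} (hg : Continuous g)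
    {ν : ℕ → ProbabilityMeasure E} {ν' : ProbabilityMeasure E} (hν : Tendsto ν atTop (𝓝 ν'))
    (hW : ∀ᶠ n in atTop, AEMeasurable (W n) (sampleLaw Q n) ∧
      (ν n : Measure E) = (sampleLaw Q n).map (W n))
    (hT : ∀ κ > 0, Whp Q fun n x => |T n x - g (W n x)| ≤ κ * ‖W n x‖ ^ 2) {t : ℝ}
    (ht : (ν' : Measure E) {w | g w = t} = 0) :
    Tendsto (fun n => (sampleLaw Q n).real {x | t < T n x}) atTop
      (𝓝 ((ν' : Measure E).real {w | t < g w})) := by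
  have hcont : ∀ c : ℝ, Continuous fun w => g w + c * ‖w‖ ^ 2 := fun c => by fun_prop
  have hmap : ∀ s : Set E, MeasurableSet s → ∀ᶠ n in atTop,
      (ν n : Measure E) s = sampleLaw Q n {x | W n x ∈ s} := fun s hs => by
    filter_upwards [hW] with n hn
    rw [hn.2, Measure.map_apply_of_aemeasurable hn.1 hs]
    rfl
  set c : ℕ → ℝ := fun m => 1 / ((m : ℝ) + 1) with hc
  have hcpos : ∀ m, 0 < c m := fun m => by positivity
  have hcanti : Antitone c := fun a b hab => one_div_le_one_div_of_le (by positivity) (by gcongr)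
  have hclim : Tendsto c atTop (𝓝 0) := tendsto_one_div_add_atTop_nhds_zero_nat
  have hlow : ∀ m, (ν' : Measure E) {w | t < g w + -c m * ‖w‖ ^ 2} ≤
      liminf (fun n => sampleLaw Q n {x | t < T n x}) atTop := fun m => by
    have ho : IsOpen {w | t < g w + -c m * ‖w‖ ^ 2} := isOpen_lt continuous_const (hcont _)
    refine (ProbabilityMeasure.le_liminf_measure_open_of_tendsto hν ho).trans ?_
    -- The exceptional event has probability tending to zero, so adding it does not change the lower
    -- limit.
    rw [← ENNReal.liminf_add_of_right_tendsto_zero (hT (c m) (hcpos m))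
      (fun n => sampleLaw Q n {x | t < T n x})]
    refine liminf_le_liminf ?_
    filter_upwards [hmap _ ho.measurableSet] with n hn
    rw [Pi.add_apply, hn]
    refine (measure_mono fun x hx => ?_).trans (measure_union_le _ _)
    by_cases hq : |T n x - g (W n x)| ≤ c m * ‖W n x‖ ^ 2
    · left
      have hx' : t < g (W n x) + -c m * ‖W n x‖ ^ 2 := hx
      have := (abs_le.1 hq).1
      exact show t < T n x by linarith
    · exact Or.inr hq
  have hupp : ∀ m, limsup (fun n => sampleLaw Q n {x | t < T n x}) atTop ≤
      (ν' : Measure E) {w | t ≤ g w + c m * ‖w‖ ^ 2} := fun m => by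
    have ho : IsClosed {w | t ≤ g w + c m * ‖w‖ ^ 2} := isClosed_le continuous_const (hcont _)
    refine le_trans ?_ (ProbabilityMeasure.limsup_measure_closed_le_of_tendsto hν ho)
    rw [← ENNReal.limsup_add_of_right_tendsto_zero (hT (c m) (hcpos m))
      (fun n => (ν n : Measure E) _)]
    refine limsup_le_limsup ?_
    filter_upwards [hmap _ ho.measurableSet] with n hn
    rw [Pi.add_apply, hn]
    refine (measure_mono fun x hx => ?_).trans (measure_union_le _ _)
    by_cases hq : |T n x - g (W n x)| ≤ c m * ‖W n x‖ ^ 2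
    · left
      have hx' : t < T n x := hx
      have := (abs_le.1 hq).2
      exact show t ≤ g (W n x) + c m * ‖W n x‖ ^ 2 by linarith
    · exact Or.inr hq
  have hlim : ∀ w : E, Tendsto (fun m => c m * ‖w‖ ^ 2) atTop (𝓝 0) := fun w => by
    simpa using hclim.mul_const (‖w‖ ^ 2)
  have h1 : Tendsto (fun m => (ν' : Measure E) {w | t < g w + -c m * ‖w‖ ^ 2}) atTop
      (𝓝 ((ν' : Measure E) {w | t < g w})) := by
    have hU : {w | t < g w} = ⋃ m, {w | t < g w + -c m * ‖w‖ ^ 2} := by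
      ext w
      simp only [Set.mem_ofPred_eq, Set.mem_iUnion]
      refine ⟨fun h => ?_, fun ⟨m, hm⟩ => ?_⟩
      · obtain ⟨m, hm⟩ := ((hlim w).eventually_lt_const (sub_pos.2 h)).exists
        exact ⟨m, by linarith⟩
      · have := mul_nonneg (hcpos m).le (sq_nonneg ‖w‖)
        linarith
    rw [hU]
    refine tendsto_measure_iUnion_atTop fun a b hab w hw => ?_
    have hw' : t < g w + -c a * ‖w‖ ^ 2 := hw
    have := mul_le_mul_of_nonneg_right (hcanti hab) (sq_nonneg ‖w‖)
    exact show t < g w + -c b * ‖w‖ ^ 2 by linarith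
  have h2 : Tendsto (fun m => (ν' : Measure E) {w | t ≤ g w + c m * ‖w‖ ^ 2}) atTop
      (𝓝 ((ν' : Measure E) {w | t ≤ g w})) := by
    have hU : {w | t ≤ g w} = ⋂ m, {w | t ≤ g w + c m * ‖w‖ ^ 2} := by
      ext w
      simp only [Set.mem_ofPred_eq, Set.mem_iInter]
      refine ⟨fun h m => ?_, fun h => ?_⟩
      · have := mul_nonneg (hcpos m).le (sq_nonneg ‖w‖)
        linarith
      · have := ge_of_tendsto' ((hlim w).const_add (g w)) h
        linarith
    rw [hU]
    refine tendsto_measure_iInter_atTop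
      (fun m => (isClosed_le continuous_const (hcont _)).measurableSet.nullMeasurableSet)
      (fun a b hab w hw => ?_) ⟨0, measure_ne_top _ _⟩
    have hw' : t ≤ g w + c b * ‖w‖ ^ 2 := hw
    have := mul_le_mul_of_nonneg_right (hcanti hab) (sq_nonneg ‖w‖)
    exact show t ≤ g w + c a * ‖w‖ ^ 2 by linarith
  -- The open and closed bounds differ by the level set `g = t`, which is null.
  have h3 : (ν' : Measure E) {w | t ≤ g w} ≤ (ν' : Measure E) {w | t < g w} := by
    have hsub : {w | t ≤ g w} ⊆ {w | t < g w} ∪ {w | g w = t} := fun w hw => by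
      rcases lt_or_eq_of_le (show t ≤ g w from hw) with h | h
      · exact Or.inl h
      · exact Or.inr h.symm
    refine (measure_mono hsub).trans ((measure_union_le _ _).trans ?_)
    rw [ht, add_zero]
  have h4 : Tendsto (fun n => sampleLaw Q n {x | t < T n x}) atTop
      (𝓝 ((ν' : Measure E) {w | t < g w})) :=
    tendsto_of_le_liminf_of_limsup_le (le_of_tendsto' h1 hlow)
      ((ge_of_tendsto' h2 hupp).trans h3)
  exact (ENNReal.tendsto_toReal (measure_ne_top _ _)).comp h4

end Slutsky

/-! ### Perturbation of quadratic forms. -/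

section QuadForm

variable {p : ℕ}

theorem dotProduct_mulVec_eq_inner (A : Matrix (Fin p) (Fin p) ℝ) (w : Vec p) :
    w.ofLp ⬝ᵥ A *ᵥ w.ofLp = inner ℝ w (toEuclideanCLM (𝕜 := ℝ) A w) := by
  rw [EuclideanSpace.inner_eq_star_dotProduct, ofLp_toEuclideanCLM, star_trivial, dotProduct_comm]

theorem abs_quadForm_sub_le (A : Matrix (Fin p) (Fin p) ℝ) (u w : Vec p) :
    |u.ofLp ⬝ᵥ A *ᵥ u.ofLp - w.ofLp ⬝ᵥ A *ᵥ w.ofLp| ≤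
      ‖toEuclideanCLM (𝕜 := ℝ) A‖ * (‖u - w‖ * (‖u‖ + ‖w‖)) := by
  rw [dotProduct_mulVec_eq_inner, dotProduct_mulVec_eq_inner]
  set L := toEuclideanCLM (𝕜 := ℝ) A
  have h1 : inner ℝ u (L u) - inner ℝ w (L w) = inner ℝ (u - w) (L u) + inner ℝ w (L (u - w)) := by
    rw [map_sub, inner_sub_left, inner_sub_right]
    ring
  rw [h1]
  calc |inner ℝ (u - w) (L u) + inner ℝ w (L (u - w))|
      ≤ ‖u - w‖ * ‖L u‖ + ‖w‖ * ‖L (u - w)‖ := (abs_add_le _ _).trans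
        (add_le_add (abs_real_inner_le_norm _ _) (abs_real_inner_le_norm _ _))
    _ ≤ ‖u - w‖ * (‖L‖ * ‖u‖) + ‖w‖ * (‖L‖ * ‖u - w‖) := by
        gcongr <;> exact L.le_opNorm _
    _ = _ := by ring

theorem quadForm_smul (A : Matrix (Fin p) (Fin p) ℝ) (c : ℝ) (w : Vec p) :
    (c • w).ofLp ⬝ᵥ A *ᵥ (c • w).ofLp = c ^ 2 * (w.ofLp ⬝ᵥ A *ᵥ w.ofLp) := by
  rw [WithLp.ofLp_smul, mulVec_smul, dotProduct_smul, smul_dotProduct, smul_eq_mul, smul_eq_mul]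
  ring

theorem continuous_quadForm (A : Matrix (Fin p) (Fin p) ℝ) :
    Continuous fun w : Vec p => w.ofLp ⬝ᵥ A *ᵥ w.ofLp := by
  simp_rw [dotProduct_mulVec_eq_inner]
  fun_prop

/-- Here `a` and `b` stand for the two estimation errors, `Ψ` for the mean score and `s` for the
divergence. The lemma combines the errors of both root expansions with that of the quadratic
approximation. -/
theorem exists_quadForm_error (A : Matrix (Fin p) (Fin p) ℝ) (G P K : Vec p →L[ℝ] Vec p)
    (hK : ∀ w, K w = G w - P w) {κ : ℝ} (hκ : 0 < κ) :
    ∃ κ' > 0, ∃ κ₁ > 0, ∀ (a b Ψ : Vec p) (s : ℝ), ‖a - G Ψ‖ ≤ κ' * ‖Ψ‖ → ‖b - P Ψ‖ ≤ κ' * ‖Ψ‖ →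
      |s - 1 / 2 * ((a - b).ofLp ⬝ᵥ A *ᵥ (a - b).ofLp)| ≤ κ₁ * (‖a‖ + ‖b‖) ^ 2 →
      |2 * s - (K Ψ).ofLp ⬝ᵥ A *ᵥ (K Ψ).ofLp| ≤ κ * ‖Ψ‖ ^ 2 := by
  obtain ⟨c, hc⟩ : ∃ c, c = ‖toEuclideanCLM (𝕜 := ℝ) A‖ := ⟨_, rfl⟩
  obtain ⟨L, hL⟩ : ∃ L, L = ‖G‖ + ‖P‖ + 2 := ⟨_, rfl⟩
  have hc0 : 0 ≤ c := hc ▸ norm_nonneg _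
  have hG0 := norm_nonneg G
  have hP0 := norm_nonneg P
  have hK0 := norm_nonneg K
  have hLpos : 0 < L := by linarith
  have hden : 0 < 8 * ((c + 1) * (‖K‖ + 1)) := by positivity
  obtain ⟨κ', hκ'0, hκ'1, hκ'2⟩ : ∃ κ' > 0, κ' ≤ 1 ∧ κ' ≤ κ / (8 * ((c + 1) * (‖K‖ + 1))) :=
    ⟨min 1 (κ / (8 * ((c + 1) * (‖K‖ + 1)))), lt_min one_pos (div_pos hκ hden), min_le_left _ _,
      min_le_right _ _⟩
  rw [le_div_iff₀ hden] at hκ'2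
  have hκ'3 : c * (4 * κ' * (‖K‖ + 1)) ≤ κ / 2 := by
    have h2 : 0 ≤ κ' * (‖K‖ + 1) := by positivity
    linarith
  -- The sum `‖a‖ + ‖b‖` is at most `L ‖Ψ‖`, so after doubling `s` this choice costs `κ / 2`; the
  -- replacement of `a - b` by `K Ψ` costs the other half.
  refine ⟨κ', hκ'0, κ / (4 * L ^ 2), by positivity, fun a b Ψ s h1 h2 h3 => ?_⟩
  have h8 := mul_le_mul_of_nonneg_right hκ'1 (norm_nonneg Ψ)
  have hA1 : ‖a‖ ≤ (‖G‖ + 1) * ‖Ψ‖ := by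
    have h6 := norm_add_le (a - G Ψ) (G Ψ)
    rw [sub_add_cancel] at h6
    linarith [G.le_opNorm Ψ]
  have hA2 : ‖b‖ ≤ (‖P‖ + 1) * ‖Ψ‖ := by
    have h6 := norm_add_le (b - P Ψ) (P Ψ)
    rw [sub_add_cancel] at h6
    linarith [P.le_opNorm Ψ]
  have hu : ‖a - b - K Ψ‖ ≤ 2 * κ' * ‖Ψ‖ := by
    have h6 : a - b - K Ψ = (a - G Ψ) - (b - P Ψ) := by rw [hK]; abel
    rw [h6]
    exact (norm_sub_le _ _).trans (by linarith)
  have hKΨ := K.le_opNorm Ψ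
  have hu' : ‖a - b‖ ≤ (‖K‖ + 2) * ‖Ψ‖ := by
    have h6 := norm_add_le (a - b - K Ψ) (K Ψ)
    rw [sub_add_cancel] at h6
    linarith
  have h9 : κ / (4 * L ^ 2) * (‖a‖ + ‖b‖) ^ 2 ≤ κ / 4 * ‖Ψ‖ ^ 2 := by
    calc κ / (4 * L ^ 2) * (‖a‖ + ‖b‖) ^ 2 ≤ κ / (4 * L ^ 2) * (L * ‖Ψ‖) ^ 2 := by
          gcongr
          rw [hL]
          linarith
      _ = κ / 4 * ‖Ψ‖ ^ 2 := by field_simp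
  have h10 := abs_quadForm_sub_le A (a - b) (K Ψ)
  rw [← hc] at h10
  have h11 : c * (‖a - b - K Ψ‖ * (‖a - b‖ + ‖K Ψ‖)) ≤ κ / 2 * ‖Ψ‖ ^ 2 := by
    calc c * (‖a - b - K Ψ‖ * (‖a - b‖ + ‖K Ψ‖))
        ≤ c * ((2 * κ' * ‖Ψ‖) * ((‖K‖ + 2) * ‖Ψ‖ + ‖K‖ * ‖Ψ‖)) := by gcongr
      _ = c * (4 * κ' * (‖K‖ + 1)) * ‖Ψ‖ ^ 2 := by ring
      _ ≤ κ / 2 * ‖Ψ‖ ^ 2 := by gcongr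
  have h12 := abs_le.1 (h3.trans h9)
  have h13 := abs_le.1 (h10.trans h11)
  rw [abs_le]
  constructor <;> linarith [h12.1, h12.2, h13.1, h13.2]

end QuadForm

/-! ### The test statistic as a quadratic form in the normalized score. -/

section Statistic

variable {X : Type*} [MeasurableSpace X] [MeasurableSingletonClass X] {μ : Measure X} {p r : ℕ}
  {Θ ω : Set (Vec p)} {f : Vec p → X → ℝ} {h : Vec p → Vec r} {θ₀ : Vec p} {β γ lam : ℝ} {y : X}

/-- The test statistic is asymptotically a quadratic form in the normalized sum of the estimating
function. -/
theorem whp_sdtStat_sub_le (S : RegularModel μ Θ ω f θ₀ β y) (hR : RegularRestriction ω h θ₀)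
    (hS : SDivRegular μ f γ lam θ₀) (hγ : 0 ≤ γ) {ε : ℝ} (hε : 0 ≤ ε)
    {That Ttil : (n : ℕ) → (Fin n → X) → Vec p}
    (hThat : IsConsistentRoot (IsRootU μ Θ f β) (levelContam (modelMeasure μ f θ₀) ε y) θ₀ That)
    (hTtil : IsConsistentRoot (IsRootR μ Θ f β h) (levelContam (modelMeasure μ f θ₀) ε y) θ₀ Ttil)
    {κ : ℝ} (hκ : 0 < κ) :
    Whp (levelContam (modelMeasure μ f θ₀) ε y) fun n x =>
      |sdtStat μ f γ lam That Ttil n x -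
        (toEuclideanCLM (𝕜 := ℝ) (projMat (Jmat μ f β θ₀) (Hmat h θ₀))
          ((√(n : ℝ))⁻¹ • ∑ i, psi μ f β θ₀ (x i))).ofLp ⬝ᵥ Amat μ f γ lam θ₀ *ᵥ
        (toEuclideanCLM (𝕜 := ℝ) (projMat (Jmat μ f β θ₀) (Hmat h θ₀))
          ((√(n : ℝ))⁻¹ • ∑ i, psi μ f β θ₀ (x i))).ofLp| ≤
        κ * ‖(√(n : ℝ))⁻¹ • ∑ i, psi μ f β θ₀ (x i)‖ ^ 2 := by
  obtain ⟨κ', hκ', κ₁, hκ₁, hexp⟩ := exists_quadForm_error (Amat μ f γ lam θ₀)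
    (toEuclideanCLM (𝕜 := ℝ) (Jmat μ f β θ₀)⁻¹) (toEuclideanCLM (𝕜 := ℝ) (Pmat μ f β h θ₀))
    (toEuclideanCLM (𝕜 := ℝ) (projMat (Jmat μ f β θ₀) (Hmat h θ₀)))
    (fun w => by rw [Pmat_eq, map_sub, _root_.sub_apply, sub_sub_cancel]) hκ
  obtain ⟨δ, hδ, hball⟩ := Metric.mem_nhds_iff.1
    (hS.eventually_abs_sub_le S.basu S.density hγ hκ₁)
  -- The unrestricted estimator is treated as a restricted one with `r = 0`, for which `P` is `J⁻¹`.
  have hThat' := hThat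
  rw [← isRootR_zero_eq] at hThat'
  have e1 := hThat'.whp_expansion S (regularRestriction_zero ω θ₀) hε hκ'
  rw [Pmat_zero] at e1
  have e2 := hTtil.whp_expansion S hR hε hκ'
  have e3 : Whp (levelContam (modelMeasure μ f θ₀) ε y) fun n x => dist (That n x) θ₀ < δ := by
    simpa only [Whp, not_lt] using hThat.consistent δ hδ
  have e4 : Whp (levelContam (modelMeasure μ f θ₀) ε y) fun n x => dist (Ttil n x) θ₀ < δ := by
    simpa only [Whp, not_lt] using hTtil.consistent δ hδ
  refine ((e1.and e2).and (e3.and e4)).mono (Eventually.of_forall fun n x hx => ?_)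
  obtain ⟨⟨h1, h2⟩, h3, h4⟩ := hx
  -- The normalized sum is `√n` times the mean score, so both sides of the deterministic estimate
  -- are multiplied by `n`.
  have hWΨ : (√(n : ℝ))⁻¹ • ∑ i, psi μ f β θ₀ (x i) =
      √(n : ℝ) • ∫ z, psi μ f β θ₀ z ∂(empirical x) := by
    rw [integral_empirical, smul_smul, ← div_eq_mul_inv, Real.sqrt_div_self]
  have hn : (√(n : ℝ)) ^ 2 = n := Real.sq_sqrt (Nat.cast_nonneg n)
  rw [hWΨ, map_smul, quadForm_smul, norm_smul, mul_pow, Real.norm_eq_abs, sq_abs, hn]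
  have h5 := hball (show (That n x, Ttil n x) ∈ Metric.ball (θ₀, θ₀) δ by
    rw [Metric.mem_ball, Prod.dist_eq]; exact max_lt h3 h4)
  simp only [Set.mem_ofPred_eq] at h5
  have h6 := hexp _ _ _ _ h1 h2 (by rwa [sub_sub_sub_cancel_right])
  rw [sdtStat, mul_comm 2 (n : ℝ), mul_assoc, ← mul_sub, abs_mul, Nat.abs_cast, mul_left_comm]
  exact mul_le_mul_of_nonneg_left h6 (Nat.cast_nonneg n)

end Statistic

/-! ### The limit law of the test statistic -/

section LimitLaw

variable {X : Type*} [MeasurableSpace X] {μ : Measure X} {p r : ℕ}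
  {Θ ω : Set (Vec p)} {f : Vec p → X → ℝ} {h : Vec p → Vec r} {θ₀ : Vec p} {β γ lam : ℝ} {y : X}

theorem SigmaTilde_eq (μ : Measure X) (f : Vec p → X → ℝ) (β : ℝ) (h : Vec p → Vec r)
    (θ : Vec p) : SigmaTilde μ f β h θ =
      projMat (Jmat μ f β θ) (Hmat h θ) * Vmat μ f β θ * projMat (Jmat μ f β θ) (Hmat h θ) := by
  rw [SigmaTilde, Pmat_eq, sub_sub_cancel]

theorem rankMat_eq (μ : Measure X) (f : Vec p → X → ℝ) (β γ lam : ℝ) (h : Vec p → Vec r)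
    (θ : Vec p) : rankMat μ f β γ lam h θ =
      Vmat μ f β θ * projMat (Jmat μ f β θ) (Hmat h θ) * Amat μ f γ lam θ *
        projMat (Jmat μ f β θ) (Hmat h θ) * Vmat μ f β θ := by
  rw [rankMat, Pmat_eq, sub_sub_cancel]

theorem RegularModel.posDef_Vmat (S : RegularModel μ Θ ω f θ₀ β y) : (Vmat μ f β θ₀).PosDef :=
  S.basu.posDef_Vmat S.lehmann S.density S.nonneg S.integrable

theorem posSemidef_SigmaTilde (S : RegularModel μ Θ ω f θ₀ β y)
    (hR : RegularRestriction ω h θ₀) : (SigmaTilde μ f β h θ₀).PosSemidef := by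
  rw [SigmaTilde_eq]
  exact posSemidef_projMat_conj S.basu.J_posDef (hR.rank_eq θ₀ S.basu.mem)
    S.posDef_Vmat.posSemidef

theorem rank_SigmaTilde (S : RegularModel μ Θ ω f θ₀ β y)
    (hR : RegularRestriction ω h θ₀) : (SigmaTilde μ f β h θ₀).rank = r := by
  rw [SigmaTilde_eq]
  exact rank_projMat_conj S.basu.J_posDef (hR.rank_eq θ₀ S.basu.mem) S.posDef_Vmat

/-- The covariance `K V K` is singular in general, but the mean is in the range of `K`, which is the
range of `K V K`, so the diagonalization applies. -/
theorem quadFormLaw_smul_eq (S : RegularModel μ Θ ω f θ₀ β y) (hR : RegularRestriction ω h θ₀)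
    {A : Matrix (Fin p) (Fin p) ℝ} (hA : A.PosDef) {ζ : Fin r → ℝ} {v : Fin r → Vec p}
    (hζ : IsSpectralSystem A (SigmaTilde μ f β h θ₀) ζ v) (ε : ℝ) (z : Vec p) :
    quadFormLaw A (SigmaTilde μ f β h θ₀)
        (ε • toEuclideanCLM (𝕜 := ℝ) (projMat (Jmat μ f β θ₀) (Hmat h θ₀)) z) =
      wtdChiSqLaw ζ (sqrtDelta (SigmaTilde μ f β h θ₀) v
        (ε • toEuclideanCLM (𝕜 := ℝ) (projMat (Jmat μ f β θ₀) (Hmat h θ₀)) z)) := by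
  refine quadFormLaw_eq_wtdChiSqLaw hζ hA.posSemidef (posSemidef_SigmaTilde S hR) ?_
  obtain ⟨w, hw⟩ := exists_projMat_conj_mulVec_eq S.basu.J_posDef (hR.rank_eq θ₀ S.basu.mem)
    S.posDef_Vmat z.ofLp
  refine ⟨ε • w, ?_⟩
  rw [WithLp.ofLp_smul, ofLp_toEuclideanCLM, hw, SigmaTilde_eq, mulVec_smul]

variable [MeasurableSingletonClass X]

/-- The asymptotic distribution of the test statistic. -/
theorem tendsto_sdtStat (S : RegularModel μ Θ ω f θ₀ β y) (hR : RegularRestriction ω h θ₀)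
    (hS : SDivRegular μ f γ lam θ₀) (hr : 0 < r) (hγ : 0 ≤ γ) {ζ : Fin r → ℝ}
    {v : Fin r → Vec p}
    (hζ : IsSpectralSystem (Amat μ f γ lam θ₀) (SigmaTilde μ f β h θ₀) ζ v) {ε : ℝ} (hε : 0 ≤ ε)
    {That Ttil : (n : ℕ) → (Fin n → X) → Vec p}
    (hThat : IsConsistentRoot (IsRootU μ Θ f β) (levelContam (modelMeasure μ f θ₀) ε y) θ₀ That)
    (hTtil : IsConsistentRoot (IsRootR μ Θ f β h) (levelContam (modelMeasure μ f θ₀) ε y) θ₀ Ttil)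
    (t : ℝ) :
    Tendsto (fun n => (sampleLaw (levelContam (modelMeasure μ f θ₀) ε y) n).real
        {x | t < sdtStat μ f γ lam That Ttil n x}) atTop
      (𝓝 ((quadFormLaw (Amat μ f γ lam θ₀) (SigmaTilde μ f β h θ₀)
        (ε • toEuclideanCLM (𝕜 := ℝ) (projMat (Jmat μ f β θ₀) (Hmat h θ₀))
          (psi μ f β θ₀ y))).real (Set.Ioi t))) := by
  have hF := S.isProbabilityMeasure
  have hA := hS.posDef_Amat S.lehmann S.basu S.density hγ
  have hH := hR.rank_eq θ₀ S.basu.mem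
  have hJ := S.basu.J_posDef
  obtain ⟨ν, ν', hν', hν, hW⟩ := exists_tendsto_normalized_sum
    (S.basu.memLp_psi S.density S.nonneg S.integrable)
    (S.basu.integral_psi S.density S.nonneg S.integrable)
    (S.basu.Vmat_eq S.density S.nonneg S.integrable) S.posDef_Vmat.posSemidef hε y
  have hq := continuous_quadForm (Amat μ f γ lam θ₀)
  have hK := (toEuclideanCLM (𝕜 := ℝ) (projMat (Jmat μ f β θ₀) (Hmat h θ₀))).continuous
  -- The limit of the normalized sum is `N(ε ψ(y), V)`; its image under `K` is `N(ε K ψ(y), K V K)`.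
  have hmap : quadFormLaw (Amat μ f γ lam θ₀) (SigmaTilde μ f β h θ₀)
      (ε • toEuclideanCLM (𝕜 := ℝ) (projMat (Jmat μ f β θ₀) (Hmat h θ₀)) (psi μ f β θ₀ y)) =
      (ν' : Measure (Vec p)).map fun w =>
        (toEuclideanCLM (𝕜 := ℝ) (projMat (Jmat μ f β θ₀) (Hmat h θ₀)) w).ofLp ⬝ᵥ
          Amat μ f γ lam θ₀ *ᵥ
            (toEuclideanCLM (𝕜 := ℝ) (projMat (Jmat μ f β θ₀) (Hmat h θ₀)) w).ofLp := by
    rw [hν', quadFormLaw, SigmaTilde_eq, ← map_smul, ← map_mulVec_multivariateGaussian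
      S.posDef_Vmat.posSemidef (transpose_projMat hJ hH)
      (posSemidef_projMat_conj hJ hH S.posDef_Vmat.posSemidef),
      Measure.map_map hq.measurable hK.measurable]
    rfl
  have hc : Continuous fun w : Vec p =>
      (toEuclideanCLM (𝕜 := ℝ) (projMat (Jmat μ f β θ₀) (Hmat h θ₀)) w).ofLp ⬝ᵥ
        Amat μ f γ lam θ₀ *ᵥ
          (toEuclideanCLM (𝕜 := ℝ) (projMat (Jmat μ f β θ₀) (Hmat h θ₀)) w).ofLp := hq.comp hK
  have hm := hc.measurable
  have hζpos := hζ.pos hA.posSemidef (posSemidef_SigmaTilde S hR)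
  -- Atoms are excluded through the chi-square form of the limit law.
  have hatom : (ν' : Measure (Vec p)) {w |
      (toEuclideanCLM (𝕜 := ℝ) (projMat (Jmat μ f β θ₀) (Hmat h θ₀)) w).ofLp ⬝ᵥ
        Amat μ f γ lam θ₀ *ᵥ
          (toEuclideanCLM (𝕜 := ℝ) (projMat (Jmat μ f β θ₀) (Hmat h θ₀)) w).ofLp = t} = 0 := by
    have h1 := wtdChiSqLaw_singleton hr hζpos (sqrtDelta (SigmaTilde μ f β h θ₀) v
        (ε • toEuclideanCLM (𝕜 := ℝ) (projMat (Jmat μ f β θ₀) (Hmat h θ₀)) (psi μ f β θ₀ y))) t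
    rw [← quadFormLaw_smul_eq S hR hA hζ, hmap] at h1
    exact (Measure.map_apply hm (measurableSet_singleton t)).symm.trans h1
  rw [hmap, map_measureReal_apply hm measurableSet_Ioi]
  exact tendsto_sampleLaw_lt hc hν hW
    (fun κ hκ => whp_sdtStat_sub_le S hR hS hγ hε hThat hTtil hκ) hatom

end LimitLaw

end

end SDT

/-! ### The asymptotic distribution and level of the test. -/

theorem corollary2
    {X : Type*} [MeasurableSpace X] [MeasurableSingletonClass X]
    (μ : Measure X) [SigmaFinite μ] {p r : ℕ} (hr : 0 < r)
    (Θ ω : Set (SDT.Vec p)) (f : SDT.Vec p → X → ℝ) (h : SDT.Vec p → SDT.Vec r)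
    (θ₀ : SDT.Vec p) (β γ lam α : ℝ)
    (hβ : 0 ≤ β) (hγ₀ : 0 ≤ γ) (hγ₁ : γ ≤ 1) (hα₀ : 0 < α) (hα₁ : α < 1)
    -- the model, the regularity conditions and the restrictions
    (hf : SDT.IsDensityFamily μ Θ f)
    (hL : SDT.LehmannConditions μ Θ ω f θ₀)
    (hB : SDT.BasuConditions μ Θ ω f β θ₀)
    (hV : Integrable (fun x => ‖SDT.score f θ₀ x‖ ^ 2 * f θ₀ x ^ (1 + 2 * β)) μ)
    (hS : SDT.SDivRegular μ f γ lam θ₀)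
    (hh : ContDiffOn ℝ 1 h ω) (hH : ∀ θ ∈ ω, (SDT.Hmat h θ).rank = r) (hθ₀ : h θ₀ = 0)
    -- the contamination point
    (y : X) (hy : 0 < f θ₀ y) (hy_smooth : ContDiffOn ℝ 3 (fun t => f t y) ω) :
    -- consistent roots of the unrestricted and of the restricted estimating equations exist
    (∃ That Ttil : (n : ℕ) → (Fin n → X) → SDT.Vec p, ∀ ε : ℝ, 0 ≤ ε →
      SDT.IsConsistentRoot (SDT.IsRootU μ Θ f β)
        (SDT.levelContam (SDT.modelMeasure μ f θ₀) ε y) θ₀ That ∧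
      SDT.IsConsistentRoot (SDT.IsRootR μ Θ f β h)
        (SDT.levelContam (SDT.modelMeasure μ f θ₀) ε y) θ₀ Ttil) ∧
    -- so do the two functionals
    (∃ U Util : Measure X → SDT.Vec p,
      SDT.IsRootFunctional (SDT.IsRootU μ Θ f β) (SDT.modelMeasure μ f θ₀) y θ₀ U ∧
      SDT.IsRootFunctional (SDT.IsRootR μ Θ f β h) (SDT.modelMeasure μ f θ₀) y θ₀ Util) ∧
    -- the number of restrictions is the rank, and the nonzero eigenvalues are `r` in number
    (SDT.rankMat μ f β γ lam h θ₀).rank = r ∧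
    (∃ (ζ : Fin r → ℝ) (v : Fin r → SDT.Vec p), SDT.IsSpectralSystem
      (SDT.Amat μ f γ lam θ₀) (SDT.SigmaTilde μ f β h θ₀) ζ v) ∧
    -- the asymptotic distribution and level, for every version of the functionals and estimators
    (∀ U Util : Measure X → SDT.Vec p,
      SDT.IsRootFunctional (SDT.IsRootU μ Θ f β) (SDT.modelMeasure μ f θ₀) y θ₀ U →
      SDT.IsRootFunctional (SDT.IsRootR μ Θ f β h) (SDT.modelMeasure μ f θ₀) y θ₀ Util →
      DifferentiableWithinAt ℝ
        (fun t => U (SDT.contam (SDT.modelMeasure μ f θ₀) t y)) (Set.Ici 0) 0 ∧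
      DifferentiableWithinAt ℝ
        (fun t => Util (SDT.contam (SDT.modelMeasure μ f θ₀) t y)) (Set.Ici 0) 0 ∧
      ∀ D : SDT.Vec p,
        D = SDT.influence U (SDT.modelMeasure μ f θ₀) y
          - SDT.influence Util (SDT.modelMeasure μ f θ₀) y →
      ∀ (ζ : Fin r → ℝ) (v : Fin r → SDT.Vec p),
        SDT.IsSpectralSystem (SDT.Amat μ f γ lam θ₀) (SDT.SigmaTilde μ f β h θ₀) ζ v →
      ∀ tα : ℝ, tα = SDT.quantile (SDT.wtdChiSqLaw ζ 0) (1 - α) →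
      (∀ ε : ℝ, 0 ≤ ε → ∀ That Ttil : (n : ℕ) → (Fin n → X) → SDT.Vec p,
        SDT.IsConsistentRoot (SDT.IsRootU μ Θ f β)
          (SDT.levelContam (SDT.modelMeasure μ f θ₀) ε y) θ₀ That →
        SDT.IsConsistentRoot (SDT.IsRootR μ Θ f β h)
          (SDT.levelContam (SDT.modelMeasure μ f θ₀) ε y) θ₀ Ttil →
        -- the asymptotic distribution, in its two forms
        (∀ t : ℝ, Tendsto (fun n => (SDT.sampleLaw
            (SDT.levelContam (SDT.modelMeasure μ f θ₀) ε y) n).real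
              {x | t < SDT.sdtStat μ f γ lam That Ttil n x}) atTop
          (𝓝 ((SDT.quadFormLaw (SDT.Amat μ f γ lam θ₀) (SDT.SigmaTilde μ f β h θ₀)
            (ε • D)).real (Set.Ioi t)))) ∧
        SDT.quadFormLaw (SDT.Amat μ f γ lam θ₀) (SDT.SigmaTilde μ f β h θ₀) (ε • D)
          = SDT.wtdChiSqLaw ζ (SDT.sqrtDelta (SDT.SigmaTilde μ f β h θ₀) v (ε • D)) ∧
        -- the asymptotic level
        Summable (SDT.seriesTerm ζ
          (SDT.sqrtDelta (SDT.SigmaTilde μ f β h θ₀) v (ε • D)) tα) ∧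
        Tendsto (fun n => (SDT.sampleLaw
            (SDT.levelContam (SDT.modelMeasure μ f θ₀) ε y) n).real
              {x | tα < SDT.sdtStat μ f γ lam That Ttil n x}) atTop
          (𝓝 (∑' k, SDT.seriesTerm ζ
            (SDT.sqrtDelta (SDT.SigmaTilde μ f β h θ₀) v (ε • D)) tα k))) ∧
      -- the case `ε = 0`: the null distribution, and the level `α`
      (∀ n, SDT.levelContam (SDT.modelMeasure μ f θ₀) 0 y n = SDT.modelMeasure μ f θ₀) ∧
      SDT.quadFormLaw (SDT.Amat μ f γ lam θ₀) (SDT.SigmaTilde μ f β h θ₀) ((0 : ℝ) • D)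
        = SDT.wtdChiSqLaw ζ 0 ∧
      ∑' k, SDT.seriesTerm ζ
        (SDT.sqrtDelta (SDT.SigmaTilde μ f β h θ₀) v ((0 : ℝ) • D)) tα k = α) := by
  have S : SDT.RegularModel μ Θ ω f θ₀ β y := ⟨hf, hL, hB, hβ, hV,
    ⟨fun θ hθ => (hB.common_support θ (hB.subset hθ) y).2 hy, hy_smooth⟩⟩
  have hR : SDT.RegularRestriction ω h θ₀ := ⟨hh, hH, hθ₀⟩
  have hR₀ := SDT.regularRestriction_zero ω θ₀
  have hA := hS.posDef_Amat hL hB hf hγ₀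
  have hSig := SDT.posSemidef_SigmaTilde S hR
  refine ⟨?_, ?_, ?_, SDT.exists_isSpectralSystem hA hSig (SDT.rank_SigmaTilde S hR), ?_⟩
  · obtain ⟨That, hThat⟩ := SDT.exists_isConsistentRoot S hR₀
    obtain ⟨Ttil, hTtil⟩ := SDT.exists_isConsistentRoot S hR
    rw [SDT.isRootR_zero_eq] at hThat
    exact ⟨That, Ttil, fun ε hε => ⟨hThat ε hε, hTtil ε hε⟩⟩
  · obtain ⟨U, hU⟩ := SDT.exists_isRootFunctional S hR₀
    obtain ⟨Util, hUtil⟩ := SDT.exists_isRootFunctional S hR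
    rw [SDT.isRootR_zero_eq] at hU
    exact ⟨U, Util, hU, hUtil⟩
  · rw [SDT.rankMat_eq]
    exact SDT.rank_conj_projMat_conj hB.J_posDef (hH θ₀ hB.mem) S.posDef_Vmat hA
  · intro U Util hU hUtil
    rw [← SDT.isRootR_zero_eq] at hU
    have hU' := hU.hasDerivWithinAt S hR₀
    have hUtil' := hUtil.hasDerivWithinAt S hR
    refine ⟨hU'.differentiableWithinAt, hUtil'.differentiableWithinAt, ?_⟩
    intro D hD ζ v hζ tα htα
    have huniq : UniqueDiffWithinAt ℝ (Set.Ici (0 : ℝ)) 0 := uniqueDiffOn_Ici 0 0 Set.self_mem_Ici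
    -- The two influence functions are `J⁻¹ ψ(y)` and `P ψ(y)`, whose difference is `K ψ(y)`,
    -- exactly the shift in the limit law.
    have hD' : D = toEuclideanCLM (𝕜 := ℝ)
        (SDT.projMat (SDT.Jmat μ f β θ₀) (SDT.Hmat h θ₀)) (SDT.psi μ f β θ₀ y) := by
      rw [hD, SDT.influence, SDT.influence, hU'.derivWithin huniq, hUtil'.derivWithin huniq,
        SDT.Pmat_zero, SDT.Pmat_eq, map_sub, _root_.sub_apply, sub_sub_cancel]
    have hζpos := hζ.pos hA.posSemidef hSig
    have hlaw : ∀ ε : ℝ, SDT.quadFormLaw (SDT.Amat μ f γ lam θ₀) (SDT.SigmaTilde μ f β h θ₀)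
        (ε • D) = SDT.wtdChiSqLaw ζ (SDT.sqrtDelta (SDT.SigmaTilde μ f β h θ₀) v (ε • D)) :=
      fun ε => by rw [hD']; exact SDT.quadFormLaw_smul_eq S hR hA hζ ε _
    have hsum : ∀ ε : ℝ, HasSum (SDT.seriesTerm ζ
        (SDT.sqrtDelta (SDT.SigmaTilde μ f β h θ₀) v (ε • D)) tα) _ := fun ε =>
      SDT.hasSum_seriesTerm hr hζpos _ tα
    have hzero : SDT.sqrtDelta (SDT.SigmaTilde μ f β h θ₀) v ((0 : ℝ) • D) = 0 := by
      funext i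
      simp [SDT.sqrtDelta]
    refine ⟨fun ε hε That Ttil hThat hTtil => ?_, fun n => ?_, ?_, ?_⟩
    · have hlim := fun t => SDT.tendsto_sdtStat S hR hS hr hγ₀ hζ hε hThat hTtil t
      rw [← hD'] at hlim
      refine ⟨hlim, hlaw ε, (hsum ε).summable, ?_⟩
      rw [(hsum ε).tsum_eq, ← hlaw ε]
      exact hlim tα
    · rw [SDT.levelContam, zero_div, SDT.contam_zero]
    · rw [hlaw 0, hzero]
    · rw [(hsum 0).tsum_eq, hzero, htα, SDT.wtdChiSqLaw_Ioi_quantile hr hζpos hα₀ hα₁]
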